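/- Let $N\ge 1$, $I=[-T,T]$ with $|I|=2T\ge 1$. Let $G\colon\mathbb R^N\to[0,\infty)$ be a $C^1$ G-function: $G$ is convex, even, $G(0)=0$, $G(x)/|x|\to\infty$ as $|x|\to\infty$, and $G$ satisfies at infinity the conditions $\Delta_2$ (there are $C,M_1$ with $G(2x)\le C\,G(x)$ for $|x|\ge M_1$) and $\nabla_2$ (there are $k>1$, $M_2$ with $G(x)\le \frac1{2k}G(kx)$ for $|x|\ge M_2$). Let $G^*(y)=\sup_{x}(\langle x,y\rangle-G(x))$, let $L^G=\{u\colon I\to\mathbb R^N \text{ measurable}:\int_I G(u)\,dt<\infty\}$ with the Luxemburg norm $\|u\|_{L^G}=\inf\{\lambda>0:\int_I G(u/\lambda)\,dt\le1\}$ (and $L^{G^*}$ likewise), let $W^1L^G$ be the space of absolutely continuous $u\colon I\to\mathbb R^N$ with $u,\dot u\in L^G$, normed by $\|u\|_{L^G}+\|\dot u\|_{L^G}$, and let $W^1_TL^G=\{u\in W^1L^G: u(-T)=u(T)\}$. Let $F\in C^1(I\times\mathbb R^N\times\mathbb R^N,\mathbb R)$ be such that for all $t\in I$, $x,v\in\mathbb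 R^N$: (F1) $F(t,x,\cdot)$ is convex; (F2) for some $a\in C([0,\infty),[0,\infty))$ and $\beta\in L^1(I,[0,\infty))$, $|F(t,x,v)|\le a(|x|)(\beta(t)+G(v))$, $|F_x(t,x,v)|\le a(|x|)(\beta(t)+G(v))$ and $G^*(F_v(t,x,v))\le a(|x|)(\beta(t)+G^*(\nabla G(v)))$; (F3) $\langle F_x(t,x,v),x\rangle+\langle F_v(t,x,v),v\rangle\le\theta_F F(t,x,v)$, for some constant $\theta_F>0$; (F4) $F(t,x,v)\ge\Lambda G(v)$, for some constant $\Lambda>0$; (F5) $F(t,x,0)=0$ and $F_v(t,x,0)=0$. Let $V\in C^1(I\times\mathbb R^N,\mathbb R)$ be such that: (V1) $V=K-W$ on $I\times\mathbb R^N$ for some functions $K,W\colon I\times\mathbb R^N\to\mathbb R$; (V2) there are $M>0$, $\varepsilon_V>0$, $\theta_V>\theta_F$ and $1<p_K\le\theta_V-\varepsilon_V$ such that, for $t\in I$ and $|x|>M$, $\langle V_x(t,x),x\rangle\le(\theta_V-\varepsilon_V)K(t,x)-\theta_V W(t,x)$ and $W(t,x)>K(t,x)>|x|^{p_K}$; (V3)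 there are $\rho>0$, $b>1$ and $g\in L^1(I,\mathbb R)$ such that $V(t,x)\ge b\,G(x)-g(t)$ whenever $t\in I$ and $G\big(x/(2|I|)\big)\le\rho/2$; (V4) $\int_I V(t,0)\,dt=0$. Finally let $f\in L^{G^*}$ satisfy (f) $\int_I \big(G^*(f(t))+g(t)\big)\,dt<\min\{\Lambda,b-1\}\,\rho$. Put $\mathcal L(t,x,v)=F(t,x,v)+V(t,x)+\langle f(t),x\rangle$. Then the functional $\mathcal J(u)=\int_I\mathcal L(t,u,\dot u)\,dt$ is well defined on $W^1_TL^G$, and the system $$\frac{d}{dt}\mathcal L_v(t,u,\dot u)=\mathcal L_x(t,u,\dot u)\ \text{ for a.e. } t\in I,\qquad u(-T)=u(T)$$ has at least one solution $u_1\in W^1L^G$ with $u_1\not\equiv0$ (where the equation means that $\mathcal L_v(t,u_1,\dot u_1)$ coincides a.e. with an absolutely continuous function whose derivative is $\mathcal L_x(t,u_1,\dot u_1)$ a.e.). Moreover $u_1$ can be taken to be a mountain-pass critical point of $\mathcal J$ on $W^1_TL^G$: with $\Omega=\{u\in W^1_TL^G:\int_I G(\dot u)+G(u)\,dt<\rho\}$,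 one has $\mathcal J(0)=0$ and $\inf_{\partial\Omega}\mathcal J>0$, and there is $e\in W^1_TL^G$ with $\int_I G(\dot e)+G(e)\,dt>\rho$ and $\mathcal J(e)<0$ such that $\mathcal J$ is Fréchet differentiable at $u_1$ with $\mathcal J'(u_1)=0$ and $$\mathcal J(u_1)=c_1:=\inf_{\gamma\in\Gamma}\max_{s\in[0,1]}\mathcal J(\gamma(s))>0,\qquad \Gamma=\{\gamma\in C([0,1],W^1_TL^G):\gamma(0)=0,\ \gamma(1)=e\}.$$ -/

import Mathlib

open Set Filter Topology MeasureTheory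

noncomputable section

namespace AnisotropicEL

/-- `ℝᴺ` with the Euclidean norm. -/
abbrev E (N : ℕ) : Type := EuclideanSpace ℝ (Fin N)

variable {N : ℕ}

/-- A continuously differentiable G-function satisfying `Δ₂` and `∇₂` at infinity. -/
structure IsGFunction (G : E N → ℝ) : Prop where
  contDiff : ContDiff ℝ 1 G
  nonneg : ∀ x, 0 ≤ G x
  convex : ConvexOn ℝ univ G
  even : ∀ x, G (-x) = G x
  zero : G 0 = 0
  superlinear : Tendsto (fun x => G x / ‖x‖) (Bornology.cobounded (E N)) atTop
  delta2 : ∃ C M : ℝ, ∀ x, M ≤ ‖x‖ → G ((2 : ℝ) • x) ≤ C * G x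
  nabla2 : ∃ k M : ℝ, 1 < k ∧ ∀ x, M ≤ ‖x‖ → G x ≤ 1 / (2 * k) * G (k • x)

/-- The Fenchel conjugate `G*(y) = sup_x (⟨x, y⟩ - G x)`, a finite supremum for a G-function. -/
def conj (G : E N → ℝ) (y : E N) : ℝ := ⨆ x : E N, (inner ℝ x y - G x)

/-- The Orlicz class `L^G(I, ℝᴺ)`, `I = [-T, T]`. -/
def LG (G : E N → ℝ) (T : ℝ) : Set (ℝ → E N) :=
  {u | AEStronglyMeasurable u (volume.restrict (Icc (-T) T)) ∧
    IntegrableOn (fun t => G (u t)) (Icc (-T) T)}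

/-- The Luxemburg norm on `L^G(I, ℝᴺ)`. -/
def normLG (G : E N → ℝ) (T : ℝ) (u : ℝ → E N) : ℝ :=
  sInf {l : ℝ | 0 < l ∧ IntegrableOn (fun t => G (l⁻¹ • u t)) (Icc (-T) T) ∧
    ∫ t in Icc (-T) T, G (l⁻¹ • u t) ≤ 1}

/-- The Orlicz–Sobolev space `W¹L^G(I, ℝᴺ)`; each element is given by its absolutely continuous
representative, whose values outside `I` play no role. -/
def WLG (G : E N → ℝ) (T : ℝ) : Set (ℝ → E N) :=
  {u | AbsolutelyContinuousOnInterval u (-T) T ∧ u ∈ LG G T ∧ deriv u ∈ LG G T}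

/-- The norm of `W¹L^G(I, ℝᴺ)`. -/
def normWLG (G : E N → ℝ) (T : ℝ) (u : ℝ → E N) : ℝ :=
  normLG G T u + normLG G T (deriv u)

/-- The subspace of `W¹L^G(I, ℝᴺ)` given by `u(-T) = u(T)`. -/
def WLGT (G : E N → ℝ) (T : ℝ) : Set (ℝ → E N) :=
  {u | u ∈ WLG G T ∧ u (-T) = u T}

/-- `Φ(u) = ∫_I G(u̇) + G(u) dt`. -/
def Phi (G : E N → ℝ) (T : ℝ) (u : ℝ → E N) : ℝ :=
  ∫ t in Icc (-T) T, (G (deriv u t) + G (u t))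

/-- The set `Ω = {Φ < ρ}`. -/
def Omega (G : E N → ℝ) (T ρ : ℝ) : Set (ℝ → E N) :=
  {u | u ∈ WLGT G T ∧ Phi G T u < ρ}

/-- The boundary of `Ω` in the space of periodic functions, for the norm `normWLG`. -/
def boundaryOmega (G : E N → ℝ) (T ρ : ℝ) : Set (ℝ → E N) :=
  {u | u ∈ WLGT G T ∧ ∀ ε > 0, (∃ v ∈ Omega G T ρ, normWLG G T (v - u) < ε) ∧
    ∃ v ∈ WLGT G T, v ∉ Omega G T ρ ∧ normWLG G T (v - u) < ε}

/-- The Lagrangian `F(t, x, v) + V(t, x) + ⟨f(t), x⟩`. -/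
def lagr (F : ℝ → E N → E N → ℝ) (V : ℝ → E N → ℝ) (f : ℝ → E N) (t : ℝ) (x v : E N) : ℝ :=
  F t x v + V t x + inner ℝ (f t) x

/-- The partial gradient `L_x` of a function `L(t, x, v)`. -/
def gradX (L : ℝ → E N → E N → ℝ) (t : ℝ) (x v : E N) : E N := gradient (fun y => L t y v) x

/-- The partial gradient `L_v` of a function `L(t, x, v)`. -/
def gradV (L : ℝ → E N → E N → ℝ) (t : ℝ) (x v : E N) : E N := gradient (fun w => L t x w) v

/-- The action functional `∫_I L(t, u, u̇) dt`. -/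
def action (L : ℝ → E N → E N → ℝ) (T : ℝ) (u : ℝ → E N) : ℝ :=
  ∫ t in Icc (-T) T, L t (u t) (deriv u t)

/-- `u ∈ W¹L^G` solves `d/dt L_v(t, u, u̇) = L_x(t, u, u̇)` a.e. in `I`, `u(-T) = u(T)`: the function
`L_v(t, u, u̇)`, which is defined almost everywhere, has an absolutely continuous representative `p`,
and `ṗ = L_x(t, u, u̇)` a.e. -/
def IsPeriodicSolution (G : E N → ℝ) (L : ℝ → E N → E N → ℝ) (T : ℝ) (u : ℝ → E N) : Prop :=
  u ∈ WLG G T ∧ u (-T) = u T ∧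
  ∃ p : ℝ → E N, AbsolutelyContinuousOnInterval p (-T) T ∧
    (∀ᵐ t ∂(volume.restrict (Icc (-T) T)), p t = gradV L t (u t) (deriv u t)) ∧
    (∀ᵐ t ∂(volume.restrict (Icc (-T) T)), HasDerivAt p (gradX L t (u t) (deriv u t)) t)

/-- `u` is a critical point of `J` on the space of periodic functions: `J` is Fréchet differentiable
at `u` with derivative `0`. -/
def IsCriticalPt (G : E N → ℝ) (T : ℝ) (J : (ℝ → E N) → ℝ) (u : ℝ → E N) : Prop :=
  u ∈ WLGT G T ∧ ∀ ε > 0, ∃ δ > 0, ∀ φ ∈ WLGT G T, normWLG G T φ < δ →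
    |J (u + φ) - J u| ≤ ε * normWLG G T φ

/-- Norm-continuous paths `γ : [0, 1] → W¹_T L^G` from `0` to `e`. -/
def Paths (G : E N → ℝ) (T : ℝ) (e : ℝ → E N) : Set (ℝ → ℝ → E N) :=
  {γ | (∀ s ∈ Icc (0 : ℝ) 1, γ s ∈ WLGT G T) ∧
    (∀ s ∈ Icc (0 : ℝ) 1,
      Tendsto (fun r => normWLG G T (γ r - γ s)) (𝓝[Icc 0 1] s) (𝓝 0)) ∧
    EqOn (γ 0) 0 (Icc (-T) T) ∧ EqOn (γ 1) e (Icc (-T) T)}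

/-- `c = inf_γ max_{s ∈ [0, 1]} J(γ(s))`, the infimum over all paths from `0` to `e`. -/
def IsMountainPassLevel (G : E N → ℝ) (T : ℝ) (J : (ℝ → E N) → ℝ) (e : ℝ → E N) (c : ℝ) : Prop :=
  (∀ γ ∈ Paths G T e, ∃ m, IsGreatest ((fun s => J (γ s)) '' Icc (0 : ℝ) 1) m) ∧
  IsGLB {m : ℝ | ∃ γ ∈ Paths G T e, IsGreatest ((fun s => J (γ s)) '' Icc (0 : ℝ) 1) m} c

end AnisotropicEL

end

open AnisotropicEL

/-! The solution is a mountain-pass critical point of `J = action (lagr F V f) T`. `IsYoung`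
collects the properties shared by `G` and `conj G`, so that each fact about Orlicz classes is proved
once for both; `Δ₂` for `conj G` comes from `∇₂` for `G`. On the complete seminormed space
`PeriodicSpace`, where functions that agree on `I` have distance zero, growth (F2) makes `J`
continuously differentiable.

Geometry. Convexity and Jensen's inequality give `G(u(t)/(2|I|)) ≤ Φ(u)/2`, so on `{Φ = ρ}`
hypothesis (V3) applies at every time; with (F4) and the Fenchel–Young inequality, `J ≥ min{Λ, b-1}
ρ - ∫ (G*(f) + g) > 0` there. Along a ray, (V2) forces `V(t, r x₀) ≤ r^q V(t, x₀)` with `q = θ_V -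
ε_V > 1` and `V(t, x₀) < 0`, which beats the linear forcing term, so a large constant `e` has `J(e)
< 0`. Every path from `0` to `e` crosses `{Φ = ρ}`, hence the minimax level is positive.

Almost critical points. Ekeland's principle on the space of paths (`exists_almost_critical`) yields
`u_n` with `J(u_n) → c₁` and `J'(u_n) → 0`. Since `θ_V J(u) - J'(u)u` controls `∫ G(u̇)` and any
multiple of `∫ |u|` up to lower-order terms (`exists_coercive_bound`), the sequence is bounded.
Superlinearity of `G` makes the derivatives equi-integrable, so a subsequence converges uniformly to
some `U`, with derivatives converging weakly against `L^{G*}` (`exists_weak_limit`).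

Passage to the limit. `F` is merely convex in `v`, so norm convergence of the derivatives cannot be
expected. Convexity used in both directions still gives `J(u_n) → J(U)`
(`tendsto_action_of_dAction`). Consequently the nonnegative convexity excess of `L` between `U̇` and
`u̇_n` tends to zero in `L¹`, and this produces one integrable majorant of `G(u̇_n)` along a
subsequence (`exists_subseq_deriv_dominated`). Lower semicontinuity at `U + sφ`, the convergence of
`J(u_n)` and the mean value theorem bound `(J(U + sφ) - J(U))/s` by a derivative of `J` close to
`J'(u_n)φ`, so `J'(U)φ ≤ 0` for all `φ` (`dAction_eq_zero_of_tendstoWeakly`). The du Bois-Reymond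
lemma turns `J'(U) = 0` into the equation, and `J(U) = c₁ > 0 = J(0)` excludes `U ≡ 0`. -/

namespace AnisotropicEL

/-! ### Young functions, Fenchel conjugates and convexity inequalities. -/

variable {N : ℕ} {G H : E N → ℝ}

/-- A finite even convex function vanishing at the origin, superlinear at infinity and satisfying
the doubling condition up to an additive constant. -/
structure IsYoung (H : E N → ℝ) : Prop where
  continuous : Continuous H
  nonneg : ∀ x, 0 ≤ H x
  convex : ConvexOn ℝ univ H
  even : ∀ x, H (-x) = H x
  zero : H 0 = 0
  coercive : ∀ ε > 0, ∃ C ≥ 0, ∀ x, ‖x‖ ≤ ε * H x + C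
  doubling : ∃ C ≥ 0, ∀ x, H ((2 : ℝ) • x) ≤ C * (H x + 1)

namespace IsYoung

variable (hH : IsYoung H)
include hH

lemma smul_le {s : ℝ} (hs : 0 ≤ s) (hs1 : s ≤ 1) (x : E N) : H (s • x) ≤ s * H x := by
  have := hH.convex.2 (mem_univ x) (mem_univ (0 : E N)) hs (sub_nonneg.2 hs1) (by ring)
  simpa [hH.zero] using this

lemma exists_bound_closedBall (R : ℝ) : ∃ C ≥ 0, ∀ x : E N, ‖x‖ ≤ R → H x ≤ C := by
  obtain ⟨C, hC⟩ := (isCompact_closedBall (0 : E N) R).exists_bound_of_continuousOn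
    hH.continuous.continuousOn
  refine ⟨max C 0, le_max_right _ _, fun x hx => ?_⟩
  exact (le_abs_self _).trans ((hC x (by simpa using hx)).trans (le_max_left _ _))

/-- Doubling is iterated until `2 ^ n` exceeds `l`. The uniformity in `s` is what later supplies
integrable majorants. -/
lemma exists_smul_le (l : ℝ) :
    ∃ C ≥ 0, ∀ s : ℝ, |s| ≤ l → ∀ x, H (s • x) ≤ C * (H x + 1) := by
  obtain ⟨D, hD0, hD⟩ := hH.doubling
  have key : ∀ n : ℕ, ∃ C ≥ 0, ∀ x, H (((2 : ℝ) ^ n) • x) ≤ C * (H x + 1) := by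
    intro n
    induction n with
    | zero => exact ⟨1, zero_le_one, fun x => by simp⟩
    | succ n ih =>
      obtain ⟨C, hC0, hC⟩ := ih
      refine ⟨D * (C + 1), by positivity, fun x => ?_⟩
      have h1 := hD (((2 : ℝ) ^ n) • x)
      rw [smul_smul, ← pow_succ'] at h1
      have h2 := hC x
      have h3 := hH.nonneg x
      calc _ ≤ _ := h1
        _ ≤ D * (C * (H x + 1) + 1) := by gcongr
        _ ≤ D * (C + 1) * (H x + 1) := by nlinarith [mul_nonneg hD0 h3]
  obtain ⟨n, hn⟩ := pow_unbounded_of_one_lt l (one_lt_two : (1 : ℝ) < 2)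
  obtain ⟨C, hC0, hC⟩ := key n
  refine ⟨C, hC0, fun s hs x => ?_⟩
  have habs : H (s • x) = H (|s| • x) := by
    rcases abs_cases s with ⟨h, _⟩ | ⟨h, _⟩ <;> rw [h]
    rw [neg_smul, hH.even]
  have h2 : (0 : ℝ) < 2 ^ n := by positivity
  have h1 : |s| • x = (|s| / 2 ^ n) • ((2 : ℝ) ^ n • x) := by
    rw [smul_smul, div_mul_cancel₀ _ h2.ne']
  have hle : |s| / 2 ^ n ≤ 1 := (div_le_one h2).2 (hs.trans hn.le)
  rw [habs, h1]
  calc _ ≤ (|s| / 2 ^ n) * H ((2 : ℝ) ^ n • x) := hH.smul_le (by positivity) hle _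
    _ ≤ 1 * H ((2 : ℝ) ^ n • x) := by gcongr; exact hH.nonneg _
    _ ≤ _ := by rw [one_mul]; exact hC x

lemma add_le_two_smul (x y : E N) :
    H (x + y) ≤ H ((2 : ℝ) • x) + H ((2 : ℝ) • y) := by
  have := hH.convex.2 (mem_univ ((2 : ℝ) • x)) (mem_univ ((2 : ℝ) • y))
    (show (0 : ℝ) ≤ 1 / 2 by norm_num) (show (0 : ℝ) ≤ 1 / 2 by norm_num) (by norm_num)
  have h1 := hH.nonneg ((2 : ℝ) • x)
  have h2 := hH.nonneg ((2 : ℝ) • y)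
  simp only [smul_smul, smul_eq_mul] at this
  norm_num at this
  linarith

lemma exists_add_le (l : ℝ) :
    ∃ C ≥ 0, ∀ s r : ℝ, |s| ≤ l → |r| ≤ l → ∀ x y,
      H (s • x + r • y) ≤ C * (H x + H y + 1) := by
  obtain ⟨C, hC0, hC⟩ := hH.exists_smul_le (2 * l)
  refine ⟨2 * C, by positivity, fun s r hs hr x y => ?_⟩
  have h1 := hH.add_le_two_smul (s • x) (r • y)
  rw [smul_smul, smul_smul] at h1
  have h2 := hC (2 * s) (by rw [abs_mul, abs_two]; linarith) x
  have h3 := hC (2 * r) (by rw [abs_mul, abs_two]; linarith) y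
  nlinarith [mul_nonneg hC0 (hH.nonneg x), mul_nonneg hC0 (hH.nonneg y)]

variable {α : Type*} {m : MeasurableSpace α} {μ : Measure α} {u v : α → E N}

lemma aestronglyMeasurable_comp (hu : AEStronglyMeasurable u μ) :
    AEStronglyMeasurable (fun t => H (u t)) μ :=
  hH.continuous.comp_aestronglyMeasurable hu

lemma integrable_lin [IsFiniteMeasure μ] (hu : AEStronglyMeasurable u μ)
    (hv : AEStronglyMeasurable v μ)
    (hHu : Integrable (fun t => H (u t)) μ) (hHv : Integrable (fun t => H (v t)) μ) (s r : ℝ) :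
    Integrable (fun t => H (s • u t + r • v t)) μ := by
  obtain ⟨C, hC0, hC⟩ := hH.exists_add_le (max |s| |r|)
  refine Integrable.mono' (((hHu.add hHv).add (integrable_const 1)).const_mul C)
    (hH.aestronglyMeasurable_comp ((hu.const_smul s).add (hv.const_smul r)))
    (Eventually.of_forall fun t => ?_)
  rw [Real.norm_of_nonneg (hH.nonneg _)]
  exact hC s r (le_max_left _ _) (le_max_right _ _) _ _

lemma integrable_smul [IsFiniteMeasure μ] (hu : AEStronglyMeasurable u μ)
    (hHu : Integrable (fun t => H (u t)) μ) (s : ℝ) :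
    Integrable (fun t => H (s • u t)) μ := by
  simpa using hH.integrable_lin hu hu hHu hHu s 0

lemma integrable_add [IsFiniteMeasure μ] (hu : AEStronglyMeasurable u μ)
    (hv : AEStronglyMeasurable v μ)
    (hHu : Integrable (fun t => H (u t)) μ) (hHv : Integrable (fun t => H (v t)) μ) :
    Integrable (fun t => H (u t + v t)) μ := by
  simpa using hH.integrable_lin hu hv hHu hHv 1 1

lemma integrable_sub [IsFiniteMeasure μ] (hu : AEStronglyMeasurable u μ)
    (hv : AEStronglyMeasurable v μ)
    (hHu : Integrable (fun t => H (u t)) μ) (hHv : Integrable (fun t => H (v t)) μ) :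
    Integrable (fun t => H (u t - v t)) μ := by
  simpa [sub_eq_add_neg] using hH.integrable_lin hu hv hHu hHv 1 (-1)

lemma integrable_of_modular [IsFiniteMeasure μ] (hu : AEStronglyMeasurable u μ)
    (hHu : Integrable (fun t => H (u t)) μ) : Integrable u μ := by
  obtain ⟨C, -, hC⟩ := hH.coercive 1 one_pos
  refine Integrable.mono' (hHu.add (integrable_const C)) hu (Eventually.of_forall fun t => ?_)
  simpa using hC (u t)

lemma integrable_of_bound [IsFiniteMeasure μ] (hu : AEStronglyMeasurable u μ) {R : ℝ}
    (hR : ∀ᵐ t ∂μ, ‖u t‖ ≤ R) : Integrable (fun t => H (u t)) μ := by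
  obtain ⟨C, -, hC⟩ := hH.exists_bound_closedBall R
  refine Integrable.mono' (integrable_const C) (hH.aestronglyMeasurable_comp hu) ?_
  filter_upwards [hR] with t ht
  rw [Real.norm_of_nonneg (hH.nonneg _)]
  exact hC _ ht

end IsYoung

namespace IsGFunction

variable (hG : IsGFunction G)
include hG

lemma exists_norm_le (ε : ℝ) (hε : 0 < ε) : ∃ C ≥ 0, ∀ x, ‖x‖ ≤ ε * G x + C := by
  have h := (hG.superlinear.eventually_ge_atTop ε⁻¹)
  obtain ⟨r, -, hr⟩ := (Filter.hasBasis_cobounded_norm (E := E N)).eventually_iff.1 h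
  refine ⟨max r 0, le_max_right _ _, fun x => ?_⟩
  have h0 := mul_nonneg hε.le (hG.nonneg x)
  by_cases hx : ‖x‖ ≤ max r 0
  · linarith
  push Not at hx
  have hx0 : 0 < ‖x‖ := (le_max_right _ _).trans_lt hx
  have h1 : ε⁻¹ ≤ G x / ‖x‖ := hr ((le_max_left _ _).trans hx.le)
  rw [le_div_iff₀ hx0, inv_mul_le_iff₀ hε] at h1
  have := le_max_right r 0
  linarith

lemma isYoung : IsYoung G where
  continuous := hG.contDiff.continuous
  nonneg := hG.nonneg
  convex := hG.convex
  even := hG.even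
  zero := hG.zero
  coercive := hG.exists_norm_le
  doubling := by
    obtain ⟨C, M, h⟩ := hG.delta2
    obtain ⟨D, hD⟩ := (isCompact_closedBall (0 : E N) M).exists_bound_of_continuousOn
      (f := fun x => G ((2 : ℝ) • x))
      (hG.contDiff.continuous.comp (continuous_const_smul 2)).continuousOn
    refine ⟨max 0 (max C D), le_max_left _ _, fun x => ?_⟩
    have h0 := hG.nonneg x
    have h1 : C ≤ max 0 (max C D) := by simp
    have h2 : D ≤ max 0 (max C D) := by simp
    have h3 : 0 ≤ max 0 (max C D) := le_max_left _ _
    by_cases hx : M ≤ ‖x‖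
    · nlinarith [h x hx]
    · have := (le_abs_self _).trans (hD x (by simpa using (not_le.1 hx).le))
      nlinarith

lemma bddAbove_conj (y : E N) : BddAbove (range fun x : E N => inner ℝ x y - G x) := by
  -- With this slope `G x` dominates `(‖y‖ + 1) ‖x‖` up to a constant, hence also the inner product.
  obtain ⟨C, hC0, hC⟩ := hG.exists_norm_le (‖y‖ + 1)⁻¹ (by positivity)
  refine ⟨(‖y‖ + 1) * C, ?_⟩
  rintro _ ⟨x, rfl⟩
  have h1 := hC x
  have h2 := real_inner_le_norm x y
  have h3 : (‖y‖ + 1) * ‖x‖ ≤ G x + (‖y‖ + 1) * C := by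
    calc _ ≤ (‖y‖ + 1) * ((‖y‖ + 1)⁻¹ * G x + C) := by gcongr
      _ = _ := by field_simp
  simp only
  nlinarith [norm_nonneg x]

lemma inner_sub_le_conj (x y : E N) : inner ℝ x y - G x ≤ conj G y :=
  le_ciSup (hG.bddAbove_conj y) x

omit hG in
lemma conj_le {y : E N} {c : ℝ} (h : ∀ x, inner ℝ x y - G x ≤ c) : conj G y ≤ c :=
  ciSup_le h

lemma inner_le (x y : E N) : inner ℝ x y ≤ G x + conj G y := by
  linarith [hG.inner_sub_le_conj x y]

lemma abs_inner_le (x y : E N) : |inner ℝ x y| ≤ G x + conj G y := by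
  have := hG.inner_le (-x) y
  rw [inner_neg_left, hG.even] at this
  exact abs_le.2 ⟨by linarith, hG.inner_le x y⟩

lemma conj_nonneg (y : E N) : 0 ≤ conj G y := by
  simpa [hG.zero] using hG.inner_sub_le_conj 0 y

lemma convexOn_conj : ConvexOn ℝ univ (conj G) := by
  refine ⟨convex_univ, fun y _ z _ a b ha hb hab => conj_le fun x => ?_⟩
  have h1 := mul_le_mul_of_nonneg_left (hG.inner_sub_le_conj x y) ha
  have h2 := mul_le_mul_of_nonneg_left (hG.inner_sub_le_conj x z) hb
  rw [inner_add_right, inner_smul_right, inner_smul_right]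
  have : G x = a * G x + b * G x := by rw [← add_mul, hab, one_mul]
  simp only [smul_eq_mul]
  linarith

/-- Continuity is automatic for a finite convex function in finite dimension. Coercivity comes from
testing the supremum at the vector of length `ε⁻¹` in the direction of `y`, and doubling is the dual
form of `∇₂`. -/
lemma isYoung_conj : IsYoung (conj G) where
  continuous := by
    have := hG.convexOn_conj.continuousOn isOpen_univ
    exact continuousOn_univ.1 this
  nonneg := hG.conj_nonneg
  convex := hG.convexOn_conj
  even := by
    have h : ∀ y, conj G (-y) ≤ conj G y := fun y => conj_le fun x => by
      have := hG.inner_sub_le_conj (-x) y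
      rwa [inner_neg_left, hG.even, ← inner_neg_right] at this
    exact fun y => le_antisymm (h y) (by simpa using h (-y))
  zero := le_antisymm (conj_le fun x => by simpa using hG.nonneg x) (hG.conj_nonneg 0)
  coercive := by
    intro ε hε
    obtain ⟨C, hC0, hC⟩ := hG.isYoung.exists_bound_closedBall ε⁻¹
    refine ⟨ε * C, by positivity, fun y => ?_⟩
    rcases eq_or_ne y 0 with rfl | hy
    · simpa using add_nonneg (mul_nonneg hε.le (hG.conj_nonneg 0)) (by positivity : 0 ≤ ε * C)
    have hy' : 0 < ‖y‖ := norm_pos_iff.2 hy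
    have h1 := hG.inner_sub_le_conj ((ε⁻¹ / ‖y‖) • y) y
    have h2 := hC ((ε⁻¹ / ‖y‖) • y) (by
      rw [norm_smul, Real.norm_of_nonneg (by positivity), div_mul_cancel₀ _ hy'.ne'])
    rw [real_inner_smul_left, real_inner_self_eq_norm_sq] at h1
    have h3 : ε⁻¹ / ‖y‖ * ‖y‖ ^ 2 = ε⁻¹ * ‖y‖ := by field_simp
    have h4 : ε⁻¹ * ‖y‖ ≤ conj G y + C := by linarith
    rw [inv_mul_le_iff₀ hε] at h4
    linarith
  doubling := by
    obtain ⟨k, M, hk, h⟩ := hG.nabla2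
    obtain ⟨C, hC0, hC⟩ := hG.isYoung.exists_bound_closedBall M
    have hk0 : 0 < k := by linarith
    -- `∇₂` extended to all `x` at the price of a constant. At `x / k` it gives `2⟨x, y⟩ - G x ≤ 2k
    -- (⟨x/k, y⟩ - G (x/k)) + 2kC`, whose bracket is at most `conj G y`.
    have key : ∀ x, 2 * k * G x ≤ G (k • x) + 2 * k * C := by
      intro x
      have h2 : 0 ≤ 2 * k * C := by positivity
      by_cases hx : M ≤ ‖x‖
      · have h1 := mul_le_mul_of_nonneg_left (h x hx) (by positivity : 0 ≤ 2 * k)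
        rw [← mul_assoc, mul_one_div_cancel (by positivity), one_mul] at h1
        linarith
      · have h1 := mul_le_mul_of_nonneg_left (hC x (not_le.1 hx).le) (by positivity : 0 ≤ 2 * k)
        linarith [hG.nonneg (k • x)]
    refine ⟨2 * k * (C + 1), by positivity, fun y => conj_le fun x => ?_⟩
    have h1 := key (k⁻¹ • x)
    rw [smul_inv_smul₀ hk0.ne'] at h1
    have h2 := mul_le_mul_of_nonneg_left (hG.inner_sub_le_conj (k⁻¹ • x) y)
      (by positivity : 0 ≤ 2 * k)
    rw [real_inner_smul_left] at h2
    rw [inner_smul_right]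
    have h3 : 2 * k * (k⁻¹ * inner ℝ x y - G (k⁻¹ • x))
        = 2 * inner ℝ x y - 2 * k * G (k⁻¹ • x) := by field_simp
    rw [h3] at h2
    have h4 := mul_nonneg (mul_nonneg hk0.le hC0) (hG.conj_nonneg y)
    nlinarith

end IsGFunction

/-- The supporting hyperplane inequality for a differentiable convex function. -/
lemma ConvexOn.add_inner_gradient_le {h : E N → ℝ} (hc : ConvexOn ℝ univ h) {x : E N}
    (hd : DifferentiableAt ℝ h x) (y : E N) :
    h x + inner ℝ (gradient h x) (y - x) ≤ h y := by
  have hg := hd.hasGradientAt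
  have h1 : HasDerivAt (fun s : ℝ => h (x + s • (y - x))) (inner ℝ (gradient h x) (y - x)) 0 := by
    have h2 : HasDerivAt (fun s : ℝ => x + s • (y - x)) (y - x) 0 := by
      simpa using ((hasDerivAt_id (0 : ℝ)).smul_const (y - x)).const_add x
    have h3 : HasFDerivAt h (InnerProductSpace.toDual ℝ (E N) (gradient h x))
      (x + (0 : ℝ) • (y - x)) := by simpa using hg.hasFDerivAt
    exact h3.comp_hasDerivAt (0 : ℝ) h2
  have h2 : ConvexOn ℝ univ (fun s : ℝ => h (x + s • (y - x))) := by
    refine ⟨convex_univ, fun a _ b _ p q hp hq hpq => ?_⟩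
    have := hc.2 (mem_univ (x + a • (y - x))) (mem_univ (x + b • (y - x))) hp hq hpq
    refine le_of_eq_of_le (congrArg h ?_) this
    obtain rfl : q = 1 - p := by linarith
    simp only [smul_eq_mul]
    module
  have h3 := h2.le_slope_of_hasDerivAt (mem_univ 0) (mem_univ 1) one_pos h1
  simp only [slope, sub_zero, inv_one, one_smul, zero_smul, add_zero, add_sub_cancel,
    vsub_eq_sub] at h3
  linarith

namespace IsGFunction

/-- The supporting hyperplane at `v` gives `G*(∇G(v)) ≤ ⟨∇G(v), v⟩ - G(v)`, and the same hyperplane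
evaluated at `2v` bounds the inner product by `G(2v) - G(v)`. Combined with `Δ₂`, this turns the
bound on `F_v` in (F2) into a bound by `G(v)`. -/
lemma conj_gradient_le (hG : IsGFunction G) (v : E N) :
    conj G (gradient G v) ≤ G ((2 : ℝ) • v) := by
  have hd := hG.contDiff.differentiable one_ne_zero v
  refine conj_le fun x => ?_
  have h1 := ConvexOn.add_inner_gradient_le hG.convex hd x
  have h2 := ConvexOn.add_inner_gradient_le hG.convex hd ((2 : ℝ) • v)
  rw [two_smul, add_sub_cancel_right, ← two_smul ℝ v] at h2
  rw [inner_sub_right] at h1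
  have := hG.nonneg v
  rw [real_inner_comm]
  linarith

end IsGFunction

end AnisotropicEL

/-! ### Ekeland's principle and the minimax principle. -/

namespace AnisotropicEL

/-- Ekeland's variational principle. -/
theorem exists_ekeland_point {Y : Type*} [PseudoMetricSpace Y] [CompleteSpace Y] {f : Y → ℝ}
    (hf : LowerSemicontinuous f) (hb : BddBelow (range f)) {ε : ℝ} (hε : 0 < ε) (y₀ : Y) :
    ∃ x, f x ≤ f y₀ ∧ ∀ y, f x ≤ f y + ε * dist x y := by
  -- `S x` consists of the points that improve on `x` in Ekeland's order. Choosing each successor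
  -- almost minimal in the current set makes these nested closed sets shrink geometrically around
  -- their centres.
  let S : Y → Set Y := fun x => {y | f y + ε * dist x y ≤ f x}
  have hself : ∀ x, x ∈ S x := fun x => by simp [S]
  have hclosed : ∀ x, IsClosed (S x) := fun x =>
    (hf.add (by fun_prop : Continuous fun y => ε * dist x y).lowerSemicontinuous).isClosed_preimage
      (f x)
  have hsub : ∀ x, ∀ y ∈ S x, S y ⊆ S x := by
    intro x y hy z hz
    simp only [S, mem_ofPred_eq] at hy hz ⊢
    have := mul_le_mul_of_nonneg_left (dist_triangle x y z) hε.le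
    linarith
  have hbi : ∀ x, BddBelow (f '' S x) := fun x => hb.mono (image_subset_range _ _)
  have hnext : ∀ (n : ℕ) (x : Y), ∃ y ∈ S x, ∀ z ∈ S x, f y ≤ f z + ε * (1 / 2) ^ n := by
    intro n x
    have hne : (f '' S x).Nonempty := ⟨_, x, hself x, rfl⟩
    obtain ⟨_, ⟨y, hy, rfl⟩, hlt⟩ := exists_lt_of_csInf_lt hne
      (lt_add_of_pos_right (sInf (f '' S x)) (by positivity : 0 < ε * (1 / 2) ^ n))
    refine ⟨y, hy, fun z hz => ?_⟩
    have := csInf_le (hbi x) (mem_image_of_mem f hz)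
    linarith
  choose nx hnx1 hnx2 using hnext
  let x : ℕ → Y := fun n => Nat.rec y₀ (fun n y => nx n y) n
  have hx : ∀ n, x (n + 1) = nx n (x n) := fun n => rfl
  have hanti : ∀ n k, S (x (n + k)) ⊆ S (x n) := by
    intro n k
    induction k with
    | zero => exact subset_rfl
    | succ k ih =>
      refine Subset.trans ?_ ih
      have := hsub (x (n + k)) (x (n + k + 1)) (by rw [hx]; exact hnx1 _ _)
      exact this
  have hdist : ∀ n, ∀ y ∈ S (x (n + 1)), dist (x (n + 1)) y ≤ (1 / 2) ^ n := by
    intro n y hy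
    have h1 : f (x (n + 1)) ≤ f y + ε * (1 / 2) ^ n := by
      rw [hx]; exact hnx2 n (x n) y (hanti n 1 hy)
    have h2 : f y + ε * dist (x (n + 1)) y ≤ f (x (n + 1)) := hy
    exact le_of_mul_le_mul_left (by linarith) hε
  have hcau : CauchySeq fun n => x (n + 1) := by
    refine cauchySeq_of_le_geometric (1 / 2) 1 (by norm_num) fun n => ?_
    rw [one_mul]
    exact hdist n _ (hanti (n + 1) 1 (hself _))
  obtain ⟨a, ha⟩ := cauchySeq_tendsto_of_complete hcau
  have hmem : ∀ n, a ∈ S (x n) := by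
    intro n
    refine (hclosed _).mem_of_tendsto ha ?_
    filter_upwards [eventually_ge_atTop n] with k hk
    obtain ⟨j, rfl⟩ := Nat.exists_eq_add_of_le hk
    exact hanti n (j + 1) (hself _)
  refine ⟨a, ?_, fun y => ?_⟩
  · have h0 : f a + ε * dist y₀ a ≤ f y₀ := hmem 0
    have : 0 ≤ ε * dist y₀ a := by positivity
    linarith
  · by_contra! hlt
    -- A strict improvement on the limit would lie in every `S (x n)` and so be a limit of the same
    -- sequence.
    have hy : ∀ n, y ∈ S (x n) := fun n => hsub _ _ (hmem n) hlt.le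
    have hty : Tendsto (fun n => x (n + 1)) atTop (𝓝 y) := by
      rw [tendsto_iff_dist_tendsto_zero]
      exact squeeze_zero (fun _ => dist_nonneg) (fun n => hdist n y (hy (n + 1)))
        (tendsto_pow_atTop_nhds_zero_of_lt_one (by norm_num) (by norm_num))
    have hd : dist a y = 0 := Metric.inseparable_iff.1 (tendsto_nhds_unique_inseparable ha hty)
    -- In a pseudometric space `a` and `y` need not coincide, but a closed sublevel set cannot
    -- separate points at distance zero.
    have hcl : a ∈ {z | f z ≤ f y} :=
      (Metric.inseparable_iff.2 hd).mem_closed_iff (hf.isClosed_preimage (f y)) |>.2 (le_refl (f y))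
    rw [hd, mul_zero, add_zero] at hlt
    exact absurd hcl (not_le.2 hlt)

section MountainPass

variable {X : Type*} [SeminormedAddCommGroup X] [NormedSpace ℝ X] {J : X → ℝ}
  {DJ : X → X →L[ℝ] ℝ}

lemma exists_eq_deriv_segment
    (hd : ∀ u v, HasDerivAt (fun s : ℝ => J (u + s • v)) (DJ u v) 0) (u v : X) :
    ∃ τ ∈ Ioo (0 : ℝ) 1, J (u + v) - J u = DJ (u + τ • v) v := by
  have hd' : ∀ s : ℝ, HasDerivAt (fun s : ℝ => J (u + s • v)) (DJ (u + s • v) v) s := by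
    intro s
    have h1 : HasDerivAt (fun r : ℝ => r - s) 1 s := (hasDerivAt_id s).sub_const s
    have h2 : HasDerivAt (fun r : ℝ => J (u + s • v + r • v)) (DJ (u + s • v) v) (s - s) := by
      rw [sub_self]; exact hd (u + s • v) v
    have h3 := h2.comp (h := fun r => r - s) s h1
    simp only [mul_one] at h3
    refine h3.congr_of_eventuallyEq (Eventually.of_forall fun r => ?_)
    simp only [Function.comp]
    congr 1
    module
  obtain ⟨τ, hτ, h⟩ := exists_hasDerivAt_eq_slope (fun s : ℝ => J (u + s • v))
    (fun s => DJ (u + s • v) v) one_pos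
    (fun s _ => (hd' s).continuousAt.continuousWithinAt) (fun s _ => hd' s)
  exact ⟨τ, hτ, by simpa using h.symm⟩

/-- Directional derivatives that depend continuously, in operator norm, on the base point are
Fréchet derivatives; the intermediate point is supplied by the mean value theorem. -/
lemma exists_abs_sub_deriv_le
    (hd : ∀ u v, HasDerivAt (fun s : ℝ => J (u + s • v)) (DJ u v) 0) (hDJ : Continuous DJ)
    (u : X) {ε : ℝ} (hε : 0 < ε) :
    ∃ δ > 0, ∀ v, ‖v‖ < δ → |J (u + v) - J u - DJ u v| ≤ ε * ‖v‖ := by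
  obtain ⟨δ, hδ, h⟩ := Metric.continuous_iff.1 hDJ u ε hε
  refine ⟨δ, hδ, fun v hv => ?_⟩
  obtain ⟨τ, hτ, he⟩ := exists_eq_deriv_segment hd u v
  rw [he, ← sub_apply, ← Real.norm_eq_abs]
  refine (ContinuousLinearMap.le_opNorm _ _).trans ?_
  gcongr
  rw [← dist_eq_norm]
  refine (h _ ?_).le
  rw [dist_self_add_left, norm_smul, Real.norm_of_nonneg hτ.1.le]
  exact (mul_le_of_le_one_left (norm_nonneg v) hτ.2.le).trans_lt hv

lemma continuous_of_line_deriv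
    (hd : ∀ u v, HasDerivAt (fun s : ℝ => J (u + s • v)) (DJ u v) 0) (hDJ : Continuous DJ) :
    Continuous J := by
  rw [continuous_iff_continuousAt]
  intro u
  obtain ⟨δ, hδ, h⟩ := exists_abs_sub_deriv_le hd hDJ u one_pos
  have hlim : Tendsto (fun w => ‖DJ u (w - u)‖ + ‖w - u‖) (𝓝 u) (𝓝 0) := by
    have : Continuous fun w => ‖DJ u (w - u)‖ + ‖w - u‖ := by fun_prop
    simpa using this.tendsto u
  rw [ContinuousAt, tendsto_iff_dist_tendsto_zero]
  refine squeeze_zero' (Eventually.of_forall fun _ => dist_nonneg) ?_ hlim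
  filter_upwards [Metric.ball_mem_nhds u hδ] with w hw
  have h1 := h (w - u) (by rwa [← dist_eq_norm])
  rw [add_sub_cancel, one_mul] at h1
  have h2 : J w - J u = (J w - J u - DJ u (w - u)) + DJ u (w - u) := by ring
  rw [Real.dist_eq, h2, Real.norm_eq_abs]
  linarith [abs_add_le (J w - J u - DJ u (w - u)) (DJ u (w - u))]

lemma exists_apply_lt_of_lt_norm (L : X →L[ℝ] ℝ) {ε : ℝ} (hε : 0 ≤ ε) (h : ε < ‖L‖) :
    ∃ v, ‖v‖ ≤ 1 ∧ L v < -ε := by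
  by_contra! hcon
  refine absurd (L.opNorm_le_of_unit_norm hε fun v hv => ?_) (not_le.2 h)
  have h1 := hcon v hv.le
  have h2 := hcon (-v) (by rw [norm_neg, hv])
  rw [map_neg] at h2
  rw [Real.norm_eq_abs, abs_le]
  constructor <;> linarith

/-- Continuous paths that start at `0` and end at `e`, up to elements of norm zero. -/
def pathSet (e : X) : Set C(unitInterval, X) := {γ | ‖γ 0‖ = 0 ∧ ‖γ 1 - e‖ = 0}

/-- The maximum of `J` along a path. -/
noncomputable def pathMax (J : X → ℝ) (γ : C(unitInterval, X)) : ℝ := ⨆ s, J (γ s)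

omit [NormedSpace ℝ X] in
lemma exists_eq_pathMax (hJ : Continuous J) (γ : C(unitInterval, X)) :
    ∃ s, J (γ s) = pathMax J γ ∧ ∀ r, J (γ r) ≤ J (γ s) := by
  obtain ⟨s, -, hs⟩ := isCompact_univ.exists_isMaxOn (univ_nonempty (α := unitInterval))
    (hJ.comp γ.continuous).continuousOn
  have hs' : ∀ r, J (γ r) ≤ J (γ s) := fun r => hs (mem_univ r)
  refine ⟨s, le_antisymm (le_ciSup (f := fun r => J (γ r)) ⟨J (γ s), ?_⟩ s) (ciSup_le hs'), hs'⟩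
  rintro _ ⟨r, rfl⟩
  exact hs' r

omit [NormedSpace ℝ X] in
lemma le_pathMax (hJ : Continuous J) (γ : C(unitInterval, X)) (r : unitInterval) :
    J (γ r) ≤ pathMax J γ := by
  obtain ⟨s, h1, h2⟩ := exists_eq_pathMax hJ γ
  exact h1 ▸ h2 r

/-- The segment from `0` to `e`. -/
def segmentPath (e : X) : C(unitInterval, X) := ⟨fun s => (s : ℝ) • e, by fun_prop⟩

lemma segmentPath_mem (e : X) : segmentPath e ∈ pathSet e := by
  simp [segmentPath, pathSet]

/-- The minimax principle: a mountain-pass level carries a Palais-Smale sequence. -/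
theorem exists_almost_critical [CompleteSpace X]
    (hd : ∀ u v, HasDerivAt (fun s : ℝ => J (u + s • v)) (DJ u v) 0) (hDJ : Continuous DJ)
    {e : X} {c : ℝ} (hc : IsGLB (pathMax J '' pathSet e) c) (h0 : J 0 < c) (he : J e < c)
    {ε : ℝ} (hε : 0 < ε) : ∃ u, |J u - c| ≤ ε ∧ ‖DJ u‖ ≤ ε := by
  have hJ : Continuous J := continuous_of_line_deriv hd hDJ
  have hins : ∀ x y : X, ‖x - y‖ = 0 → J x = J y := fun x y h => by
    have : Inseparable x y := Metric.inseparable_iff.2 (by rw [dist_eq_norm, h])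
    exact (this.map hJ).eq
  have hclosed : IsClosed (pathSet e) := by
    have h1 : Continuous fun γ : C(unitInterval, X) => ‖γ 0‖ := by fun_prop
    have h2 : Continuous fun γ : C(unitInterval, X) => ‖γ 1 - e‖ := by fun_prop
    exact (isClosed_eq h1 continuous_const).inter (isClosed_eq h2 continuous_const)
  have : CompleteSpace (pathSet e) := hclosed.completeSpace_coe
  let f : pathSet e → ℝ := fun γ => pathMax J γ
  -- A supremum of continuous functions of the path. The endpoint conditions are closed, so
  -- Ekeland's principle applies to `f` on `pathSet e` with the uniform distance.
  have hlsc : LowerSemicontinuous f := by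
    refine lowerSemicontinuous_ciSup (f := fun s (γ : pathSet e) => J (γ.1 s)) (fun γ => ?_)
      fun s => Continuous.lowerSemicontinuous ?_
    · refine ⟨pathMax J γ.1, ?_⟩
      rintro _ ⟨s, rfl⟩
      exact le_pathMax hJ γ.1 s
    · exact hJ.comp ((by fun_prop : Continuous fun γ : C(unitInterval, X) => γ s).comp
        continuous_subtype_val)
  have hge : ∀ γ : pathSet e, c ≤ f γ := fun γ => hc.1 ⟨γ.1, γ.2, rfl⟩
  have hbdd : BddBelow (range f) := ⟨c, by rintro _ ⟨γ, rfl⟩; exact hge γ⟩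
  obtain ⟨_, ⟨γ₀, hγ₀, rfl⟩, hlt⟩ : ∃ m ∈ pathMax J '' pathSet e, m < c + ε := by
    by_contra! h
    linarith [hc.2 h]
  obtain ⟨⟨γ, hγ⟩, h1, h2⟩ := exists_ekeland_point hlsc hbdd hε ⟨γ₀, hγ₀⟩
  have hle : pathMax J γ ≤ c + ε := h1.trans hlt.le
  have hcle : c ≤ pathMax J γ := hge ⟨γ, hγ⟩
  -- The parameters where the almost optimal path attains its maximum. The endpoints are not among
  -- them, because `J` lies below `c` there.
  let M : Set unitInterval := {s | J (γ s) = pathMax J γ}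
  have hMc : IsClosed M := isClosed_eq (hJ.comp γ.continuous) continuous_const
  have h0M : (0 : unitInterval) ∉ M := fun h => by
    have h' : J (γ 0) = pathMax J γ := h
    rw [hins (γ 0) 0 (by simpa using hγ.1)] at h'
    linarith
  have h1M : (1 : unitInterval) ∉ M := fun h => by
    have h' : J (γ 1) = pathMax J γ := h
    rw [hins (γ 1) e hγ.2] at h'
    linarith
  by_contra! hcon
  have hbig : ∀ s ∈ M, ε < ‖DJ (γ s)‖ := by
    intro s hs
    have hs' : J (γ s) = pathMax J γ := hs
    refine hcon (γ s) ?_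
    rw [hs', abs_le]
    constructor <;> linarith
  -- Admissible descent directions. These sets are convex and have locally constant selections, so a
  -- partition of unity yields a continuous field `w` with `DJ (γ s) (w s) < -ε` on `M` and `w = 0`
  -- at the endpoints.
  let t : unitInterval → Set X := fun s =>
    {v | ‖v‖ ≤ 1 ∧ (s ∈ M → DJ (γ s) v < -ε) ∧ (s = 0 ∨ s = 1 → v = 0)}
  have ht : ∀ s, Convex ℝ (t s) := by
    intro s x hx y hy a b ha hb hab
    refine ⟨?_, fun hs => ?_, fun hs => ?_⟩
    · have := (convex_closedBall (0 : X) 1) (by simpa using hx.1 : x ∈ Metric.closedBall 0 1)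
        (by simpa using hy.1 : y ∈ Metric.closedBall 0 1) ha hb hab
      simpa using this
    · have := (convex_Iio (-ε)) (hx.2.1 hs) (hy.2.1 hs) ha hb hab
      simpa using this
    · rw [hx.2.2 hs, hy.2.2 hs]; simp
  obtain ⟨w, hw⟩ : ∃ w : C(unitInterval, X), ∀ s, w s ∈ t s := by
    refine exists_continuous_forall_mem_convex_of_local_const ht fun s => ?_
    by_cases hs : s ∈ M
    · obtain ⟨v, hv1, hv2⟩ := exists_apply_lt_of_lt_norm _ hε.le (hbig s hs)
      refine ⟨v, ?_⟩
      have hcont : Continuous fun r => DJ (γ r) v :=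
        (hDJ.comp γ.continuous).clm_apply continuous_const
      have hs0 : s ≠ 0 := fun h => h0M (h ▸ hs)
      have hs1 : s ≠ 1 := fun h => h1M (h ▸ hs)
      filter_upwards [hcont.continuousAt.eventually (gt_mem_nhds hv2),
        isOpen_ne.mem_nhds hs0, isOpen_ne.mem_nhds hs1] with r hr hr0 hr1
      exact ⟨hv1, fun _ => hr, fun h => by rcases h with h | h <;> contradiction⟩
    · refine ⟨0, ?_⟩
      filter_upwards [hMc.isOpen_compl.mem_nhds hs] with r hr
      exact ⟨by simp, fun h => absurd h hr, fun _ => rfl⟩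
  let η : ℕ → ℝ := fun n => 1 / ((n : ℝ) + 1)
  have hη0 : ∀ n, 0 < η n := fun n => by positivity
  have hηlim : Tendsto η atTop (𝓝 0) := tendsto_one_div_add_atTop_nhds_zero_nat
  let Γ : ℕ → C(unitInterval, X) := fun n => γ + η n • w
  have hΓ : ∀ n, Γ n ∈ pathSet e := by
    intro n
    have hw0 := (hw 0).2.2 (Or.inl rfl)
    have hw1 := (hw 1).2.2 (Or.inr rfl)
    exact ⟨by simpa [Γ, hw0] using hγ.1, by simpa [Γ, hw1] using hγ.2⟩
  -- Ekeland's inequality: deforming by `η n • w` moves the path by at most `η n`, so it lowers the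
  -- maximum by at most `ε * η n`.
  have hmax : ∀ n, pathMax J γ ≤ pathMax J (Γ n) + ε * η n := by
    intro n
    refine (h2 ⟨Γ n, hΓ n⟩).trans ?_
    gcongr
    change dist γ (Γ n) ≤ η n
    refine (ContinuousMap.dist_le (hη0 n).le).2 fun s => ?_
    simp only [Γ, ContinuousMap.add_apply, ContinuousMap.smul_apply, dist_self_add_right, norm_smul]
    rw [Real.norm_of_nonneg (hη0 n).le]
    exact mul_le_of_le_one_right (hη0 n).le (hw s).1
  choose s hs1 hs2 using fun n => exists_eq_pathMax hJ (Γ n)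
  -- At a maximum point of the deformed path the drop is at most `ε * η n`, so the mean value
  -- theorem gives a slope at least `-ε`. A limit of these parameters lies in `M` and inherits the
  -- bound, against the choice of `w`.
  have hseg : ∀ n, ∃ τ ∈ Ioo (0 : ℝ) 1, -ε ≤ DJ (γ (s n) + τ • (η n • w (s n))) (w (s n)) := by
    intro n
    obtain ⟨τ, hτ, h⟩ := exists_eq_deriv_segment hd (γ (s n)) (η n • w (s n))
    refine ⟨τ, hτ, ?_⟩
    rw [map_smul, smul_eq_mul] at h
    have h3 : J (γ (s n) + η n • w (s n)) = pathMax J (Γ n) := hs1 n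
    have h4 := hmax n
    have h5 := le_pathMax hJ γ (s n)
    rw [h3] at h
    have h6 : η n * (-ε) ≤ η n * (DJ (γ (s n) + τ • (η n • w (s n))) (w (s n))) := by linarith
    exact le_of_mul_le_mul_left h6 (hη0 n)
  choose τ hτ hτε using hseg
  obtain ⟨s', -, φ, hφ, hlim⟩ := isCompact_univ.tendsto_subseq (fun n => mem_univ (s n))
  have hηφ : Tendsto (fun n => η (φ n)) atTop (𝓝 0) := hηlim.comp hφ.tendsto_atTop
  have hγl : Tendsto (fun n => γ (s (φ n))) atTop (𝓝 (γ s')) :=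
    (γ.continuous.tendsto s').comp hlim
  have hwl : Tendsto (fun n => w (s (φ n))) atTop (𝓝 (w s')) :=
    (w.continuous.tendsto s').comp hlim
  have hpert : Tendsto (fun n => γ (s (φ n)) + τ (φ n) • (η (φ n) • w (s (φ n)))) atTop
      (𝓝 (γ s')) := by
    have : Tendsto (fun n => τ (φ n) • (η (φ n) • w (s (φ n)))) atTop (𝓝 0) := by
      refine squeeze_zero_norm (fun n => ?_) hηφ
      rw [norm_smul, norm_smul, Real.norm_of_nonneg (hτ _).1.le, Real.norm_of_nonneg (hη0 _).le]
      have h3 := mul_le_of_le_one_right (hη0 (φ n)).le (hw (s (φ n))).1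
      have h4 : 0 ≤ η (φ n) * ‖w (s (φ n))‖ := mul_nonneg (hη0 _).le (norm_nonneg _)
      exact (mul_le_of_le_one_left h4 (hτ _).2.le).trans h3
    simpa using hγl.add this
  have hD : Tendsto (fun n => DJ (γ (s (φ n)) + τ (φ n) • (η (φ n) • w (s (φ n)))) (w (s (φ n))))
      atTop (𝓝 (DJ (γ s') (w s'))) := by
    have hev : Continuous fun p : (X →L[ℝ] ℝ) × X => p.1 p.2 := by fun_prop
    exact (hev.tendsto (DJ (γ s'), w s')).comp (((hDJ.tendsto _).comp hpert).prodMk_nhds hwl)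
  have hge' : -ε ≤ DJ (γ s') (w s') := ge_of_tendsto' hD fun n => hτε (φ n)
  have hΓl : Tendsto (fun n => J (Γ (φ n) (s (φ n))) + ε * η (φ n)) atTop
      (𝓝 (J (γ s') + ε * 0)) := by
    refine ((hJ.tendsto _).comp ?_).add (hηφ.const_mul ε)
    have : Tendsto (fun n => γ (s (φ n)) + η (φ n) • w (s (φ n))) atTop
      (𝓝 (γ s' + (0 : ℝ) • w s')) := hγl.add (hηφ.smul hwl)
    simpa [Γ] using this
  have hs'M : s' ∈ M := by
    refine le_antisymm (le_pathMax hJ γ s') ?_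
    have := ge_of_tendsto' hΓl fun n => (hs1 (φ n)).symm ▸ hmax (φ n)
    simpa using this
  exact absurd ((hw s').2.1 hs'M) (not_lt.2 hge')

end MountainPass

end AnisotropicEL

/-! ### Absolutely continuous functions with values in Euclidean space. -/

namespace AnisotropicEL

variable {N : ℕ} {u v w : ℝ → E N} {T a b : ℝ}

/-- Lebesgue measure on `[-T, T]`. -/
noncomputable abbrev μI (T : ℝ) : Measure ℝ := volume.restrict (Icc (-T) T)

lemma AbsolutelyContinuousOnInterval.of_dist_le {X Y : Type*} [PseudoMetricSpace X]
    [PseudoMetricSpace Y] {f : ℝ → X} {g : ℝ → Y}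
    (hf : AbsolutelyContinuousOnInterval f a b)
    (h : ∀ x ∈ uIcc a b, ∀ y ∈ uIcc a b, dist (g x) (g y) ≤ dist (f x) (f y)) :
    AbsolutelyContinuousOnInterval g a b := by
  rw [absolutelyContinuousOnInterval_iff] at hf ⊢
  intro ε hε
  obtain ⟨δ, hδ, hf⟩ := hf ε hε
  refine ⟨δ, hδ, fun I hI hlt => (Finset.sum_le_sum fun i hi => ?_).trans_lt (hf I hI hlt)⟩
  exact h _ (hI.1 i hi).1 _ (hI.1 i hi).2

lemma AbsolutelyContinuousOnInterval.coord (hu : AbsolutelyContinuousOnInterval u a b)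
    (i : Fin N) : AbsolutelyContinuousOnInterval (fun t => u t i) a b := by
  refine AbsolutelyContinuousOnInterval.of_dist_le hu fun x _ y _ => ?_
  rw [dist_eq_norm, dist_eq_norm, ← PiLp.sub_apply]
  exact PiLp.norm_apply_le _ i

lemma AbsolutelyContinuousOnInterval.ae_differentiableAt_euclidean
    (hu : AbsolutelyContinuousOnInterval u a b) :
    ∀ᵐ t, t ∈ uIcc a b → DifferentiableAt ℝ u t := by
  have h : ∀ i, ∀ᵐ t, t ∈ uIcc a b → DifferentiableAt ℝ (fun t => u t i) t :=
    fun i => (AbsolutelyContinuousOnInterval.coord hu i).ae_differentiableAt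
  filter_upwards [ae_all_iff.2 h] with t ht hm
  exact differentiableAt_euclidean.2 fun i => ht i hm

lemma deriv_coord {t : ℝ} (h : DifferentiableAt ℝ u t) (i : Fin N) :
    deriv (fun t => u t i) t = deriv u t i :=
  ((EuclideanSpace.proj (𝕜 := ℝ) i).hasFDerivAt.comp_hasDerivAt t h.hasDerivAt).deriv

lemma norm_le_sum_abs (x : E N) : ‖x‖ ≤ ∑ i, |x i| := by
  have h : x = ∑ i, x i • EuclideanSpace.basisFun (Fin N) ℝ i := by
    simpa using ((EuclideanSpace.basisFun (Fin N) ℝ).sum_repr x).symm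
  calc ‖x‖ = ‖∑ i, x i • EuclideanSpace.basisFun (Fin N) ℝ i‖ := by rw [← h]
    _ ≤ ∑ i, ‖x i • EuclideanSpace.basisFun (Fin N) ℝ i‖ := norm_sum_le _ _
    _ = ∑ i, |x i| := by simp [norm_smul]

lemma AbsolutelyContinuousOnInterval.intervalIntegrable_deriv_euclidean
    (hu : AbsolutelyContinuousOnInterval u a b) : IntervalIntegrable (deriv u) volume a b := by
  have h : ∀ i, IntervalIntegrable (deriv fun t => u t i) volume a b :=
    fun i => (AbsolutelyContinuousOnInterval.coord hu i).intervalIntegrable_deriv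
  rw [intervalIntegrable_iff]
  have hs : IntegrableOn (fun t => ∑ i, |deriv (fun t => u t i) t|) (uIoc a b) :=
    integrable_finsetSum _ fun i _ => (intervalIntegrable_iff.1 (h i)).abs
  refine Integrable.mono' hs (aestronglyMeasurable_deriv u _) ?_
  rw [ae_restrict_iff' measurableSet_uIoc]
  filter_upwards [AbsolutelyContinuousOnInterval.ae_differentiableAt_euclidean hu] with t ht hm
  refine (norm_le_sum_abs _).trans_eq (Finset.sum_congr rfl fun i _ => ?_)
  rw [deriv_coord (ht (uIoc_subset_uIcc hm))]

/-- Increments are dominated by those of the scalar primitive of `‖w‖`. -/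
lemma IntervalIntegrable.absolutelyContinuousOnInterval_primitive
    (hw : IntervalIntegrable w volume a b) :
    AbsolutelyContinuousOnInterval (fun t => ∫ s in a..t, w s) a b := by
  have h := hw.norm.absolutelyContinuousOnInterval_intervalIntegral (c := a) left_mem_uIcc
  refine AbsolutelyContinuousOnInterval.of_dist_le h fun x hx y hy => ?_
  have hax : uIoc a x ⊆ uIoc a b := by
    rw [uIoc, uIoc]; rw [uIcc, mem_Icc] at hx; apply Ioc_subset_Ioc <;> grind
  have hay : uIoc a y ⊆ uIoc a b := by
    rw [uIoc, uIoc]; rw [uIcc, mem_Icc] at hy; apply Ioc_subset_Ioc <;> grind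
  have h1 := hw.mono_set' hax
  have h2 := hw.mono_set' hay
  rw [dist_eq_norm, dist_eq_norm, intervalIntegral.integral_interval_sub_left h1 h2,
    intervalIntegral.integral_interval_sub_left h1.norm h2.norm, Real.norm_eq_abs]
  exact intervalIntegral.norm_integral_le_abs_integral_norm

/-- Subtracting the primitive of the derivative leaves an absolutely continuous function with
derivative zero almost everywhere, hence a constant. -/
lemma AbsolutelyContinuousOnInterval.integral_deriv_euclidean
    (hu : AbsolutelyContinuousOnInterval u a b) :
    ∫ t in a..b, deriv u t = u b - u a := by
  have hi := AbsolutelyContinuousOnInterval.intervalIntegrable_deriv_euclidean hu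
  let g : ℝ → E N := fun x => u x - ∫ t in a..x, deriv u t
  have hg : AbsolutelyContinuousOnInterval g a b :=
    hu.sub (IntervalIntegrable.absolutelyContinuousOnInterval_primitive hi)
  have hg0 : ∀ᵐ x, x ∈ uIcc a b → HasDerivAt g 0 x := by
    filter_upwards [AbsolutelyContinuousOnInterval.ae_differentiableAt_euclidean hu,
      hi.ae_hasDerivAt_integral] with x h1 h2 hx
    have := (h1 hx).hasDerivAt.sub (h2 hx a left_mem_uIcc)
    rwa [sub_self] at this
  obtain ⟨C, hC⟩ := hg.const_of_ae_hasDerivAt_zero hg0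
  have h1 := hC a left_mem_uIcc
  have h2 := hC b right_mem_uIcc
  simp only [g, intervalIntegral.integral_same, sub_zero] at h1 h2
  rw [h1, ← h2]
  abel

lemma ae_μI_mem (T : ℝ) : ∀ᵐ t ∂μI T, t ∈ Ioo (-T) T := by
  rw [ae_restrict_iff' measurableSet_Icc]
  have h1 : ∀ᵐ t : ℝ, t ≠ -T := by simp [ae_iff, measure_singleton]
  have h2 : ∀ᵐ t : ℝ, t ≠ T := by simp [ae_iff, measure_singleton]
  filter_upwards [h1, h2] with t h1 h2 h3
  exact ⟨lt_of_le_of_ne h3.1 h1.symm, lt_of_le_of_ne h3.2 h2⟩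

lemma ae_μI_mem_Icc (T : ℝ) : ∀ᵐ t ∂μI T, t ∈ Icc (-T) T :=
  ae_restrict_mem measurableSet_Icc

lemma uIcc_neg_self (hT : 0 ≤ T) : uIcc (-T) T = Icc (-T) T := uIcc_of_le (by linarith)

lemma integral_μI {F : Type*} [NormedAddCommGroup F] [NormedSpace ℝ F] (hT : 0 ≤ T) (f : ℝ → F) :
    ∫ t, f t ∂μI T = ∫ t in (-T)..T, f t := by
  rw [intervalIntegral.integral_of_le (by linarith), integral_Icc_eq_integral_Ioc]

lemma integrable_μI_iff {F : Type*} [NormedAddCommGroup F] (hT : 0 ≤ T) (f : ℝ → F) :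
    Integrable f (μI T) ↔ IntervalIntegrable f volume (-T) T := by
  rw [intervalIntegrable_iff_integrableOn_Icc_of_le (by linarith)]; rfl

lemma AbsolutelyContinuousOnInterval.ae_differentiableAt_μI (hT : 0 ≤ T)
    (hu : AbsolutelyContinuousOnInterval u (-T) T) : ∀ᵐ t ∂μI T, DifferentiableAt ℝ u t := by
  rw [ae_restrict_iff' measurableSet_Icc, ← uIcc_neg_self hT]
  exact AbsolutelyContinuousOnInterval.ae_differentiableAt_euclidean hu

lemma deriv_add_ae (hT : 0 ≤ T) (hu : AbsolutelyContinuousOnInterval u (-T) T)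
    (hv : AbsolutelyContinuousOnInterval v (-T) T) :
    deriv (u + v) =ᵐ[μI T] deriv u + deriv v := by
  filter_upwards [AbsolutelyContinuousOnInterval.ae_differentiableAt_μI hT hu,
    AbsolutelyContinuousOnInterval.ae_differentiableAt_μI hT hv] with t h1 h2
  exact deriv_add h1 h2

lemma deriv_sub_ae (hT : 0 ≤ T) (hu : AbsolutelyContinuousOnInterval u (-T) T)
    (hv : AbsolutelyContinuousOnInterval v (-T) T) :
    deriv (u - v) =ᵐ[μI T] deriv u - deriv v := by
  filter_upwards [AbsolutelyContinuousOnInterval.ae_differentiableAt_μI hT hu,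
    AbsolutelyContinuousOnInterval.ae_differentiableAt_μI hT hv] with t h1 h2
  exact deriv_sub h1 h2

lemma deriv_smul_eq (c : ℝ) (u : ℝ → E N) : deriv (c • u) = c • deriv u := by
  ext1 t
  exact deriv_const_smul_field c u

lemma deriv_congr_ae (h : EqOn u v (Icc (-T) T)) : deriv u =ᵐ[μI T] deriv v := by
  filter_upwards [ae_μI_mem T] with t ht
  refine Filter.EventuallyEq.deriv_eq ?_
  filter_upwards [Icc_mem_nhds ht.1 ht.2] with s hs using h hs

lemma integrable_deriv_μI (hT : 0 ≤ T) (hu : AbsolutelyContinuousOnInterval u (-T) T) :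
    Integrable (deriv u) (μI T) :=
  (integrable_μI_iff hT _).2 (AbsolutelyContinuousOnInterval.intervalIntegrable_deriv_euclidean hu)

lemma integral_deriv_interval (hT : 0 ≤ T) (hu : AbsolutelyContinuousOnInterval u (-T) T)
    {s t : ℝ} (hs : s ∈ Icc (-T) T) (ht : t ∈ Icc (-T) T) :
    ∫ r in s..t, deriv u r = u t - u s :=
  AbsolutelyContinuousOnInterval.integral_deriv_euclidean
    (hu.mono (by rw [uIcc_neg_self hT]; exact uIcc_subset_Icc hs ht))

/-- The primitive of `w` with value `ξ` at `-T`. -/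
noncomputable def primitive (T : ℝ) (ξ : E N) (w : ℝ → E N) (t : ℝ) : E N :=
  ξ + ∫ s in (-T)..t, w s

lemma primitive_ac (hT : 0 ≤ T) (ξ : E N) (hw : Integrable w (μI T)) :
    AbsolutelyContinuousOnInterval (primitive T ξ w) (-T) T := by
  refine AbsolutelyContinuousOnInterval.of_dist_le
    (IntervalIntegrable.absolutelyContinuousOnInterval_primitive
      ((integrable_μI_iff hT _).1 hw)) fun x _ y _ => ?_
  simp [primitive]

lemma primitive_hasDerivAt (hT : 0 ≤ T) (ξ : E N) (hw : Integrable w (μI T)) :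
    ∀ᵐ t ∂μI T, HasDerivAt (primitive T ξ w) (w t) t := by
  rw [ae_restrict_iff' measurableSet_Icc, ← uIcc_neg_self hT]
  filter_upwards [((integrable_μI_iff hT _).1 hw).ae_hasDerivAt_integral] with t ht hm
  exact (ht hm (-T) left_mem_uIcc).const_add ξ

lemma primitive_deriv (hT : 0 ≤ T) (ξ : E N) (hw : Integrable w (μI T)) :
    deriv (primitive T ξ w) =ᵐ[μI T] w := by
  filter_upwards [primitive_hasDerivAt hT ξ hw] with t ht using ht.deriv

lemma primitive_neg (T : ℝ) (ξ : E N) (w : ℝ → E N) : primitive T ξ w (-T) = ξ := by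
  simp [primitive]

lemma primitive_right (hT : 0 ≤ T) (ξ : E N) (w : ℝ → E N) :
    primitive T ξ w T = ξ + ∫ t, w t ∂μI T := by
  rw [primitive, integral_μI hT]

end AnisotropicEL

/-! ### Luxemburg norms, modulars and Hölder's inequality. -/

namespace AnisotropicEL

variable {N : ℕ} {G : E N → ℝ} {u v w : ℝ → E N} {T : ℝ}

section General

variable {α : Type*} {m : MeasurableSpace α} {μ : Measure α}

/-- Fatou's lemma for the Bochner integral of nonnegative functions. -/
lemma integrable_and_integral_le_of_tendsto {f : ℕ → α → ℝ} {g : α → ℝ} {C : ℝ}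
    (hf : ∀ n, Integrable (f n) μ) (hf0 : ∀ n t, 0 ≤ f n t)
    (hlim : ∀ᵐ t ∂μ, Tendsto (fun n => f n t) atTop (𝓝 (g t)))
    (hC : ∀ n, ∫ t, f n t ∂μ ≤ C) : Integrable g μ ∧ ∫ t, g t ∂μ ≤ C := by
  have hC0 : 0 ≤ C := (integral_nonneg (hf0 0)).trans (hC 0)
  have hm : AEStronglyMeasurable g μ :=
    aestronglyMeasurable_of_tendsto_ae _ (fun n => (hf n).aestronglyMeasurable) hlim
  have hg0 : ∀ᵐ t ∂μ, 0 ≤ g t := by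
    filter_upwards [hlim] with t ht using ge_of_tendsto' ht fun n => hf0 n t
  have hle : ∫⁻ t, ENNReal.ofReal (g t) ∂μ ≤ ENNReal.ofReal C := by
    calc ∫⁻ t, ENNReal.ofReal (g t) ∂μ
        = ∫⁻ t, liminf (fun n => ENNReal.ofReal (f n t)) atTop ∂μ := by
          refine lintegral_congr_ae ?_
          filter_upwards [hlim] with t ht
          exact ((ENNReal.continuous_ofReal.tendsto _).comp ht).liminf_eq.symm
      _ ≤ liminf (fun n => ∫⁻ t, ENNReal.ofReal (f n t) ∂μ) atTop :=
          lintegral_liminf_le' fun n => (hf n).aestronglyMeasurable.aemeasurable.ennreal_ofReal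
      _ ≤ liminf (fun _ : ℕ => ENNReal.ofReal C) atTop := by
          refine liminf_le_liminf (Eventually.of_forall fun n => ?_)
          rw [← ofReal_integral_eq_lintegral_ofReal (hf n) (Eventually.of_forall (hf0 n))]
          exact ENNReal.ofReal_le_ofReal (hC n)
      _ = ENNReal.ofReal C := liminf_const _
  have hi : Integrable g μ := by
    refine ⟨hm, ?_⟩
    rw [hasFiniteIntegral_iff_ofReal hg0]
    exact hle.trans_lt ENNReal.ofReal_lt_top
  refine ⟨hi, ?_⟩
  rw [← ofReal_integral_eq_lintegral_ofReal hi hg0] at hle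
  exact (ENNReal.ofReal_le_ofReal_iff hC0).1 hle

/-- A series of nonnegative functions with summable integrals has integrable sum. -/
lemma exists_integrable_bound_of_summable {f : ℕ → α → ℝ}
    (hf : ∀ n, Integrable (f n) μ) (hf0 : ∀ n t, 0 ≤ f n t)
    (hs : Summable fun n => ∫ t, f n t ∂μ) :
    ∃ H : α → ℝ, Integrable H μ ∧
      ∀ᵐ t ∂μ, (∀ n, f n t ≤ H t) ∧ Summable fun n => f n t := by
  have hmeas : ∀ n, AEMeasurable (fun t => ENNReal.ofReal (f n t)) μ :=
    fun n => (hf n).aestronglyMeasurable.aemeasurable.ennreal_ofReal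
  have hfin : ∫⁻ t, ∑' n, ENNReal.ofReal (f n t) ∂μ ≠ ⊤ := by
    rw [lintegral_tsum hmeas]
    have : ∀ n, ∫⁻ t, ENNReal.ofReal (f n t) ∂μ = ENNReal.ofReal (∫ t, f n t ∂μ) := fun n =>
      (ofReal_integral_eq_lintegral_ofReal (hf n) (Eventually.of_forall (hf0 n))).symm
    simp_rw [this]
    exact hs.tsum_ofReal_ne_top
  have hms : AEMeasurable (fun t => ∑' n, ENNReal.ofReal (f n t)) μ := AEMeasurable.tsum hmeas
  refine ⟨fun t => (∑' n, ENNReal.ofReal (f n t)).toReal,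
    integrable_toReal_of_lintegral_ne_top hms hfin, ?_⟩
  filter_upwards [ae_lt_top' hms hfin] with t ht
  constructor
  · intro n
    have h1 : ENNReal.ofReal (f n t) ≤ ∑' n, ENNReal.ofReal (f n t) := ENNReal.le_tsum n
    exact (ENNReal.ofReal_le_iff_le_toReal ht.ne).1 h1
  · refine (ENNReal.summable_toReal ht.ne).congr fun n => ?_
    rw [ENNReal.toReal_ofReal (hf0 n t)]

end General

lemma normLG_nonneg (G : E N → ℝ) (T : ℝ) (u : ℝ → E N) : 0 ≤ normLG G T u :=
  Real.sInf_nonneg fun _ hl => hl.1.le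

lemma normLG_congr (h : u =ᵐ[μI T] v) : normLG G T u = normLG G T v := by
  have h1 : ∀ l : ℝ, (fun t => G (l⁻¹ • u t)) =ᵐ[μI T] fun t => G (l⁻¹ • v t) := by
    intro l
    filter_upwards [h] with t ht
    rw [ht]
  unfold normLG
  congr 1
  ext l
  simp only [mem_ofPred_eq]
  rw [integral_congr_ae (h1 l), IntegrableOn, IntegrableOn, integrable_congr (h1 l)]

lemma LG_congr (hu : u ∈ LG G T) (h : u =ᵐ[μI T] v) : v ∈ LG G T := by
  refine ⟨hu.1.congr h, hu.2.congr ?_⟩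
  filter_upwards [h] with t ht
  rw [ht]

lemma normLG_le_of_modular {l : ℝ} (hl : 0 < l)
    (hi : Integrable (fun t => G (l⁻¹ • u t)) (μI T))
    (h : ∫ t, G (l⁻¹ • u t) ∂μI T ≤ 1) : normLG G T u ≤ l :=
  csInf_le ⟨0, fun _ hl => hl.1.le⟩ ⟨hl, hi, h⟩

namespace IsYoung

variable (hG : IsYoung G)
include hG

lemma LG_smul (hu : u ∈ LG G T) (c : ℝ) : c • u ∈ LG G T :=
  ⟨hu.1.const_smul c, hG.integrable_smul hu.1 hu.2 c⟩

lemma LG_add (hu : u ∈ LG G T) (hv : v ∈ LG G T) : u + v ∈ LG G T :=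
  ⟨hu.1.add hv.1, hG.integrable_add hu.1 hv.1 hu.2 hv.2⟩

lemma LG_sub (hu : u ∈ LG G T) (hv : v ∈ LG G T) : u - v ∈ LG G T :=
  ⟨hu.1.sub hv.1, hG.integrable_sub hu.1 hv.1 hu.2 hv.2⟩

lemma LG_zero : (0 : ℝ → E N) ∈ LG G T :=
  ⟨aestronglyMeasurable_const, by simp [hG.zero]⟩

lemma LG_of_bound (hu : AEStronglyMeasurable u (μI T)) {R : ℝ}
    (hR : ∀ᵐ t ∂μI T, ‖u t‖ ≤ R) : u ∈ LG G T :=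
  ⟨hu, hG.integrable_of_bound hu hR⟩

lemma LG_integrable (hu : u ∈ LG G T) : Integrable u (μI T) := hG.integrable_of_modular hu.1 hu.2

/-- For `l` equal to the modular plus one, `l ≥ 1` and convexity gives `∫ G(u/l) ≤ l⁻¹ ∫ G(u) ≤ 1`.
-/
lemma normLG_le_modular_add_one (hu : u ∈ LG G T) :
    normLG G T u ≤ ∫ t, G (u t) ∂μI T + 1 := by
  have h0 : 0 ≤ ∫ t, G (u t) ∂μI T := integral_nonneg fun t => hG.nonneg _
  set l := ∫ t, G (u t) ∂μI T + 1 with hl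
  have hl0 : 0 < l := by linarith
  have hi := hG.integrable_smul hu.1 hu.2 l⁻¹
  refine normLG_le_of_modular hl0 hi ?_
  have h1 : ∫ t, G (l⁻¹ • u t) ∂μI T ≤ ∫ t, l⁻¹ * G (u t) ∂μI T :=
    integral_mono hi (hu.2.const_mul _) fun t =>
      hG.smul_le (by positivity) (inv_le_one_of_one_le₀ (by linarith)) _
  rw [integral_const_mul] at h1
  refine h1.trans ?_
  rw [inv_mul_le_iff₀ hl0]
  linarith

lemma modular_le_div_of_normLG_lt (hu : u ∈ LG G T) {l : ℝ} (h : normLG G T u < l) :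
    ∫ t, G (l⁻¹ • u t) ∂μI T ≤ 1 := by
  have hne : {l : ℝ | 0 < l ∧ IntegrableOn (fun t => G (l⁻¹ • u t)) (Icc (-T) T) ∧
      ∫ t in Icc (-T) T, G (l⁻¹ • u t) ≤ 1}.Nonempty := by
    set c := ∫ t, G (u t) ∂μI T + 1 with hc
    have h0 : 0 ≤ ∫ t, G (u t) ∂μI T := integral_nonneg fun t => hG.nonneg _
    have hl0 : 0 < c := by linarith
    have hi := hG.integrable_smul hu.1 hu.2 c⁻¹
    refine ⟨c, hl0, hi, ?_⟩
    have h1 : ∫ t, G (c⁻¹ • u t) ∂μI T ≤ ∫ t, c⁻¹ * G (u t) ∂μI T :=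
      integral_mono hi (hu.2.const_mul _) fun t =>
        hG.smul_le (by positivity) (inv_le_one_of_one_le₀ (by linarith)) _
    rw [integral_const_mul] at h1
    refine h1.trans ?_
    rw [inv_mul_le_iff₀ hl0]
    linarith
  obtain ⟨k, ⟨hk0, hki, hk1⟩, hkl⟩ := exists_lt_of_csInf_lt hne h
  have hl0 : 0 < l := hk0.trans hkl
  refine le_trans (integral_mono (hG.integrable_smul hu.1 hu.2 l⁻¹) hki fun t => ?_) hk1
  have h1 : l⁻¹ • u t = (k / l) • (k⁻¹ • u t) := by
    rw [smul_smul]; congr 1; field_simp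
  have h2 : k / l ≤ 1 := (div_le_one hl0).2 hkl.le
  simp only
  rw [h1]
  exact (hG.smul_le (by positivity) h2 _).trans (mul_le_of_le_one_left (hG.nonneg _) h2)

lemma normLG_add_le (hu : u ∈ LG G T) (hv : v ∈ LG G T) :
    normLG G T (u + v) ≤ normLG G T u + normLG G T v := by
  refine le_of_forall_pos_le_add fun ε hε => ?_
  set k := normLG G T u + ε / 2 with hk
  set l := normLG G T v + ε / 2 with hl
  have hk0 : 0 < k := by have := normLG_nonneg G T u; linarith
  have hl0 : 0 < l := by have := normLG_nonneg G T v; linarith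
  have h1 := hG.modular_le_div_of_normLG_lt hu (show normLG G T u < k by linarith)
  have h2 := hG.modular_le_div_of_normLG_lt hv (show normLG G T v < l by linarith)
  have hi1 := hG.integrable_smul hu.1 hu.2 k⁻¹
  have hi2 := hG.integrable_smul hv.1 hv.2 l⁻¹
  have huv := hG.LG_add hu hv
  have hi := hG.integrable_smul huv.1 huv.2 (k + l)⁻¹
  have : normLG G T (u + v) ≤ k + l := by
    refine normLG_le_of_modular (by positivity) hi ?_
    have h3 : ∫ t, G ((k + l)⁻¹ • (u + v) t) ∂μI T ≤
        ∫ t, (k / (k + l) * G (k⁻¹ • u t) + l / (k + l) * G (l⁻¹ • v t)) ∂μI T := by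
      refine integral_mono hi ((hi1.const_mul _).add (hi2.const_mul _)) fun t => ?_
      have := hG.convex.2 (mem_univ (k⁻¹ • u t)) (mem_univ (l⁻¹ • v t))
        (show 0 ≤ k / (k + l) by positivity) (show 0 ≤ l / (k + l) by positivity)
        (by field_simp)
      refine le_of_eq_of_le (congrArg G ?_) this
      rw [Pi.add_apply, smul_add, smul_smul, smul_smul]
      congr 2 <;> field_simp
    rw [integral_add (hi1.const_mul _) (hi2.const_mul _), integral_const_mul,
      integral_const_mul] at h3
    refine h3.trans ?_
    have h4 : k / (k + l) * 1 + l / (k + l) * 1 = 1 := by field_simp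
    rw [← h4]
    gcongr
  linarith

lemma normLG_smul_le (hu : u ∈ LG G T) (c : ℝ) :
    normLG G T (c • u) ≤ |c| * normLG G T u := by
  refine le_of_forall_pos_le_add fun ε hε => ?_
  set l := normLG G T u + ε / (|c| + 1) with hl
  have hl0 : normLG G T u < l := by
    have : 0 < ε / (|c| + 1) := by positivity
    linarith
  have hl1 : 0 < l := (normLG_nonneg _ _ _).trans_lt hl0
  have h1 := hG.modular_le_div_of_normLG_lt hu hl0
  have hi := hG.integrable_smul hu.1 hu.2 l⁻¹
  have hcε : |c| * (ε / (|c| + 1)) ≤ ε := by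
    rw [mul_div_assoc', div_le_iff₀ (by positivity)]
    nlinarith [abs_nonneg c]
  rcases eq_or_ne c 0 with rfl | hc
  · have : normLG G T ((0 : ℝ) • u) ≤ ε := by
      refine normLG_le_of_modular hε ?_ ?_ <;> simp [hG.zero]
    simpa using this
  have hc0 : 0 < |c| := abs_pos.2 hc
  have heq : (fun t => G ((|c| * l)⁻¹ • (c • u) t)) = fun t => G (l⁻¹ • u t) := by
    ext t
    rw [Pi.smul_apply, smul_smul]
    rcases abs_cases c with ⟨h, _⟩ | ⟨h, _⟩
    · rw [h]; congr 2; field_simp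
    · rw [h, ← hG.even (l⁻¹ • u t), ← neg_smul]; congr 2; field_simp
  have : normLG G T (c • u) ≤ |c| * l := by
    refine normLG_le_of_modular (by positivity) ?_ ?_ <;> rw [heq] <;> assumption
  rw [hl, mul_add] at this
  linarith

lemma normLG_zero : normLG G T (0 : ℝ → E N) = 0 := by
  have := hG.normLG_smul_le (hG.LG_zero (T := T)) 0
  rw [smul_zero, abs_zero, zero_mul] at this
  exact le_antisymm this (normLG_nonneg _ _ _)

lemma exists_integral_norm_le (T : ℝ) :
    ∃ C ≥ 0, ∀ u ∈ LG G T, ∫ t, ‖u t‖ ∂μI T ≤ C * normLG G T u := by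
  obtain ⟨C, hC0, hC⟩ := hG.coercive 1 one_pos
  set m := (μI T).real univ
  have hm : 0 ≤ m := measureReal_nonneg
  refine ⟨1 + C * m, by positivity, fun u hu => le_of_forall_pos_le_add fun ε hε => ?_⟩
  set K := 1 + C * m with hK
  have hK0 : 0 < K := by positivity
  set l := normLG G T u + ε / K with hl
  have hl0 : normLG G T u < l := by
    have : 0 < ε / K := by positivity
    linarith
  have hl1 : 0 < l := (normLG_nonneg _ _ _).trans_lt hl0
  have h1 := hG.modular_le_div_of_normLG_lt hu hl0
  have hi := hG.integrable_smul hu.1 hu.2 l⁻¹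
  have h2 : ∫ t, ‖u t‖ ∂μI T ≤ ∫ t, l * (G (l⁻¹ • u t) + C) ∂μI T := by
    refine integral_mono (hG.LG_integrable hu).norm
      ((hi.add (integrable_const C)).const_mul l) fun t => ?_
    have := hC (l⁻¹ • u t)
    rw [norm_smul, Real.norm_of_nonneg (by positivity), inv_mul_le_iff₀ hl1, one_mul] at this
    exact this
  rw [integral_const_mul, integral_add hi (integrable_const C), integral_const, smul_eq_mul] at h2
  have h3 : l * (∫ t, G (l⁻¹ • u t) ∂μI T + m * C) ≤ l * K := by
    gcongr; rw [hK]; linarith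
  have h4 : l * K = K * normLG G T u + ε := by rw [hl]; field_simp
  linarith

lemma exists_normLG_le_of_bound (T : ℝ) :
    ∃ C ≥ 0, ∀ (u : ℝ → E N) (R : ℝ), AEStronglyMeasurable u (μI T) → 0 ≤ R →
      (∀ᵐ t ∂μI T, ‖u t‖ ≤ R) → normLG G T u ≤ C * R := by
  obtain ⟨D, hD0, hD⟩ := hG.exists_bound_closedBall 1
  set m := (μI T).real univ
  have hm : 0 ≤ m := measureReal_nonneg
  -- `K` absorbs the measure of `I`: the integrand below is at most `K⁻¹ * D`, and `D * m ≤ K`.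
  set K := 1 + D * m with hK
  have hK1 : 1 ≤ K := by have := mul_nonneg hD0 hm; linarith
  have hK0 : 0 < K := by linarith
  refine ⟨K, hK0.le, fun u R hu hR h => le_of_forall_pos_le_add fun ε hε => ?_⟩
  set l := K * R + ε with hl
  have hl0 : 0 < l := by positivity
  have hb : ∀ᵐ t ∂μI T, G (l⁻¹ • u t) ≤ K⁻¹ * D := by
    filter_upwards [h] with t ht
    have h1 : l⁻¹ • u t = K⁻¹ • ((K / l) • u t) := by
      rw [smul_smul]; congr 1; field_simp
    rw [h1]
    refine (hG.smul_le (by positivity) (inv_le_one_of_one_le₀ hK1) _).trans ?_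
    gcongr
    refine hD _ ?_
    rw [norm_smul, Real.norm_of_nonneg (by positivity), div_mul_eq_mul_div, div_le_one hl0]
    nlinarith
  have hi : Integrable (fun t => G (l⁻¹ • u t)) (μI T) := by
    refine hG.integrable_smul hu (hG.integrable_of_bound hu h) _
  refine normLG_le_of_modular hl0 hi ?_
  have h1 := integral_mono_ae hi (integrable_const (K⁻¹ * D)) hb
  rw [integral_const, smul_eq_mul] at h1
  refine h1.trans ?_
  rw [mul_comm, mul_assoc, inv_mul_le_iff₀ hK0]
  linarith

/-- Lower semicontinuity of the Luxemburg norm under almost everywhere convergence. -/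
lemma normLG_le_of_tendsto {w : ℕ → ℝ → E N} {l : ℝ} (hw : ∀ n, w n ∈ LG G T)
    (hl : ∀ n, normLG G T (w n) < l)
    (hlim : ∀ᵐ t ∂μI T, Tendsto (fun n => w n t) atTop (𝓝 (u t))) :
    u ∈ LG G T ∧ normLG G T u ≤ l := by
  have hl0 : 0 < l := (normLG_nonneg _ _ _).trans_lt (hl 0)
  have hum : AEStronglyMeasurable u (μI T) :=
    aestronglyMeasurable_of_tendsto_ae _ (fun n => (hw n).1) hlim
  have key := integrable_and_integral_le_of_tendsto (μ := μI T)
    (f := fun n t => G (l⁻¹ • w n t)) (g := fun t => G (l⁻¹ • u t)) (C := 1)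
    (fun n => hG.integrable_smul (hw n).1 (hw n).2 _) (fun n t => hG.nonneg _)
    (by filter_upwards [hlim] with t ht
        exact (hG.continuous.tendsto _).comp (ht.const_smul l⁻¹))
    (fun n => hG.modular_le_div_of_normLG_lt (hw n) (hl n))
  refine ⟨⟨hum, ?_⟩, normLG_le_of_modular hl0 key.1 key.2⟩
  have := hG.integrable_smul (hum.const_smul l⁻¹) key.1 l
  simp only [Pi.smul_apply, smul_inv_smul₀ hl0.ne'] at this
  exact this

/-- A partial converse of dominated convergence. Along a subsequence the norms of `w - u` are below
`l n`, so the functions `2 * l n * G((w - u)/l n)` have summable integrals; their sum dominates, and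
their convergence to zero forces pointwise convergence. -/
lemma exists_subseq_dominated {w : ℕ → ℝ → E N} (hw : ∀ n, w n ∈ LG G T) (hu : u ∈ LG G T)
    (hlim : Tendsto (fun n => normLG G T (w n - u)) atTop (𝓝 0)) :
    ∃ φ : ℕ → ℕ, StrictMono φ ∧ ∃ H : ℝ → ℝ, Integrable H (μI T) ∧
      ∀ᵐ t ∂μI T, Tendsto (fun n => w (φ n) t) atTop (𝓝 (u t)) ∧ ∀ n, G (w (φ n) t) ≤ H t := by
  -- The exponent `n + 1` ensures `2 * l n ≤ 1`, so that `G (2 (w - u)) ≤ 2 l n G((w - u)/l n)` by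
  -- convexity.
  let l : ℕ → ℝ := fun n => (1 / 2) ^ (n + 1)
  have hl0 : ∀ n, 0 < l n := fun n => by positivity
  have hl1 : ∀ n, 2 * l n ≤ 1 := fun n => by
    have : ((1 : ℝ) / 2) ^ n ≤ 1 := pow_le_one₀ (by norm_num) (by norm_num)
    simp only [l, pow_succ]; linarith
  have hls : Summable l := (summable_nat_add_iff 1).2
    (summable_geometric_of_lt_one (by norm_num) (by norm_num))
  obtain ⟨φ, hφ, hφl⟩ := extraction_forall_of_eventually
    (P := fun n k => normLG G T (w k - u) < l n) (fun n => hlim.eventually (gt_mem_nhds (hl0 n)))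
  have hd : ∀ n, w (φ n) - u ∈ LG G T := fun n => hG.LG_sub (hw _) hu
  let g : ℕ → ℝ → ℝ := fun n t => G ((l n)⁻¹ • (w (φ n) t - u t))
  have hgi : ∀ n, Integrable (g n) (μI T) := fun n => hG.integrable_smul (hd n).1 (hd n).2 _
  have hg1 : ∀ n, ∫ t, g n t ∂μI T ≤ 1 := fun n => hG.modular_le_div_of_normLG_lt (hd n) (hφl n)
  obtain ⟨H, hHi, hH⟩ := exists_integrable_bound_of_summable (μ := μI T)
    (f := fun n t => 2 * l n * g n t) (fun n => (hgi n).const_mul _)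
    (fun n t => mul_nonneg (by have := hl0 n; positivity) (hG.nonneg _)) (by
      refine Summable.of_nonneg_of_le (fun n => integral_nonneg fun t =>
        mul_nonneg (by have := hl0 n; positivity) (hG.nonneg _)) (fun n => ?_) (hls.mul_left 2)
      rw [integral_const_mul]
      exact mul_le_of_le_one_right (by have := hl0 n; positivity) (hg1 n))
  obtain ⟨C, hC0, hC⟩ := hG.coercive 1 one_pos
  have h2u := hG.integrable_smul hu.1 hu.2 2
  refine ⟨φ, hφ, fun t => G ((2 : ℝ) • u t) + H t, h2u.add hHi, ?_⟩
  filter_upwards [hH] with t ht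
  constructor
  · rw [tendsto_iff_norm_sub_tendsto_zero]
    have hlim2 : Tendsto (fun n => 2 * l n * g n t + l n * C) atTop (𝓝 (0 + 0 * C)) :=
      ht.2.tendsto_atTop_zero.add (hls.tendsto_atTop_zero.mul_const C)
    rw [zero_mul, add_zero] at hlim2
    refine squeeze_zero (fun _ => norm_nonneg _) (fun n => ?_) hlim2
    have h1 := hC ((l n)⁻¹ • (w (φ n) t - u t))
    rw [norm_smul, Real.norm_of_nonneg (inv_nonneg.2 (hl0 n).le), inv_mul_le_iff₀ (hl0 n)] at h1
    have h2 : 0 ≤ l n * g n t := mul_nonneg (hl0 n).le (hG.nonneg _)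
    simp only [g] at h2 ⊢
    linarith
  · intro n
    have h1 := hG.add_le_two_smul (u t) (w (φ n) t - u t)
    rw [add_sub_cancel] at h1
    have h2 : (2 : ℝ) • (w (φ n) t - u t) = (2 * l n) • ((l n)⁻¹ • (w (φ n) t - u t)) := by
      rw [smul_smul, mul_assoc, mul_inv_cancel₀ (hl0 n).ne', mul_one]
    rw [h2] at h1
    have h3 := hG.smul_le (by have := hl0 n; positivity) (hl1 n) ((l n)⁻¹ • (w (φ n) t - u t))
    have h4 := ht.1 n
    simp only [g] at h4
    linarith

end IsYoung

namespace IsGFunction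

variable (hG : IsGFunction G)
include hG

lemma integrable_inner {q : ℝ → E N} (hq : q ∈ LG (conj G) T) (hw : w ∈ LG G T) :
    Integrable (fun t => inner ℝ (q t) (w t)) (μI T) := by
  refine Integrable.mono' (hw.2.add hq.2) (hq.1.inner hw.1) (Eventually.of_forall fun t => ?_)
  rw [real_inner_comm]
  exact hG.abs_inner_le _ _

/-- Hölder's inequality in Orlicz spaces. -/
lemma abs_integral_inner_le {q : ℝ → E N} (hq : q ∈ LG (conj G) T) (hw : w ∈ LG G T) :
    |∫ t, inner ℝ (q t) (w t) ∂μI T| ≤ (∫ t, conj G (q t) ∂μI T + 1) * normLG G T w := by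
  set K := ∫ t, conj G (q t) ∂μI T + 1 with hK
  have hK0 : 0 < K := by
    have : 0 ≤ ∫ t, conj G (q t) ∂μI T := integral_nonneg fun t => hG.conj_nonneg _
    linarith
  refine le_of_forall_pos_le_add fun ε hε => ?_
  set l := normLG G T w + ε / K with hl
  have hl0 : normLG G T w < l := by
    have : 0 < ε / K := by positivity
    linarith
  have hl1 : 0 < l := (normLG_nonneg _ _ _).trans_lt hl0
  have h1 := hG.isYoung.modular_le_div_of_normLG_lt hw hl0
  have hi := hG.isYoung.integrable_smul hw.1 hw.2 l⁻¹
  have h2 : |∫ t, inner ℝ (q t) (w t) ∂μI T| ≤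
      ∫ t, l * (conj G (q t) + G (l⁻¹ • w t)) ∂μI T := by
    rw [← Real.norm_eq_abs]
    refine (norm_integral_le_integral_norm _).trans ?_
    refine integral_mono (hG.integrable_inner hq hw).norm ((hq.2.add hi).const_mul l) fun t => ?_
    have := hG.abs_inner_le (l⁻¹ • w t) (q t)
    rw [real_inner_smul_left, abs_mul, abs_of_pos (inv_pos.2 hl1), inv_mul_le_iff₀ hl1,
      real_inner_comm] at this
    simp only [Real.norm_eq_abs]
    linarith
  rw [integral_const_mul, integral_add hq.2 hi] at h2
  have h3 : l * (∫ t, conj G (q t) ∂μI T + ∫ t, G (l⁻¹ • w t) ∂μI T) ≤ l * K := by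
    gcongr; rw [hK]; gcongr
  have h4 : l * K = K * normLG G T w + ε := by rw [hl]; field_simp
  linarith

/-- If the modulars of `ε⁻¹ q_n` tend to zero for every `ε`, the pairings with `q_n` tend to zero
uniformly on bounded sets. Dominated convergence can thus be applied to modulars, without any dual
Luxemburg norm. -/
lemma abs_integral_inner_le_scaled {q : ℝ → E N} (hq : q ∈ LG (conj G) T) (hw : w ∈ LG G T)
    {ε : ℝ} (hε : 0 < ε) :
    |∫ t, inner ℝ (q t) (w t) ∂μI T| ≤
      ε * (∫ t, conj G (ε⁻¹ • q t) ∂μI T + 1) * normLG G T w := by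
  have h := hG.abs_integral_inner_le (hG.isYoung_conj.LG_smul hq ε⁻¹) hw
  simp only [Pi.smul_apply, real_inner_smul_left] at h
  rw [integral_const_mul, abs_mul, abs_of_pos (inv_pos.2 hε), inv_mul_le_iff₀ hε] at h
  linarith

end IsGFunction

end AnisotropicEL

/-! ### The space of periodic Orlicz–Sobolev functions. -/

namespace AnisotropicEL

variable {N : ℕ} {G : E N → ℝ} {u v w : ℝ → E N} {T : ℝ}

lemma WLGT_ac (hu : u ∈ WLGT G T) : AbsolutelyContinuousOnInterval u (-T) T := hu.1.1

lemma WLGT_mem (hu : u ∈ WLGT G T) : u ∈ LG G T := hu.1.2.1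

lemma WLGT_deriv (hu : u ∈ WLGT G T) : deriv u ∈ LG G T := hu.1.2.2

namespace IsYoung

variable (hG : IsYoung G)
include hG

lemma normLG_smul (hu : u ∈ LG G T) (c : ℝ) : normLG G T (c • u) = |c| * normLG G T u := by
  refine le_antisymm (hG.normLG_smul_le hu c) ?_
  rcases eq_or_ne c 0 with rfl | hc
  · simp [hG.normLG_zero]
  have h := hG.normLG_smul_le (hG.LG_smul hu c) c⁻¹
  rw [inv_smul_smul₀ hc, abs_inv, le_inv_mul_iff₀ (abs_pos.2 hc)] at h
  exact h

lemma WLGT_add (hT : 0 < T) (hu : u ∈ WLGT G T) (hv : v ∈ WLGT G T) : u + v ∈ WLGT G T :=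
  ⟨⟨(WLGT_ac hu).add (WLGT_ac hv), hG.LG_add (WLGT_mem hu) (WLGT_mem hv),
    LG_congr (hG.LG_add (WLGT_deriv hu) (WLGT_deriv hv))
      (deriv_add_ae hT.le (WLGT_ac hu) (WLGT_ac hv)).symm⟩, by
    simp only [Pi.add_apply, hu.2, hv.2]⟩

lemma WLGT_smul (c : ℝ) (hu : u ∈ WLGT G T) : c • u ∈ WLGT G T :=
  ⟨⟨(WLGT_ac hu).const_smul c, hG.LG_smul (WLGT_mem hu) c, by
    rw [deriv_smul_eq]; exact hG.LG_smul (WLGT_deriv hu) c⟩, by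
    simp only [Pi.smul_apply, hu.2]⟩

lemma WLGT_const (ξ : E N) : (fun _ => ξ : ℝ → E N) ∈ WLGT G T := by
  refine ⟨⟨?_, hG.LG_of_bound aestronglyMeasurable_const (R := ‖ξ‖) (by simp), ?_⟩, rfl⟩
  · rw [absolutelyContinuousOnInterval_iff]
    intro ε hε
    exact ⟨1, one_pos, fun I _ _ => by simpa using hε⟩
  · simpa [deriv_const'] using! hG.LG_zero (T := T)

lemma WLGT_zero : (0 : ℝ → E N) ∈ WLGT G T := hG.WLGT_const 0

lemma primitive_mem_WLGT (hT : 0 < T) (ξ : E N) (hw : w ∈ LG G T) (h0 : ∫ t, w t ∂μI T = 0) :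
    primitive T ξ w ∈ WLGT G T := by
  have hwi := hG.LG_integrable hw
  have hac := primitive_ac hT.le ξ hwi
  refine ⟨⟨hac, ?_, LG_congr hw (primitive_deriv hT.le ξ hwi).symm⟩, ?_⟩
  · have hc := hac.continuousOn
    rw [uIcc_neg_self hT.le] at hc
    obtain ⟨C, hC⟩ := isCompact_Icc.exists_bound_of_continuousOn hc
    exact hG.LG_of_bound (hc.aestronglyMeasurable measurableSet_Icc)
      (by filter_upwards [ae_μI_mem_Icc T] with t ht using hC t ht)
  · rw [primitive_neg, primitive_right hT.le, h0, add_zero]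

end IsYoung

lemma measureReal_μI (hT : 0 < T) : (μI T).real univ = 2 * T := by
  rw [measureReal_restrict_apply MeasurableSet.univ, univ_inter, Real.volume_real_Icc_of_le
    (by linarith)]
  ring

lemma integrable_of_ac (hT : 0 < T) (hu : AbsolutelyContinuousOnInterval u (-T) T) :
    Integrable u (μI T) := by
  have hc := hu.continuousOn
  rw [uIcc_neg_self hT.le] at hc
  exact hc.integrableOn_compact isCompact_Icc

lemma norm_sub_le_integral_deriv (hT : 0 < T) (hu : AbsolutelyContinuousOnInterval u (-T) T)
    {s t : ℝ} (hs : s ∈ Icc (-T) T) (ht : t ∈ Icc (-T) T) :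
    ‖u t - u s‖ ≤ ∫ r, ‖deriv u r‖ ∂μI T := by
  rw [← integral_deriv_interval hT.le hu hs ht]
  refine intervalIntegral.norm_integral_le_integral_norm_uIoc.trans ?_
  refine setIntegral_mono_set (integrable_deriv_μI hT.le hu).norm
    (Eventually.of_forall fun _ => norm_nonneg _) (Eventually.of_forall ?_)
  exact uIoc_subset_uIcc.trans (uIcc_subset_Icc hs ht)

lemma norm_le_integral (hT : 0 < T) (hu : AbsolutelyContinuousOnInterval u (-T) T)
    {t : ℝ} (ht : t ∈ Icc (-T) T) :
    2 * T * ‖u t‖ ≤ ∫ s, ‖u s‖ ∂μI T + 2 * T * ∫ r, ‖deriv u r‖ ∂μI T := by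
  have h1 : ∫ _s, ‖u t‖ ∂μI T ≤ ∫ s, (‖u s‖ + ∫ r, ‖deriv u r‖ ∂μI T) ∂μI T := by
    refine integral_mono_ae (integrable_const _)
      ((integrable_of_ac hT hu).norm.add (integrable_const _)) ?_
    filter_upwards [ae_μI_mem_Icc T] with s hs
    have h2 := norm_sub_le_integral_deriv hT hu hs ht
    have h3 := norm_le_insert' (u t) (u s)
    linarith
  rw [integral_add (integrable_of_ac hT hu).norm (integrable_const _), integral_const,
    integral_const, measureReal_μI hT, smul_eq_mul, smul_eq_mul] at h1
  exact h1

lemma IsYoung.exists_norm_le_normWLG (hG : IsYoung G) (hT : 0 < T) :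
    ∃ C ≥ 0, ∀ u ∈ WLG G T, ∀ t ∈ Icc (-T) T, ‖u t‖ ≤ C * normWLG G T u := by
  obtain ⟨C, hC0, hC⟩ := hG.exists_integral_norm_le T
  refine ⟨C / (2 * T) + C, by positivity, fun u hu t ht => ?_⟩
  have h1 := norm_le_integral hT hu.1 ht
  have h2 := hC u hu.2.1
  have h3 := hC _ hu.2.2
  have h4 := normLG_nonneg G T u
  have h5 := normLG_nonneg G T (deriv u)
  have h6 : ‖u t‖ ≤ (2 * T)⁻¹ * (C * normLG G T u) + C * normLG G T (deriv u) := by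
    rw [← mul_le_mul_iff_right₀ (by positivity : 0 < 2 * T)]
    rw [mul_add, mul_inv_cancel_left₀ (by positivity)]
    nlinarith
  refine h6.trans ?_
  unfold normWLG
  have h7 : 0 ≤ C / (2 * T) * normLG G T (deriv u) := by positivity
  have h8 : 0 ≤ C * normLG G T u := by positivity
  rw [div_eq_inv_mul] at h7 ⊢
  nlinarith

lemma normWLG_congr (h : EqOn u v (Icc (-T) T)) : normWLG G T u = normWLG G T v := by
  unfold normWLG
  rw [normLG_congr (deriv_congr_ae h), normLG_congr (u := u) (v := v)]
  filter_upwards [ae_μI_mem_Icc T] with t ht using h ht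

/-- The vector space underlying `W¹_T L^G`. -/
def periodicSubmodule (hG : IsGFunction G) (hT : 0 < T) : Submodule ℝ (ℝ → E N) where
  carrier := WLGT G T
  add_mem' := hG.isYoung.WLGT_add hT
  zero_mem' := hG.isYoung.WLGT_zero
  smul_mem' c _ := hG.isYoung.WLGT_smul c

/-- The space `W¹_T L^G`, a complete seminormed space. Elements of norm zero are those
which vanish on `[-T, T]`. -/
def PeriodicSpace (hG : IsGFunction G) (hT : 0 < T) : Type := ↥(periodicSubmodule hG hT)

namespace PeriodicSpace

variable (hG : IsGFunction G) (hT : 0 < T)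

instance : AddCommGroup (PeriodicSpace hG hT) :=
  inferInstanceAs (AddCommGroup (periodicSubmodule hG hT))

noncomputable instance : Module ℝ (PeriodicSpace hG hT) :=
  inferInstanceAs (Module ℝ (periodicSubmodule hG hT))

noncomputable instance : Norm (PeriodicSpace hG hT) := ⟨fun u => normWLG G T u.1⟩

variable {hG hT}

/-- The function represented by an element of the space. -/
def fn (u : PeriodicSpace hG hT) : ℝ → E N := u.1

lemma mem (u : PeriodicSpace hG hT) : u.fn ∈ WLGT G T := u.2

/-- An element of the space from a function. -/
def mk (u : ℝ → E N) (hu : u ∈ WLGT G T) : PeriodicSpace hG hT := ⟨u, hu⟩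

lemma fn_add (u v : PeriodicSpace hG hT) : (u + v).fn = u.fn + v.fn := rfl

lemma fn_smul (c : ℝ) (u : PeriodicSpace hG hT) : (c • u).fn = c • u.fn := rfl

lemma fn_zero : (0 : PeriodicSpace hG hT).fn = 0 := rfl

lemma ac (u : PeriodicSpace hG hT) : AbsolutelyContinuousOnInterval u.fn (-T) T := WLGT_ac u.mem

lemma mem_LG (u : PeriodicSpace hG hT) : u.fn ∈ LG G T := WLGT_mem u.mem

lemma deriv_mem (u : PeriodicSpace hG hT) : deriv u.fn ∈ LG G T := WLGT_deriv u.mem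

lemma deriv_add_ae (u v : PeriodicSpace hG hT) :
    ∀ᵐ t ∂μI T, deriv (u + v).fn t = deriv u.fn t + deriv v.fn t :=
  AnisotropicEL.deriv_add_ae hT.le u.ac v.ac

lemma deriv_sub_ae (u v : PeriodicSpace hG hT) :
    ∀ᵐ t ∂μI T, deriv (u - v).fn t = deriv u.fn t - deriv v.fn t :=
  AnisotropicEL.deriv_sub_ae hT.le u.ac v.ac

lemma deriv_smul (c : ℝ) (u : PeriodicSpace hG hT) (t : ℝ) :
    deriv (c • u).fn t = c • deriv u.fn t := congrFun (deriv_smul_eq c u.fn) t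

noncomputable instance : SeminormedAddCommGroup (PeriodicSpace hG hT) :=
  SeminormedAddCommGroup.ofCore (𝕜 := ℝ)
    { norm_nonneg := fun u => add_nonneg (normLG_nonneg _ _ _) (normLG_nonneg _ _ _)
      norm_smul := fun c u => by
        change normLG G T (c • u).fn + normLG G T (deriv (c • u.fn)) =
          ‖c‖ * (normLG G T u.fn + normLG G T (deriv u.fn))
        rw [deriv_smul_eq, fn_smul, hG.isYoung.normLG_smul u.mem_LG,
          hG.isYoung.normLG_smul u.deriv_mem, Real.norm_eq_abs, mul_add]
      norm_triangle := fun u v => by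
        change normLG G T (u.fn + v.fn) + normLG G T (deriv (u + v).fn) ≤
          (normLG G T u.fn + normLG G T (deriv u.fn)) +
            (normLG G T v.fn + normLG G T (deriv v.fn))
        rw [normLG_congr (u.deriv_add_ae v)]
        have h1 := hG.isYoung.normLG_add_le u.mem_LG v.mem_LG
        have h2 := hG.isYoung.normLG_add_le u.deriv_mem v.deriv_mem
        simp only [Pi.add_def] at h2
        linarith }

lemma norm_def (u : PeriodicSpace hG hT) :
    ‖u‖ = normLG G T u.fn + normLG G T (deriv u.fn) := rfl

noncomputable instance : NormedSpace ℝ (PeriodicSpace hG hT) where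
  norm_smul_le c u := by
    rw [norm_def, norm_def]
    change normLG G T (c • u).fn + normLG G T (deriv (c • u.fn)) ≤ _
    rw [deriv_smul_eq, fn_smul, hG.isYoung.normLG_smul u.mem_LG,
      hG.isYoung.normLG_smul u.deriv_mem, Real.norm_eq_abs, mul_add]

lemma norm_eq (u : PeriodicSpace hG hT) : ‖u‖ = normWLG G T u.fn := rfl

lemma normLG_deriv_le (u : PeriodicSpace hG hT) : normLG G T (deriv u.fn) ≤ ‖u‖ :=
  le_add_of_nonneg_left (normLG_nonneg _ _ _)

lemma exists_norm_apply_le (hG : IsGFunction G) (hT : 0 < T) :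
    ∃ C ≥ 0, ∀ (u : PeriodicSpace hG hT), ∀ t ∈ Icc (-T) T, ‖u.fn t‖ ≤ C * ‖u‖ := by
  obtain ⟨C, hC0, hC⟩ := hG.isYoung.exists_norm_le_normWLG hT
  exact ⟨C, hC0, fun u t ht => hC u.fn u.mem.1 t ht⟩

lemma eqOn_zero_of_norm_eq_zero (u : PeriodicSpace hG hT) (h : ‖u‖ = 0) :
    EqOn u.fn 0 (Icc (-T) T) := by
  intro t ht
  obtain ⟨C, -, hC⟩ := exists_norm_apply_le hG hT
  have := hC u t ht
  rw [h, mul_zero] at this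
  exact norm_le_zero_iff.1 this

lemma norm_eq_zero_of_eqOn (u : PeriodicSpace hG hT) (h : EqOn u.fn 0 (Icc (-T) T)) :
    ‖u‖ = 0 := by
  rw [norm_eq, normWLG_congr h]
  exact (norm_eq (0 : PeriodicSpace hG hT)).symm.trans norm_zero

/-- For a rapidly Cauchy sequence the derivatives converge almost everywhere to some `w`, and in
norm by lower semicontinuity. The limit is the primitive of `w` starting at the limit `ξ` of the
values at `-T`; uniform convergence to it and periodicity of the sequence force `∫ w = 0`. -/
instance : CompleteSpace (PeriodicSpace hG hT) := by
  have hY := hG.isYoung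
  refine Metric.complete_of_convergent_controlled_sequences (fun n => (1 / 2 : ℝ) ^ n)
    (fun n => by positivity) fun u hu => ?_
  obtain ⟨C, hC0, hC⟩ := exists_norm_apply_le hG hT
  obtain ⟨D, hD0, hD⟩ := hY.exists_integral_norm_le T
  have hgeo : Summable fun n : ℕ => ((1 : ℝ) / 2) ^ n :=
    summable_geometric_of_lt_one (by norm_num) (by norm_num)
  have hdiff : ∀ n m, n ≤ m → normLG G T (deriv (u n).fn - deriv (u m).fn) < (1 / 2) ^ n := by
    intro n m hnm
    have h1 := hu n n m le_rfl hnm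
    rw [dist_eq_norm] at h1
    refine lt_of_le_of_lt ?_ h1
    refine le_of_eq_of_le (normLG_congr ?_) (u n - u m).normLG_deriv_le
    filter_upwards [(u n).deriv_sub_ae (u m)] with t ht using ht.symm
  have hdm : ∀ n m, deriv (u n).fn - deriv (u m).fn ∈ LG G T := fun n m =>
    hY.LG_sub (u n).deriv_mem (u m).deriv_mem
  obtain ⟨H, hHi, hH⟩ := exists_integrable_bound_of_summable (μ := μI T)
    (f := fun n t => ‖deriv (u n).fn t - deriv (u (n + 1)).fn t‖)
    (fun n => (hY.LG_integrable (hdm n (n + 1))).norm) (fun _ _ => norm_nonneg _) (by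
      refine Summable.of_nonneg_of_le (fun n => integral_nonneg fun t => norm_nonneg _)
        (fun n => ?_) (hgeo.mul_left D)
      exact (hD _ (hdm n (n + 1))).trans
        (mul_le_mul_of_nonneg_left (hdiff n (n + 1) n.le_succ).le hD0))
  have hex : ∀ᵐ t ∂μI T, ∃ y, Tendsto (fun n => deriv (u n).fn t) atTop (𝓝 y) := by
    filter_upwards [hH] with t ht
    refine cauchySeq_tendsto_of_complete (cauchySeq_of_summable_dist ?_)
    simpa [dist_eq_norm] using ht.2
  let w : ℝ → E N := fun t => limUnder atTop fun n => deriv (u n).fn t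
  have hw : ∀ᵐ t ∂μI T, Tendsto (fun n => deriv (u n).fn t) atTop (𝓝 (w t)) := by
    filter_upwards [hex] with t ht using tendsto_nhds_limUnder ht
  have hdw : ∀ n, deriv (u n).fn - w ∈ LG G T ∧
      normLG G T (deriv (u n).fn - w) ≤ (1 / 2) ^ n := by
    intro n
    refine hY.normLG_le_of_tendsto (w := fun m => deriv (u n).fn - deriv (u (n + m)).fn)
      (fun m => hdm n _) (fun m => hdiff n _ (Nat.le_add_right n m)) ?_
    filter_upwards [hw] with t ht
    have := ((tendsto_add_atTop_iff_nat n).2 ht).const_sub (deriv (u n).fn t)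
    simpa [add_comm] using this
  have hwG : w ∈ LG G T := by
    have := hY.LG_sub (u 0).deriv_mem (hdw 0).1
    rwa [sub_sub_cancel] at this
  have hpt : ∀ t ∈ Icc (-T) T, CauchySeq fun n => (u n).fn t := by
    intro t ht
    refine cauchySeq_of_summable_dist (Summable.of_nonneg_of_le (fun _ => dist_nonneg)
      (fun n => ?_) (hgeo.mul_left C))
    rw [dist_eq_norm]
    have h1 := hC (u n - u (n + 1)) t ht
    refine h1.trans (mul_le_mul_of_nonneg_left ?_ hC0)
    rw [← dist_eq_norm]
    exact (hu n n (n + 1) le_rfl n.le_succ).le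
  obtain ⟨ξ, hξ⟩ := cauchySeq_tendsto_of_complete (hpt (-T) ⟨le_rfl, by linarith⟩)
  have hwi := hY.LG_integrable hwG
  have hint : ∀ n, ∫ t, ‖deriv (u n).fn t - w t‖ ∂μI T ≤ D * (1 / 2) ^ n := fun n =>
    (hD _ (hdw n).1).trans (mul_le_mul_of_nonneg_left (hdw n).2 hD0)
  have hsup : ∀ n, ∀ t ∈ Icc (-T) T, ‖(u n).fn t - primitive T ξ w t‖ ≤
      ‖(u n).fn (-T) - ξ‖ + D * (1 / 2) ^ n := by
    intro n t ht
    have hac : AbsolutelyContinuousOnInterval ((u n).fn - primitive T ξ w) (-T) T :=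
      (u n).ac.sub (primitive_ac hT.le ξ hwi)
    have h1 := norm_sub_le_integral_deriv hT hac (s := -T) ⟨le_rfl, by linarith⟩ ht
    have h2 : ∫ t, ‖deriv ((u n).fn - primitive T ξ w) t‖ ∂μI T =
        ∫ t, ‖deriv (u n).fn t - w t‖ ∂μI T := by
      refine integral_congr_ae ?_
      filter_upwards [AnisotropicEL.deriv_sub_ae hT.le (u n).ac (primitive_ac hT.le ξ hwi),
        primitive_deriv hT.le ξ hwi] with t h3 h4
      rw [h3, Pi.sub_apply, h4]
    rw [h2] at h1
    simp only [Pi.sub_apply, primitive_neg] at h1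
    have h3 := norm_le_insert' ((u n).fn t - primitive T ξ w t) ((u n).fn (-T) - ξ)
    linarith [hint n]
  have hb0 : Tendsto (fun n => ‖(u n).fn (-T) - ξ‖ + D * (1 / 2) ^ n) atTop (𝓝 0) := by
    have h1 := tendsto_iff_norm_sub_tendsto_zero.1 hξ
    simpa using h1.add ((tendsto_pow_atTop_nhds_zero_of_lt_one (by norm_num)
      (by norm_num : (1 / 2 : ℝ) < 1)).const_mul D)
  have hTm : T ∈ Icc (-T) T := ⟨by linarith, le_rfl⟩
  have h0 : ∫ t, w t ∂μI T = 0 := by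
    have h1 : Tendsto (fun n => (u n).fn T) atTop (𝓝 (primitive T ξ w T)) :=
      tendsto_iff_norm_sub_tendsto_zero.2
        (squeeze_zero (fun _ => norm_nonneg _) (fun n => hsup n T hTm) hb0)
    have h2 : (fun n => (u n).fn T) = fun n => (u n).fn (-T) := by
      ext1 n; exact (u n).mem.2.symm
    rw [h2] at h1
    have h3 := tendsto_nhds_unique h1 hξ
    rw [primitive_right hT.le] at h3
    simpa using h3
  let U : PeriodicSpace hG hT := mk _ (hY.primitive_mem_WLGT hT ξ hwG h0)
  obtain ⟨K, hK0, hK⟩ := hY.exists_normLG_le_of_bound T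
  refine ⟨U, tendsto_iff_norm_sub_tendsto_zero.2 (squeeze_zero (fun _ => norm_nonneg _)
    (g := fun n => K * (‖(u n).fn (-T) - ξ‖ + D * (1 / 2) ^ n) + (1 / 2) ^ n) (fun n => ?_) ?_)⟩
  · rw [norm_def]
    refine add_le_add (hK _ _ (u n - U).mem_LG.1 (by positivity) ?_) ?_
    · filter_upwards [ae_μI_mem_Icc T] with t ht using hsup n t ht
    · refine le_of_eq_of_le (normLG_congr ?_) (hdw n).2
      filter_upwards [(u n).deriv_sub_ae U, primitive_deriv hT.le ξ hwi] with t h1 h2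
      rw [h1, Pi.sub_apply]
      congr 1
  · simpa using (hb0.const_mul K).add (tendsto_pow_atTop_nhds_zero_of_lt_one (by norm_num)
      (by norm_num : (1 / 2 : ℝ) < 1))

end PeriodicSpace

end AnisotropicEL

/-! ### The action functional is continuously differentiable. -/

namespace AnisotropicEL

variable {N : ℕ} {G : E N → ℝ} {u v w : ℝ → E N} {T : ℝ} {L : ℝ → E N → E N → ℝ}

/-- A Carathéodory Lagrangian, continuously differentiable in `(x, v)`, of `G`-growth. -/
structure IsLagrangian (G : E N → ℝ) (T : ℝ) (L : ℝ → E N → E N → ℝ) : Prop where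
  hasDerivAt : ∀ t ∈ Icc (-T) T, ∀ x v h k, HasDerivAt (fun s : ℝ => L t (x + s • h) (v + s • k))
    (inner ℝ (gradX L t x v) h + inner ℝ (gradV L t x v) k) 0
  continuous : ∀ t ∈ Icc (-T) T, Continuous fun p : E N × E N => L t p.1 p.2
  unif : ∀ R : ℝ, ∀ ε > 0, ∃ δ > 0, ∀ t ∈ Icc (-T) T, ∀ x x' v v' : E N, ‖x‖ ≤ R → ‖x'‖ ≤ R →
    ‖v‖ ≤ R → ‖v'‖ ≤ R → ‖x - x'‖ < δ → ‖v - v'‖ < δ →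
    ‖gradX L t x v - gradX L t x' v'‖ ≤ ε ∧ ‖gradV L t x v - gradV L t x' v'‖ ≤ ε
  meas : ∀ u w : ℝ → E N, AEStronglyMeasurable u (μI T) → AEStronglyMeasurable w (μI T) →
    AEStronglyMeasurable (fun t => L t (u t) (w t)) (μI T) ∧
    AEStronglyMeasurable (fun t => gradX L t (u t) (w t)) (μI T) ∧
    AEStronglyMeasurable (fun t => gradV L t (u t) (w t)) (μI T)
  bound : ∃ B : ℝ → ℝ, Integrable B (μI T) ∧ (∀ t ∈ Icc (-T) T, 0 ≤ B t) ∧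
    ∀ R : ℝ, ∃ A ≥ 0, ∀ t ∈ Icc (-T) T, ∀ x v : E N, ‖x‖ ≤ R →
      |L t x v| ≤ A * (B t + G v) ∧ ‖gradX L t x v‖ ≤ A * (B t + G v) ∧
      conj G (gradV L t x v) ≤ A * (B t + G v)

namespace IsLagrangian

variable (hL : IsLagrangian G T L)
include hL

lemma tendsto_grad {t : ℝ} (ht : t ∈ Icc (-T) T) {ι : Type*} {l : Filter ι} {x v : ι → E N}
    {x₀ v₀ : E N} (hx : Tendsto x l (𝓝 x₀)) (hv : Tendsto v l (𝓝 v₀)) :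
    Tendsto (fun n => gradX L t (x n) (v n)) l (𝓝 (gradX L t x₀ v₀)) ∧
    Tendsto (fun n => gradV L t (x n) (v n)) l (𝓝 (gradV L t x₀ v₀)) := by
  set R := ‖x₀‖ + ‖v₀‖ + 1
  have hxR : ∀ᶠ n in l, ‖x n‖ ≤ R := by
    filter_upwards [hx.norm.eventually (gt_mem_nhds (lt_add_one ‖x₀‖))] with n hn
    have := norm_nonneg v₀
    simp only [R]; linarith
  have hvR : ∀ᶠ n in l, ‖v n‖ ≤ R := by
    filter_upwards [hv.norm.eventually (gt_mem_nhds (lt_add_one ‖v₀‖))] with n hn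
    have := norm_nonneg x₀
    simp only [R]; linarith
  have h0 : ‖x₀‖ ≤ R := by have := norm_nonneg v₀; simp only [R]; linarith
  have h1 : ‖v₀‖ ≤ R := by have := norm_nonneg x₀; simp only [R]; linarith
  have key : ∀ ε > 0, ∀ᶠ n in l, ‖gradX L t (x n) (v n) - gradX L t x₀ v₀‖ ≤ ε ∧
      ‖gradV L t (x n) (v n) - gradV L t x₀ v₀‖ ≤ ε := by
    intro ε hε
    obtain ⟨δ, hδ, h⟩ := hL.unif R ε hε
    filter_upwards [hxR, hvR, (tendsto_iff_norm_sub_tendsto_zero.1 hx).eventually (gt_mem_nhds hδ),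
      (tendsto_iff_norm_sub_tendsto_zero.1 hv).eventually (gt_mem_nhds hδ)] with n a1 a2 a3 a4
    exact h t ht _ _ _ _ a1 h0 a2 h1 a3 a4
  constructor <;> rw [Metric.tendsto_nhds] <;> intro ε hε <;>
    filter_upwards [key (ε / 2) (half_pos hε)] with n hn <;> rw [dist_eq_norm]
  · linarith [hn.1]
  · linarith [hn.2]

variable (hG : IsGFunction G)

lemma integrable_comp (hu : AEStronglyMeasurable u (μI T)) {R : ℝ}
    (hR : ∀ᵐ t ∂μI T, ‖u t‖ ≤ R) (hw : w ∈ LG G T) :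
    Integrable (fun t => L t (u t) (w t)) (μI T) ∧
    Integrable (fun t => gradX L t (u t) (w t)) (μI T) := by
  obtain ⟨B, hB, hB0, hbd⟩ := hL.bound
  obtain ⟨A, hA, h⟩ := hbd R
  obtain ⟨m1, m2, -⟩ := hL.meas u w hu hw.1
  constructor
  · refine Integrable.mono' ((hB.add hw.2).const_mul A) m1 ?_
    filter_upwards [ae_μI_mem_Icc T, hR] with t ht hr using (h t ht _ _ hr).1
  · refine Integrable.mono' ((hB.add hw.2).const_mul A) m2 ?_
    filter_upwards [ae_μI_mem_Icc T, hR] with t ht hr using (h t ht _ _ hr).2.1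

include hG

lemma gradV_mem (hu : AEStronglyMeasurable u (μI T)) {R : ℝ}
    (hR : ∀ᵐ t ∂μI T, ‖u t‖ ≤ R) (hw : w ∈ LG G T) :
    (fun t => gradV L t (u t) (w t)) ∈ LG (conj G) T := by
  obtain ⟨B, hB, hB0, hbd⟩ := hL.bound
  obtain ⟨A, hA, h⟩ := hbd R
  obtain ⟨-, -, m3⟩ := hL.meas u w hu hw.1
  refine ⟨m3, Integrable.mono' ((hB.add hw.2).const_mul A)
    (hG.isYoung_conj.aestronglyMeasurable_comp m3) ?_⟩
  filter_upwards [ae_μI_mem_Icc T, hR] with t ht hr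
  rw [Real.norm_of_nonneg (hG.conj_nonneg _)]
  exact (h t ht _ _ hr).2.2

/-- A bound for the derivative of the Lagrangian in the direction `(h, k)`. -/
lemma exists_deriv_bound : ∃ B : ℝ → ℝ, Integrable B (μI T) ∧ (∀ t ∈ Icc (-T) T, 0 ≤ B t) ∧
    ∀ R : ℝ, ∃ A ≥ 0, ∀ t ∈ Icc (-T) T, ∀ x v h k : E N, ‖x‖ ≤ R → ‖h‖ ≤ R →
      |inner ℝ (gradX L t x v) h + inner ℝ (gradV L t x v) k| ≤ A * (B t + G v + G k) := by
  obtain ⟨B, hB, hB0, hbd⟩ := hL.bound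
  refine ⟨B, hB, hB0, fun R => ?_⟩
  obtain ⟨A, hA, hb⟩ := hbd R
  refine ⟨A * |R| + A + 1, by positivity, fun t ht x v h k hx hh => ?_⟩
  obtain ⟨-, h2, h3⟩ := hb t ht x v hx
  have h4 := hG.abs_inner_le k (gradV L t x v)
  rw [real_inner_comm] at h4
  have h5 := abs_real_inner_le_norm (gradX L t x v) h
  have h6 := hB0 t ht
  have h7 := hG.nonneg v
  have h8 := hG.nonneg k
  have h9 : ‖gradX L t x v‖ * ‖h‖ ≤ A * (B t + G v) * |R| :=
    mul_le_mul h2 (hh.trans (le_abs_self R)) (norm_nonneg _) (by positivity)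
  have h10 := abs_add_le (inner ℝ (gradX L t x v) h) (inner ℝ (gradV L t x v) k)
  have h11 : 0 ≤ (A * |R| + A) * G k := by positivity
  nlinarith

end IsLagrangian

lemma PeriodicSpace.exists_bound {hG : IsGFunction G} {hT : 0 < T} (u : PeriodicSpace hG hT) :
    ∃ R ≥ 0, (∀ t ∈ Icc (-T) T, ‖u.fn t‖ ≤ R) ∧ ∀ᵐ t ∂μI T, ‖u.fn t‖ ≤ R := by
  obtain ⟨C, hC0, hC⟩ := PeriodicSpace.exists_norm_apply_le hG hT
  refine ⟨C * ‖u‖, by positivity, fun t ht => hC u t ht, ?_⟩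
  filter_upwards [ae_μI_mem_Icc T] with t ht using hC u t ht

namespace IsLagrangian

variable {hG : IsGFunction G} {hT : 0 < T}

section

variable (hL : IsLagrangian G T L) (u φ : PeriodicSpace hG hT)
include hL

lemma integrable_action : Integrable (fun t => L t (u.fn t) (deriv u.fn t)) (μI T) := by
  obtain ⟨R, -, -, hR⟩ := u.exists_bound
  exact (hL.integrable_comp u.mem_LG.1 hR u.deriv_mem).1

lemma integrable_gradX : Integrable (fun t => gradX L t (u.fn t) (deriv u.fn t)) (μI T) := by
  obtain ⟨R, -, -, hR⟩ := u.exists_bound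
  exact (hL.integrable_comp u.mem_LG.1 hR u.deriv_mem).2

lemma gradV_mem_LG : (fun t => gradV L t (u.fn t) (deriv u.fn t)) ∈ LG (conj G) T := by
  obtain ⟨R, -, -, hR⟩ := u.exists_bound
  exact hL.gradV_mem hG u.mem_LG.1 hR u.deriv_mem

end

end IsLagrangian

lemma integrable_inner_of_bound {r h : ℝ → E N} (hr : Integrable r (μI T))
    (hh : AEStronglyMeasurable h (μI T)) {R : ℝ} (hR : ∀ᵐ t ∂μI T, ‖h t‖ ≤ R) :
    Integrable (fun t => inner ℝ (r t) (h t)) (μI T) := by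
  refine Integrable.mono' (hr.norm.mul_const R) (hr.aestronglyMeasurable.inner hh) ?_
  filter_upwards [hR] with t ht
  exact (abs_real_inner_le_norm _ _).trans (by gcongr)

lemma abs_integral_inner_le_of_bound {r h : ℝ → E N} (hr : Integrable r (μI T))
    (hh : AEStronglyMeasurable h (μI T)) {R : ℝ} (hR : ∀ᵐ t ∂μI T, ‖h t‖ ≤ R) :
    |∫ t, inner ℝ (r t) (h t) ∂μI T| ≤ (∫ t, ‖r t‖ ∂μI T) * R := by
  rw [← Real.norm_eq_abs]
  refine (norm_integral_le_integral_norm _).trans ?_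
  rw [← integral_mul_const]
  refine integral_mono_ae (integrable_inner_of_bound hr hh hR).norm (hr.norm.mul_const R) ?_
  filter_upwards [hR] with t ht
  exact (abs_real_inner_le_norm _ _).trans (by gcongr)

/-- The linear functional `φ ↦ ∫ ⟨r, φ⟩ + ⟨q, φ'⟩`. -/
noncomputable def pairing (hG : IsGFunction G) (hT : 0 < T) (r q : ℝ → E N)
    (hr : Integrable r (μI T)) (hq : q ∈ LG (conj G) T) : PeriodicSpace hG hT →L[ℝ] ℝ :=
  LinearMap.mkContinuous
    { toFun := fun φ => ∫ t, inner ℝ (r t) (φ.fn t) ∂μI T + ∫ t, inner ℝ (q t) (deriv φ.fn t) ∂μI T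
      map_add' := fun φ ψ => by
        obtain ⟨R, -, -, hR⟩ := φ.exists_bound
        obtain ⟨S, -, -, hS⟩ := ψ.exists_bound
        have h1 : ∫ t, inner ℝ (q t) (deriv (φ + ψ).fn t) ∂μI T =
            ∫ t, (inner ℝ (q t) (deriv φ.fn t) + inner ℝ (q t) (deriv ψ.fn t)) ∂μI T := by
          refine integral_congr_ae ?_
          filter_upwards [φ.deriv_add_ae ψ] with t ht
          rw [ht, inner_add_right]
        rw [h1, integral_add (hG.integrable_inner hq φ.deriv_mem)
          (hG.integrable_inner hq ψ.deriv_mem)]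
        simp only [PeriodicSpace.fn_add, Pi.add_apply, inner_add_right]
        rw [integral_add (integrable_inner_of_bound hr φ.mem_LG.1 hR)
          (integrable_inner_of_bound hr ψ.mem_LG.1 hS)]
        ring
      map_smul' := fun c φ => by
        simp only [PeriodicSpace.deriv_smul]
        simp only [PeriodicSpace.fn_smul, Pi.smul_apply,
          inner_smul_right, integral_const_mul, RingHom.id_apply, smul_eq_mul]
        ring }
    ((∫ t, ‖r t‖ ∂μI T) * (PeriodicSpace.exists_norm_apply_le hG hT).choose +
      (∫ t, conj G (q t) ∂μI T + 1)) fun φ => by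
    obtain ⟨hC0, hC⟩ := (PeriodicSpace.exists_norm_apply_le hG hT).choose_spec
    set C := (PeriodicSpace.exists_norm_apply_le hG hT).choose
    have h1 := abs_integral_inner_le_of_bound hr φ.mem_LG.1 (R := C * ‖φ‖)
      (by filter_upwards [ae_μI_mem_Icc T] with t ht using hC φ t ht)
    have h2 := hG.abs_integral_inner_le hq φ.deriv_mem
    have h3 : 0 ≤ ∫ t, conj G (q t) ∂μI T := integral_nonneg fun t => hG.conj_nonneg _
    have h4 := mul_le_mul_of_nonneg_left φ.normLG_deriv_le
      (by linarith : 0 ≤ ∫ t, conj G (q t) ∂μI T + 1)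
    simp only [LinearMap.coe_mk, AddHom.coe_mk, Real.norm_eq_abs]
    refine (abs_add_le _ _).trans ?_
    linarith

lemma pairing_apply {hG : IsGFunction G} {hT : 0 < T} {r q : ℝ → E N}
    (hr : Integrable r (μI T)) (hq : q ∈ LG (conj G) T) (φ : PeriodicSpace hG hT) :
    pairing hG hT r q hr hq φ =
      ∫ t, inner ℝ (r t) (φ.fn t) ∂μI T + ∫ t, inner ℝ (q t) (deriv φ.fn t) ∂μI T := rfl

namespace IsLagrangian

variable {hG : IsGFunction G} {hT : 0 < T}

/-- The differential of the action functional. -/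
noncomputable def dAction (hL : IsLagrangian G T L) (u : PeriodicSpace hG hT) :
    PeriodicSpace hG hT →L[ℝ] ℝ :=
  pairing hG hT _ _ (hL.integrable_gradX u) (hL.gradV_mem_LG u)

variable (hL : IsLagrangian G T L)
include hL

lemma integrable_inner_gradX (u φ : PeriodicSpace hG hT) :
    Integrable (fun t => inner ℝ (gradX L t (u.fn t) (deriv u.fn t)) (φ.fn t)) (μI T) := by
  obtain ⟨R, -, -, hR⟩ := φ.exists_bound
  exact integrable_inner_of_bound (hL.integrable_gradX u) φ.mem_LG.1 hR

lemma integrable_inner_gradV (u φ : PeriodicSpace hG hT) :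
    Integrable (fun t => inner ℝ (gradV L t (u.fn t) (deriv u.fn t)) (deriv φ.fn t)) (μI T) :=
  hG.integrable_inner (hL.gradV_mem_LG u) φ.deriv_mem

lemma dAction_apply (u φ : PeriodicSpace hG hT) :
    hL.dAction u φ = ∫ t, (inner ℝ (gradX L t (u.fn t) (deriv u.fn t)) (φ.fn t) +
      inner ℝ (gradV L t (u.fn t) (deriv u.fn t)) (deriv φ.fn t)) ∂μI T := by
  rw [integral_add (hL.integrable_inner_gradX u φ) (hL.integrable_inner_gradV u φ)]
  rfl

/-- Differentiation under the integral sign; `Δ₂` bounds `G(u̇ + sφ̇)` by an integrable function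
independent of `|s| ≤ 1`. -/
lemma hasDerivAt_action (u φ : PeriodicSpace hG hT) :
    HasDerivAt (fun s : ℝ => action L T (u + s • φ).fn) (hL.dAction u φ) 0 := by
  obtain ⟨R, hR0, hR, hR'⟩ := u.exists_bound
  obtain ⟨S, hS0, hS, hS'⟩ := φ.exists_bound
  obtain ⟨B, hB, hB0, hbd⟩ := hL.exists_deriv_bound hG
  obtain ⟨A, hA, hb⟩ := hbd (R + S)
  obtain ⟨C, hC0, hC⟩ := hG.isYoung.exists_add_le 1
  have hder : ∀ s : ℝ, ∀ᵐ t ∂μI T, deriv (u + s • φ).fn t =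
      deriv u.fn t + s • deriv φ.fn t := fun s => by
    filter_upwards [u.deriv_add_ae (s • φ)] with t ht
    rw [ht, PeriodicSpace.deriv_smul]
  have heq : (fun s : ℝ => action L T (u + s • φ).fn) = fun s : ℝ =>
      ∫ t, L t (u.fn t + s • φ.fn t) (deriv u.fn t + s • deriv φ.fn t) ∂μI T := by
    ext s
    refine integral_congr_ae ?_
    filter_upwards [hder s] with t ht
    rw [ht]; rfl
  have hmu : ∀ s : ℝ, AEStronglyMeasurable (fun t => u.fn t + s • φ.fn t) (μI T) := fun s =>
    u.mem_LG.1.add (φ.mem_LG.1.const_smul s)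
  have hmd : ∀ s : ℝ, AEStronglyMeasurable (fun t => deriv u.fn t + s • deriv φ.fn t) (μI T) :=
    fun s => u.deriv_mem.1.add (φ.deriv_mem.1.const_smul s)
  rw [heq]
  have key := hasDerivAt_integral_of_dominated_loc_of_deriv_le (μ := μI T) (x₀ := (0 : ℝ))
    (F := fun s t => L t (u.fn t + s • φ.fn t) (deriv u.fn t + s • deriv φ.fn t))
    (F' := fun s t => inner ℝ (gradX L t (u.fn t + s • φ.fn t) (deriv u.fn t + s • deriv φ.fn t))
      (φ.fn t) + inner ℝ (gradV L t (u.fn t + s • φ.fn t) (deriv u.fn t + s • deriv φ.fn t))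
      (deriv φ.fn t))
    (bound := fun t => A * (B t + C * (G (deriv u.fn t) + G (deriv φ.fn t) + 1) +
      G (deriv φ.fn t))) (Metric.ball_mem_nhds (0 : ℝ) one_pos)
    (Eventually.of_forall fun s => (hL.meas _ _ (hmu s) (hmd s)).1)
    (by simpa using hL.integrable_action u)
    (by
      obtain ⟨-, h2, h3⟩ := hL.meas _ _ (hmu 0) (hmd 0)
      exact (h2.inner φ.mem_LG.1).add (h3.inner φ.deriv_mem.1))
    (by
      filter_upwards [ae_μI_mem_Icc T] with t ht s hs
      have hs1 : |s| ≤ 1 := by simpa using (mem_ball_zero_iff.1 hs).le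
      refine (hb t ht _ _ _ _ ?_ ((hS t ht).trans (by linarith))).trans ?_
      · refine (norm_add_le _ _).trans (add_le_add (hR t ht) ?_)
        rw [norm_smul, Real.norm_eq_abs]
        exact (mul_le_of_le_one_left (norm_nonneg _) hs1).trans (hS t ht)
      · have := hC 1 s (by simp) hs1 (deriv u.fn t) (deriv φ.fn t)
        rw [one_smul] at this
        gcongr)
    ((((hB.add (((u.deriv_mem.2.add φ.deriv_mem.2).add (integrable_const 1)).const_mul C)).add
      φ.deriv_mem.2).const_mul A))
    (by
      filter_upwards [ae_μI_mem_Icc T] with t ht s hs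
      have h1 := hL.hasDerivAt t ht (u.fn t + s • φ.fn t) (deriv u.fn t + s • deriv φ.fn t)
        (φ.fn t) (deriv φ.fn t)
      have h2 : HasDerivAt (fun r : ℝ => r - s) 1 s := (hasDerivAt_id s).sub_const s
      rw [← sub_self s] at h1
      have h3 := h1.comp (h := fun r => r - s) s h2
      rw [mul_one] at h3
      refine h3.congr_of_eventuallyEq (Eventually.of_forall fun r => ?_)
      simp only [Function.comp]
      congr 1 <;> module)
  have h2 := key.2
  simp only [zero_smul, add_zero] at h2
  rwa [hL.dAction_apply]

/-- The uniform bound on test functions pairs with the `L¹` distance of the `x`-gradients, and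
scaled Hölder pairs their derivatives with the `v`-gradients. -/
lemma norm_dAction_sub_le : ∃ C ≥ 0, ∀ (u w : PeriodicSpace hG hT) (ε : ℝ), 0 < ε →
    ‖hL.dAction w - hL.dAction u‖ ≤
      C * ∫ t, ‖gradX L t (w.fn t) (deriv w.fn t) - gradX L t (u.fn t) (deriv u.fn t)‖ ∂μI T +
      ε * (∫ t, conj G (ε⁻¹ • (gradV L t (w.fn t) (deriv w.fn t) -
        gradV L t (u.fn t) (deriv u.fn t))) ∂μI T + 1) := by
  obtain ⟨C, hC0, hC⟩ := PeriodicSpace.exists_norm_apply_le hG hT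
  refine ⟨C, hC0, fun u w ε hε => ?_⟩
  have hq := hG.isYoung_conj.LG_sub (hL.gradV_mem_LG w) (hL.gradV_mem_LG u)
  have hr := (hL.integrable_gradX w).sub (hL.integrable_gradX u)
  have hc0 : 0 ≤ ∫ t, conj G (ε⁻¹ • (gradV L t (w.fn t) (deriv w.fn t) -
        gradV L t (u.fn t) (deriv u.fn t))) ∂μI T := integral_nonneg fun t => hG.conj_nonneg _
  refine ContinuousLinearMap.opNorm_le_bound _ (by positivity) fun φ => ?_
  have heq : (hL.dAction w - hL.dAction u) φ =
      ∫ t, inner ℝ (gradX L t (w.fn t) (deriv w.fn t) - gradX L t (u.fn t) (deriv u.fn t))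
        (φ.fn t) ∂μI T +
      ∫ t, inner ℝ (gradV L t (w.fn t) (deriv w.fn t) - gradV L t (u.fn t) (deriv u.fn t))
        (deriv φ.fn t) ∂μI T := by
    simp only [inner_sub_left]
    rw [integral_sub (hL.integrable_inner_gradX w φ) (hL.integrable_inner_gradX u φ),
      integral_sub (hL.integrable_inner_gradV w φ) (hL.integrable_inner_gradV u φ)]
    rw [sub_apply]
    simp only [dAction, pairing_apply]
    ring
  have h1 := abs_integral_inner_le_of_bound hr φ.mem_LG.1 (R := C * ‖φ‖)
    (by filter_upwards [ae_μI_mem_Icc T] with t ht using hC φ t ht)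
  have h2 := hG.abs_integral_inner_le_scaled hq φ.deriv_mem hε
  have h4 := mul_le_mul_of_nonneg_left φ.normLG_deriv_le
    (by positivity : 0 ≤ ε * (∫ t, conj G (ε⁻¹ • (gradV L t (w.fn t) (deriv w.fn t) -
        gradV L t (u.fn t) (deriv u.fn t))) ∂μI T + 1))
  rw [heq, Real.norm_eq_abs]
  refine (abs_add_le _ _).trans ?_
  simp only [Pi.sub_apply] at h1 h2
  linarith

/-- Every subsequence of a convergent sequence has a further one whose derivatives converge
pointwise with dominated modulars; along it both integrals in `norm_dAction_sub_le` tend to zero by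
dominated convergence. -/
lemma continuous_dAction : Continuous (hL.dAction : PeriodicSpace hG hT → _) := by
  have hY := hG.isYoung
  rw [continuous_iff_seqContinuous]
  intro w u hwu
  refine tendsto_of_subseq_tendsto fun ns hns => ?_
  have hlim0 : Tendsto (fun n => ‖w (ns n) - u‖) atTop (𝓝 0) :=
    (tendsto_iff_norm_sub_tendsto_zero.1 hwu).comp hns
  have hlimd : Tendsto (fun n => normLG G T (deriv (w (ns n)).fn - deriv u.fn)) atTop (𝓝 0) := by
    refine squeeze_zero (fun _ => normLG_nonneg _ _ _) (fun n => ?_) hlim0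
    refine le_of_eq_of_le (normLG_congr ?_) (w (ns n) - u).normLG_deriv_le
    filter_upwards [(w (ns n)).deriv_sub_ae u] with t ht using ht.symm
  obtain ⟨φ, hφ, H, hHi, hH⟩ := hY.exists_subseq_dominated
    (fun n => (w (ns n)).deriv_mem) u.deriv_mem hlimd
  refine ⟨φ, ?_⟩
  obtain ⟨C, hC0, hC⟩ := PeriodicSpace.exists_norm_apply_le hG hT
  have hlim1 : Tendsto (fun n => ‖w (ns (φ n)) - u‖) atTop (𝓝 0) := hlim0.comp hφ.tendsto_atTop
  have hpt : ∀ t ∈ Icc (-T) T, Tendsto (fun n => (w (ns (φ n))).fn t) atTop (𝓝 (u.fn t)) := by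
    intro t ht
    rw [tendsto_iff_norm_sub_tendsto_zero]
    refine squeeze_zero (fun _ => norm_nonneg _) (fun n => hC (w (ns (φ n)) - u) t ht) ?_
    simpa using hlim1.const_mul C
  obtain ⟨R, hR⟩ : ∃ R, ∀ n, ∀ t ∈ Icc (-T) T, ‖(w (ns (φ n))).fn t‖ ≤ R := by
    obtain ⟨D, hD⟩ := hlim1.bddAbove_range
    refine ⟨C * (D + ‖u‖), fun n t ht => (hC _ t ht).trans ?_⟩
    gcongr
    have h1 : ‖w (ns (φ n)) - u‖ ≤ D := hD ⟨n, rfl⟩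
    have h2 := norm_le_insert' (w (ns (φ n))) u
    linarith
  obtain ⟨S, hS0, hS, -⟩ := u.exists_bound
  obtain ⟨B, hB, hB0, hbd⟩ := hL.bound
  obtain ⟨A, hA, hb⟩ := hbd (max R S)
  have hX : Tendsto (fun n => ∫ t, ‖gradX L t ((w (ns (φ n))).fn t) (deriv (w (ns (φ n))).fn t) -
      gradX L t (u.fn t) (deriv u.fn t)‖ ∂μI T) atTop (𝓝 0) := by
    have h0 : (0 : ℝ) = ∫ _t, (0 : ℝ) ∂μI T := by simp
    rw [h0]
    refine tendsto_integral_of_dominated_convergence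
      (fun t => A * (B t + H t) + A * (B t + G (deriv u.fn t)))
      (fun n => (((hL.integrable_gradX _).sub (hL.integrable_gradX u)).norm).aestronglyMeasurable)
      (((hB.add hHi).const_mul A).add ((hB.add u.deriv_mem.2).const_mul A)) (fun n => ?_) ?_
    · filter_upwards [ae_μI_mem_Icc T, hH] with t ht hHt
      rw [norm_norm]
      refine (norm_sub_le _ _).trans (add_le_add ?_ ?_)
      · refine ((hb t ht _ _ ((hR n t ht).trans (le_max_left _ _))).2.1).trans ?_
        have := hHt.2 n
        gcongr
      · exact (hb t ht _ _ ((hS t ht).trans (le_max_right _ _))).2.1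
    · filter_upwards [ae_μI_mem_Icc T, hH] with t ht hHt
      exact tendsto_iff_norm_sub_tendsto_zero.1 (hL.tendsto_grad ht (hpt t ht) hHt.1).1
  have hV : ∀ ε : ℝ, 0 < ε → Tendsto (fun n => ∫ t, conj G (ε⁻¹ • (gradV L t ((w (ns (φ n))).fn t)
      (deriv (w (ns (φ n))).fn t) - gradV L t (u.fn t) (deriv u.fn t))) ∂μI T) atTop (𝓝 0) := by
    intro ε hε
    have hYc := hG.isYoung_conj
    obtain ⟨K, hK0, hK⟩ := hYc.exists_add_le |ε⁻¹|
    have h0 : (0 : ℝ) = ∫ _t, (0 : ℝ) ∂μI T := by simp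
    rw [h0]
    refine tendsto_integral_of_dominated_convergence
      (fun t => K * (A * (B t + H t) + A * (B t + G (deriv u.fn t)) + 1))
      (fun n => ?_)
      ((((((hB.add hHi).const_mul A).add ((hB.add u.deriv_mem.2).const_mul A))).add
        (integrable_const 1)).const_mul K) (fun n => ?_) ?_
    · exact hYc.aestronglyMeasurable_comp
        (((hL.gradV_mem_LG _).1.sub (hL.gradV_mem_LG u).1).const_smul ε⁻¹)
    · filter_upwards [ae_μI_mem_Icc T, hH] with t ht hHt
      rw [Real.norm_of_nonneg (hG.conj_nonneg _)]
      have h1 := hK ε⁻¹ (-ε⁻¹) le_rfl (by rw [abs_neg])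
        (gradV L t ((w (ns (φ n))).fn t) (deriv (w (ns (φ n))).fn t))
        (gradV L t (u.fn t) (deriv u.fn t))
      rw [neg_smul, ← sub_eq_add_neg, ← smul_sub] at h1
      refine h1.trans ?_
      have h2 := (hb t ht _ (deriv (w (ns (φ n))).fn t)
        ((hR n t ht).trans (le_max_left _ _))).2.2
      have h3 := (hb t ht _ (deriv u.fn t) ((hS t ht).trans (le_max_right _ _))).2.2
      have h4 := hHt.2 n
      have h5 : A * (B t + G (deriv (w (ns (φ n))).fn t)) ≤ A * (B t + H t) := by gcongr
      gcongr
      linarith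
    · filter_upwards [ae_μI_mem_Icc T, hH] with t ht hHt
      have h1 := (hL.tendsto_grad ht (hpt t ht) hHt.1).2
      have h2 := (h1.sub_const (gradV L t (u.fn t) (deriv u.fn t))).const_smul ε⁻¹
      rw [sub_self, smul_zero] at h2
      have h3 := (hYc.continuous.tendsto 0).comp h2
      rwa [hYc.zero] at h3
  obtain ⟨C', hC'0, hC'⟩ := hL.norm_dAction_sub_le (hG := hG) (hT := hT)
  rw [tendsto_iff_norm_sub_tendsto_zero, Metric.tendsto_nhds]
  intro ε hε
  -- The scaled bound does not vanish in the limit; it tends to its parameter, here `ε / 3`.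
  have hε3 : 0 < ε / 3 := by positivity
  have h1 : Tendsto (fun n => C' * ∫ t, ‖gradX L t ((w (ns (φ n))).fn t)
      (deriv (w (ns (φ n))).fn t) - gradX L t (u.fn t) (deriv u.fn t)‖ ∂μI T +
      ε / 3 * (∫ t, conj G ((ε / 3)⁻¹ • (gradV L t ((w (ns (φ n))).fn t)
      (deriv (w (ns (φ n))).fn t) - gradV L t (u.fn t) (deriv u.fn t))) ∂μI T + 1)) atTop
      (𝓝 (C' * 0 + ε / 3 * (0 + 1))) :=
    (hX.const_mul C').add (((hV _ hε3).add_const 1).const_mul _)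
  have h2 : C' * 0 + ε / 3 * (0 + 1) < ε := by linarith
  filter_upwards [h1.eventually (gt_mem_nhds h2)] with n hn
  rw [Real.dist_0_eq_abs, abs_norm]
  exact (hC' u (w (ns (φ n))) _ hε3).trans_lt hn

lemma continuous_action : Continuous fun u : PeriodicSpace hG hT => action L T u.fn :=
  continuous_of_line_deriv (fun u φ => hL.hasDerivAt_action u φ) hL.continuous_dAction

end IsLagrangian

end AnisotropicEL

/-! ### The hypotheses on `F`, `V` and `f` give a Lagrangian of `G`-growth. -/

namespace AnisotropicEL

variable {N : ℕ} {G : E N → ℝ} {T : ℝ} {F : ℝ → E N → E N → ℝ} {V : ℝ → E N → ℝ} {f : ℝ → E N}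

/-- Regularity is assumed only on the closed strip, so the derivative is taken within it. For fixed
`t` the variable `p` is unrestricted, and the restriction to the second factor is a genuine
derivative. -/
lemma exists_partial_fderiv {P : Type*} [NormedAddCommGroup P] [NormedSpace ℝ P] {Q : ℝ × P → ℝ}
    (hT : 0 < T) (h : ContDiffOn ℝ 1 Q (Icc (-T) T ×ˢ univ)) :
    ∃ D : ℝ × P → (P →L[ℝ] ℝ), ContinuousOn D (Icc (-T) T ×ˢ univ) ∧
      ∀ t ∈ Icc (-T) T, ∀ p, HasFDerivAt (fun p => Q (t, p)) (D (t, p)) p := by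
  have hu : UniqueDiffOn ℝ (Icc (-T) T ×ˢ (univ : Set P)) :=
    (uniqueDiffOn_Icc (by linarith)).prod uniqueDiffOn_univ
  refine ⟨fun z => (fderivWithin ℝ Q (Icc (-T) T ×ˢ univ) z).comp
    (ContinuousLinearMap.inr ℝ ℝ P), ?_, fun t ht p => ?_⟩
  · exact (h.continuousOn_fderivWithin hu le_rfl).clm_comp continuousOn_const
  · have hz : (t, p) ∈ Icc (-T) T ×ˢ (univ : Set P) := ⟨ht, mem_univ p⟩
    have h1 := (h.differentiableOn one_ne_zero (t, p) hz).hasFDerivWithinAt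
    have h2 : HasFDerivWithinAt (fun p : P => (t, p)) (ContinuousLinearMap.inr ℝ ℝ P) univ p :=
      (hasFDerivAt_prodMk_right t p).hasFDerivWithinAt
    have h3 := h1.comp p h2 (fun q _ => ⟨ht, mem_univ q⟩)
    exact hasFDerivWithinAt_univ.1 h3

lemma exists_unif_of_continuousOn {Y : Type*} [NormedAddCommGroup Y] {Q : ℝ × E N × E N → Y}
    (h : ContinuousOn Q (Icc (-T) T ×ˢ univ)) (R : ℝ) {ε : ℝ} (hε : 0 < ε) :
    ∃ δ > 0, ∀ t ∈ Icc (-T) T, ∀ x x' v v' : E N, ‖x‖ ≤ R → ‖x'‖ ≤ R → ‖v‖ ≤ R → ‖v'‖ ≤ R →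
      ‖x - x'‖ < δ → ‖v - v'‖ < δ → ‖Q (t, x, v) - Q (t, x', v')‖ ≤ ε := by
  have hK : IsCompact (Icc (-T) T ×ˢ (Metric.closedBall (0 : E N) R ×ˢ
      Metric.closedBall (0 : E N) R)) :=
    isCompact_Icc.prod ((isCompact_closedBall _ _).prod (isCompact_closedBall _ _))
  have hu := hK.uniformContinuousOn_of_continuous
    (h.mono (prod_mono subset_rfl (subset_univ _)))
  obtain ⟨δ, hδ, hd⟩ := Metric.uniformContinuousOn_iff.1 hu ε hε
  refine ⟨δ, hδ, fun t ht x x' v v' hx hx' hv hv' h1 h2 => ?_⟩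
  rw [← dist_eq_norm]
  refine (hd (t, x, v) ⟨ht, by simpa using hx, by simpa using hv⟩ (t, x', v')
    ⟨ht, by simpa using hx', by simpa using hv'⟩ ?_).le
  rw [Prod.dist_eq, Prod.dist_eq, dist_self, dist_eq_norm x, dist_eq_norm v]
  exact max_lt hδ (max_lt h1 h2)

/-- Projecting time onto `I` extends `Q` to a continuous function on the whole product. -/
lemma aestronglyMeasurable_of_continuousOn {Y : Type*} [NormedAddCommGroup Y]
    {P : Type*} [NormedAddCommGroup P] (hT : 0 < T) {Q : ℝ × P → Y}
    (h : ContinuousOn Q (Icc (-T) T ×ˢ univ)) {z : ℝ → P} (hz : AEStronglyMeasurable z (μI T)) :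
    AEStronglyMeasurable (fun t => Q (t, z t)) (μI T) := by
  have hle : -T ≤ T := by linarith
  have hc : Continuous fun p : ℝ × P => Q ((projIcc (-T) T hle p.1 : ℝ), p.2) := by
    refine h.comp_continuous (by fun_prop) fun p => ⟨(projIcc (-T) T hle p.1).2, mem_univ _⟩
  have hm : AEStronglyMeasurable (fun t => (t, z t)) (μI T) :=
    aestronglyMeasurable_id.prodMk hz
  refine (hc.comp_aestronglyMeasurable hm).congr ?_
  filter_upwards [ae_μI_mem_Icc T] with t ht
  simp [projIcc_of_mem hle ht]

lemma gradient_eq_of_hasFDerivAt {h : E N → ℝ} {D : E N →L[ℝ] ℝ} {x : E N}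
    (hd : HasFDerivAt h D x) : gradient h x = (InnerProductSpace.toDual ℝ (E N)).symm D := by
  rw [gradient, hd.fderiv]

lemma exists_gradients (hT : 0 < T)
    (hF : ContDiffOn ℝ 1 (fun p : ℝ × E N × E N => F p.1 p.2.1 p.2.2) (Icc (-T) T ×ˢ univ)) :
    (∀ t ∈ Icc (-T) T, ∀ x v, HasFDerivAt (fun p : E N × E N => F t p.1 p.2)
      ((innerSL ℝ (gradX F t x v)).comp (ContinuousLinearMap.fst ℝ (E N) (E N)) +
        (innerSL ℝ (gradV F t x v)).comp (ContinuousLinearMap.snd ℝ (E N) (E N))) (x, v)) ∧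
    ContinuousOn (fun p : ℝ × E N × E N => gradX F p.1 p.2.1 p.2.2) (Icc (-T) T ×ˢ univ) ∧
    ContinuousOn (fun p : ℝ × E N × E N => gradV F p.1 p.2.1 p.2.2) (Icc (-T) T ×ˢ univ) := by
  obtain ⟨D, hD, hd⟩ := exists_partial_fderiv hT hF
  have hX : ∀ t ∈ Icc (-T) T, ∀ x v, gradX F t x v = (InnerProductSpace.toDual ℝ (E N)).symm
      ((D (t, x, v)).comp (ContinuousLinearMap.inl ℝ (E N) (E N))) := fun t ht x v =>
    gradient_eq_of_hasFDerivAt (HasFDerivAt.comp (g := fun p : E N × E N => F t p.1 p.2) x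
      (hd t ht (x, v)) (hasFDerivAt_prodMk_left (𝕜 := ℝ) x v))
  have hV : ∀ t ∈ Icc (-T) T, ∀ x v, gradV F t x v = (InnerProductSpace.toDual ℝ (E N)).symm
      ((D (t, x, v)).comp (ContinuousLinearMap.inr ℝ (E N) (E N))) := fun t ht x v =>
    gradient_eq_of_hasFDerivAt (HasFDerivAt.comp (g := fun p : E N × E N => F t p.1 p.2) v
      (hd t ht (x, v)) (hasFDerivAt_prodMk_right (𝕜 := ℝ) x v))
  refine ⟨fun t ht x v => ?_, ?_, ?_⟩
  · have heq : (innerSL ℝ (gradX F t x v)).comp (ContinuousLinearMap.fst ℝ (E N) (E N)) +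
        (innerSL ℝ (gradV F t x v)).comp (ContinuousLinearMap.snd ℝ (E N) (E N)) =
        D (t, x, v) := by
      ext p
      · simp [hX t ht]
      · simp [hV t ht]
    rw [heq]
    exact hd t ht (x, v)
  · refine ContinuousOn.congr (f := fun p : ℝ × E N × E N =>
      (InnerProductSpace.toDual ℝ (E N)).symm ((D p).comp (ContinuousLinearMap.inl ℝ (E N) (E N))))
      ?_ fun p hp => hX p.1 hp.1 p.2.1 p.2.2
    exact (InnerProductSpace.toDual ℝ (E N)).symm.continuous.comp_continuousOn
      (hD.clm_comp continuousOn_const)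
  · refine ContinuousOn.congr (f := fun p : ℝ × E N × E N =>
      (InnerProductSpace.toDual ℝ (E N)).symm ((D p).comp (ContinuousLinearMap.inr ℝ (E N) (E N))))
      ?_ fun p hp => hV p.1 hp.1 p.2.1 p.2.2
    exact (InnerProductSpace.toDual ℝ (E N)).symm.continuous.comp_continuousOn
      (hD.clm_comp continuousOn_const)

lemma exists_gradient_potential (hT : 0 < T)
    (hV : ContDiffOn ℝ 1 (fun p : ℝ × E N => V p.1 p.2) (Icc (-T) T ×ˢ univ)) :
    (∀ t ∈ Icc (-T) T, ∀ x, HasFDerivAt (V t) (innerSL ℝ (gradient (V t) x)) x) ∧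
    ContinuousOn (fun p : ℝ × E N => gradient (V p.1) p.2) (Icc (-T) T ×ˢ univ) := by
  obtain ⟨D, hD, hd⟩ := exists_partial_fderiv hT hV
  have hX : ∀ t ∈ Icc (-T) T, ∀ x, gradient (V t) x =
      (InnerProductSpace.toDual ℝ (E N)).symm (D (t, x)) := fun t ht x =>
    gradient_eq_of_hasFDerivAt (hd t ht x)
  refine ⟨fun t ht x => ?_, ?_⟩
  · have heq : innerSL ℝ (gradient (V t) x) = D (t, x) := by
      ext p
      simp [hX t ht]
    rw [heq]
    exact hd t ht x
  · refine ContinuousOn.congr (f := fun p : ℝ × E N =>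
      (InnerProductSpace.toDual ℝ (E N)).symm (D p)) ?_ fun p hp => hX p.1 hp.1 p.2
    exact (InnerProductSpace.toDual ℝ (E N)).symm.continuous.comp_continuousOn hD

lemma exists_bound_of_continuousOn {Y : Type*} [NormedAddCommGroup Y] {Q : ℝ × E N → Y}
    (h : ContinuousOn Q (Icc (-T) T ×ˢ univ)) (R : ℝ) :
    ∃ A ≥ 0, ∀ t ∈ Icc (-T) T, ∀ x, ‖x‖ ≤ R → ‖Q (t, x)‖ ≤ A := by
  have hK : IsCompact (Icc (-T) T ×ˢ (Metric.closedBall (0 : E N) R)) :=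
    isCompact_Icc.prod (isCompact_closedBall _ _)
  obtain ⟨A, hA⟩ := hK.exists_bound_of_continuousOn
    (h.mono (prod_mono subset_rfl (subset_univ _)))
  exact ⟨max A 0, le_max_right _ _, fun t ht x hx =>
    (hA (t, x) ⟨ht, by simpa using hx⟩).trans (le_max_left _ _)⟩

lemma hasFDerivAt_lagr (hT : 0 < T)
    (hF : ContDiffOn ℝ 1 (fun p : ℝ × E N × E N => F p.1 p.2.1 p.2.2) (Icc (-T) T ×ˢ univ))
    (hV : ContDiffOn ℝ 1 (fun p : ℝ × E N => V p.1 p.2) (Icc (-T) T ×ˢ univ))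
    {t : ℝ} (ht : t ∈ Icc (-T) T) (x v : E N) :
    HasFDerivAt (fun p : E N × E N => lagr F V f t p.1 p.2)
      ((innerSL ℝ (gradX F t x v + gradient (V t) x + f t)).comp
        (ContinuousLinearMap.fst ℝ (E N) (E N)) +
        (innerSL ℝ (gradV F t x v)).comp (ContinuousLinearMap.snd ℝ (E N) (E N))) (x, v) := by
  have h1 := (exists_gradients hT hF).1 t ht x v
  have h2 := ((exists_gradient_potential hT hV).1 t ht x).comp (x, v)
    (hasFDerivAt_fst (𝕜 := ℝ) (p := (x, v)))
  have h3 := (innerSL ℝ (f t)).hasFDerivAt.comp (x, v) (hasFDerivAt_fst (𝕜 := ℝ) (p := (x, v)))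
  have heq : (innerSL ℝ (gradX F t x v + gradient (V t) x + f t)).comp
        (ContinuousLinearMap.fst ℝ (E N) (E N)) +
        (innerSL ℝ (gradV F t x v)).comp (ContinuousLinearMap.snd ℝ (E N) (E N)) =
      (innerSL ℝ (gradX F t x v)).comp (ContinuousLinearMap.fst ℝ (E N) (E N)) +
        (innerSL ℝ (gradV F t x v)).comp (ContinuousLinearMap.snd ℝ (E N) (E N)) +
        (innerSL ℝ (gradient (V t) x)).comp (ContinuousLinearMap.fst ℝ (E N) (E N)) +
        (innerSL ℝ (f t)).comp (ContinuousLinearMap.fst ℝ (E N) (E N)) := by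
    rw [map_add, map_add, ContinuousLinearMap.add_comp, ContinuousLinearMap.add_comp]
    abel
  rw [heq]
  exact (h1.add h2).add h3

section

variable (hT : 0 < T)
    (hF : ContDiffOn ℝ 1 (fun p : ℝ × E N × E N => F p.1 p.2.1 p.2.2) (Icc (-T) T ×ˢ univ))
    (hV : ContDiffOn ℝ 1 (fun p : ℝ × E N => V p.1 p.2) (Icc (-T) T ×ˢ univ))
    {t : ℝ} (ht : t ∈ Icc (-T) T)
include hT hF hV ht

lemma gradX_lagr (x v : E N) :
    gradX (lagr F V f) t x v = gradX F t x v + gradient (V t) x + f t := by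
  have h := HasFDerivAt.comp (g := fun p : E N × E N => lagr F V f t p.1 p.2) x
    (hasFDerivAt_lagr hT hF hV ht x v) (hasFDerivAt_prodMk_left (𝕜 := ℝ) x v)
  refine (gradient_eq_of_hasFDerivAt h).trans ?_
  rw [LinearIsometryEquiv.symm_apply_eq]
  ext y
  simp

lemma gradV_lagr (x v : E N) : gradV (lagr F V f) t x v = gradV F t x v := by
  have h := HasFDerivAt.comp (g := fun p : E N × E N => lagr F V f t p.1 p.2) v
    (hasFDerivAt_lagr hT hF hV ht x v) (hasFDerivAt_prodMk_right (𝕜 := ℝ) x v)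
  refine (gradient_eq_of_hasFDerivAt h).trans ?_
  rw [LinearIsometryEquiv.symm_apply_eq]
  ext y
  simp

end

/-- The Lagrangian `F + V + ⟨f, x⟩` is of `G`-growth. -/
theorem isLagrangian_lagr (hG : IsGFunction G) (hT : 0 < T)
    (hF : ContDiffOn ℝ 1 (fun p : ℝ × E N × E N => F p.1 p.2.1 p.2.2) (Icc (-T) T ×ˢ univ))
    (hF2 : ∃ a β : ℝ → ℝ, ContinuousOn a (Ici 0) ∧ (∀ r, 0 ≤ r → 0 ≤ a r) ∧
      IntegrableOn β (Icc (-T) T) ∧ (∀ t ∈ Icc (-T) T, 0 ≤ β t) ∧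
      ∀ t ∈ Icc (-T) T, ∀ x v,
        |F t x v| ≤ a ‖x‖ * (β t + G v) ∧
        ‖gradX F t x v‖ ≤ a ‖x‖ * (β t + G v) ∧
        conj G (gradV F t x v) ≤ a ‖x‖ * (β t + conj G (gradient G v)))
    (hV : ContDiffOn ℝ 1 (fun p : ℝ × E N => V p.1 p.2) (Icc (-T) T ×ˢ univ))
    (hf : f ∈ LG (conj G) T) : IsLagrangian G T (lagr F V f) := by
  obtain ⟨hdF, hcX, hcV⟩ := exists_gradients hT hF
  obtain ⟨hdV, hcP⟩ := exists_gradient_potential hT hV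
  have hcP' : ContinuousOn (fun p : ℝ × E N × E N => gradient (V p.1) p.2.1)
      (Icc (-T) T ×ˢ univ) :=
    hcP.comp (f := fun p : ℝ × E N × E N => (p.1, p.2.1)) (by fun_prop)
      fun p hp => ⟨hp.1, mem_univ _⟩
  have hcQ := hcX.add hcP'
  refine ⟨fun t ht x v h k => ?_, fun t ht => ?_, fun R ε hε => ?_, fun u w hu hw => ?_, ?_⟩
  · have h1 := hasFDerivAt_lagr (f := f) hT hF hV ht x v
    have h2 : HasDerivAt (fun s : ℝ => (x + s • h, v + s • k)) (h, k) 0 := by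
      have a1 : HasDerivAt (fun s : ℝ => x + s • h) h 0 := by
        simpa using ((hasDerivAt_id (0 : ℝ)).smul_const h).const_add x
      have a2 : HasDerivAt (fun s : ℝ => v + s • k) k 0 := by
        simpa using ((hasDerivAt_id (0 : ℝ)).smul_const k).const_add v
      exact a1.prodMk a2
    have h4 := HasFDerivAt.comp_hasDerivAt_of_eq (0 : ℝ) h1 h2 (by simp)
    rw [gradX_lagr hT hF hV ht, gradV_lagr hT hF hV ht]
    exact h4
  · rw [continuous_iff_continuousAt]
    exact fun p => (hasFDerivAt_lagr hT hF hV ht p.1 p.2).continuousAt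
  · obtain ⟨δ₁, hδ₁, h1⟩ := exists_unif_of_continuousOn hcQ R hε
    obtain ⟨δ₂, hδ₂, h2⟩ := exists_unif_of_continuousOn hcV R hε
    refine ⟨min δ₁ δ₂, lt_min hδ₁ hδ₂, fun t ht x x' v v' hx hx' hv hv' a b => ?_⟩
    rw [gradX_lagr hT hF hV ht, gradX_lagr hT hF hV ht, gradV_lagr hT hF hV ht,
      gradV_lagr hT hF hV ht, add_sub_add_right_eq_sub]
    exact ⟨h1 t ht x x' v v' hx hx' hv hv' (a.trans_le (min_le_left _ _))
      (b.trans_le (min_le_left _ _)), h2 t ht x x' v v' hx hx' hv hv'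
      (a.trans_le (min_le_right _ _)) (b.trans_le (min_le_right _ _))⟩
  · have hz : AEStronglyMeasurable (fun t => (u t, w t)) (μI T) := hu.prodMk hw
    refine ⟨?_, ?_, ?_⟩
    · exact ((aestronglyMeasurable_of_continuousOn hT hF.continuousOn hz).add
        (aestronglyMeasurable_of_continuousOn hT hV.continuousOn hu)).add (hf.1.inner hu)
    · refine ((aestronglyMeasurable_of_continuousOn hT hcQ hz).add hf.1).congr ?_
      filter_upwards [ae_μI_mem_Icc T] with t ht
      rw [gradX_lagr hT hF hV ht]; rfl
    · refine (aestronglyMeasurable_of_continuousOn hT hcV hz).congr ?_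
      filter_upwards [ae_μI_mem_Icc T] with t ht
      rw [gradV_lagr hT hF hV ht]
  · obtain ⟨a, β, hac, ha0, hβ, hβ0, hbd⟩ := hF2
    have hfi := hG.isYoung_conj.LG_integrable hf
    obtain ⟨C, hC0, hC⟩ := hG.isYoung.doubling
    -- The summand `1` absorbs the bounds of `V` and its gradient on bounded sets, and `‖f t‖`
    -- absorbs the forcing term.
    refine ⟨fun t => β t + 1 + ‖f t‖, (hβ.add (integrable_const 1)).add hfi.norm,
      fun t ht => by have := hβ0 t ht; positivity, fun R => ?_⟩
    obtain ⟨A₁, hA₁, h1⟩ := exists_bound_of_continuousOn hV.continuousOn R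
    obtain ⟨A₂, hA₂, h2⟩ := exists_bound_of_continuousOn hcP R
    obtain ⟨A₃, h3⟩ := (isCompact_Icc (a := 0) (b := R)).exists_bound_of_continuousOn
      (hac.mono Icc_subset_Ici_self)
    set A := |A₃| * (C + 1) + A₁ + A₂ + |R| + 1
    have hA0 : 0 ≤ A := by positivity
    refine ⟨A, hA0, fun t ht x v hx => ?_⟩
    have hβt := hβ0 t ht
    have hGv := hG.nonneg v
    have hft := norm_nonneg (f t)
    have hax : a ‖x‖ ≤ |A₃| := (le_abs_self _).trans
      ((h3 ‖x‖ ⟨norm_nonneg x, hx⟩).trans (le_abs_self _))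
    obtain ⟨b1, b2, b3⟩ := hbd t ht x v
    have b4 := h1 t ht x hx
    have b5 := h2 t ht x hx
    simp only at b4 b5
    rw [Real.norm_eq_abs] at b4
    have hxR : ‖x‖ ≤ |R| := hx.trans (le_abs_self _)
    have c1 : |inner ℝ (f t) x| ≤ ‖f t‖ * |R| :=
      (abs_real_inner_le_norm _ _).trans (by gcongr)
    have c2 : a ‖x‖ * (β t + G v) ≤ |A₃| * (C + 1) * (β t + G v) := by
      have : |A₃| * 1 ≤ |A₃| * (C + 1) := by gcongr; linarith
      rw [mul_one] at this
      exact mul_le_mul_of_nonneg_right (hax.trans this) (by positivity)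
    have e1 : 0 ≤ |A₃| * (C + 1) := by positivity
    have e2 : 0 ≤ β t + ‖f t‖ + G v := by positivity
    have key : |A₃| * (C + 1) * (β t + G v) + A₁ + A₂ + (|R| + 1) * ‖f t‖ ≤
        A * (β t + 1 + ‖f t‖ + G v) := by
      have i1 : |A₃| * (C + 1) * (β t + G v) ≤ |A₃| * (C + 1) * (β t + 1 + ‖f t‖ + G v) := by
        gcongr; linarith
      have i2 : A₁ * 1 ≤ A₁ * (β t + 1 + ‖f t‖ + G v) := by gcongr; linarith
      have i3 : A₂ * 1 ≤ A₂ * (β t + 1 + ‖f t‖ + G v) := by gcongr; linarith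
      have i4 : (|R| + 1) * ‖f t‖ ≤ (|R| + 1) * (β t + 1 + ‖f t‖ + G v) := by gcongr; linarith
      simp only [A]
      linarith
    refine ⟨?_, ?_, ?_⟩
    · refine le_trans ?_ key
      have := abs_add_three (F t x v) (V t x) (inner ℝ (f t) x)
      simp only [lagr]
      linarith
    · refine le_trans ?_ key
      rw [gradX_lagr hT hF hV ht]
      have := norm_add₃_le (a := gradX F t x v) (b := gradient (V t) x) (c := f t)
      have : 0 ≤ |R| * ‖f t‖ := by positivity
      linarith
    · rw [gradV_lagr hT hF hV ht]
      -- `G*(∇G(v)) ≤ G(2v) ≤ C (G(v) + 1)`, so the third bound in (F2) has the same form as the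
      -- other two.
      have d1 := (hG.conj_gradient_le v).trans (hC v)
      have d2 := hG.conj_nonneg (gradient G v)
      have d3 : a ‖x‖ * (β t + conj G (gradient G v)) ≤ |A₃| * (β t + C * (G v + 1)) := by
        gcongr
      have d4 : β t + C * (G v + 1) ≤ (C + 1) * (β t + 1 + ‖f t‖ + G v) := by
        nlinarith [mul_nonneg hC0 hβt, mul_nonneg hC0 hft]
      have d5 : |A₃| * (β t + C * (G v + 1)) ≤ |A₃| * ((C + 1) * (β t + 1 + ‖f t‖ + G v)) := by
        gcongr
      have d6 : |A₃| * (C + 1) ≤ A := by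
        simp only [A]; have := abs_nonneg R; linarith
      have d7 : |A₃| * (C + 1) * (β t + 1 + ‖f t‖ + G v) ≤ A * (β t + 1 + ‖f t‖ + G v) := by
        gcongr
      rw [mul_assoc] at d7
      linarith

end AnisotropicEL

/-! ### Compactness from bounded modulars, and integration by parts. -/

namespace AnisotropicEL

variable {N : ℕ} {G : E N → ℝ} {T : ℝ}

/-- The de la Vallée Poussin mechanism: the modular term is made small by the choice of `ε`, and
then the length term by the choice of the interval. It gives both equicontinuity and uniform
absolute continuity. -/
lemma dist_le_modular (hT : 0 < T) {ε C : ℝ} (hC : ∀ x, ‖x‖ ≤ ε * G x + C) {u : ℝ → E N}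
    (hu : AbsolutelyContinuousOnInterval u (-T) T)
    (hGu : Integrable (fun t => G (deriv u t)) (μI T))
    {a b : ℝ} (ha : a ∈ Icc (-T) T) (hb : b ∈ Icc (-T) T) :
    dist (u a) (u b) ≤ ε * (∫ t in uIoc a b, G (deriv u t)) + C * dist a b := by
  have hsub : uIoc a b ⊆ Icc (-T) T := uIoc_subset_uIcc.trans (uIcc_subset_Icc ha hb)
  have hi : IntegrableOn (deriv u) (uIoc a b) :=
    IntegrableOn.mono_set (s := uIoc a b) (integrable_deriv_μI hT.le hu) hsub
  have hi2 : IntegrableOn (fun t => G (deriv u t)) (uIoc a b) := IntegrableOn.mono_set hGu hsub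
  have hfin : IsFiniteMeasure (volume.restrict (uIoc a b)) :=
    ⟨by rw [Measure.restrict_apply_univ, Real.volume_uIoc]; exact ENNReal.ofReal_lt_top⟩
  rw [dist_comm, dist_eq_norm, ← integral_deriv_interval hT.le hu ha hb]
  refine intervalIntegral.norm_integral_le_integral_norm_uIoc.trans ?_
  have h1 : ∫ t in uIoc a b, ‖deriv u t‖ ≤ ∫ t in uIoc a b, (ε * G (deriv u t) + C) :=
    integral_mono hi.norm ((hi2.const_mul ε).add (integrable_const C)) fun t => hC _
  rw [integral_add (hi2.const_mul ε) (integrable_const C), integral_const_mul, integral_const,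
    measureReal_restrict_apply MeasurableSet.univ, univ_inter, Measure.real, Real.volume_uIoc,
    ENNReal.toReal_ofReal (abs_nonneg _), smul_eq_mul, mul_comm _ C] at h1
  rwa [dist_comm a b, Real.dist_eq]

lemma sum_dist_le_modular (hG : IsYoung G) (hT : 0 < T) {ε C : ℝ} (hε : 0 ≤ ε)
    (hC : ∀ x, ‖x‖ ≤ ε * G x + C) {u : ℝ → E N}
    (hu : AbsolutelyContinuousOnInterval u (-T) T)
    (hGu : Integrable (fun t => G (deriv u t)) (μI T)) {I : ℕ × (ℕ → ℝ × ℝ)}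
    (hI : I ∈ AbsolutelyContinuousOnInterval.disjWithin (-T) T) :
    ∑ i ∈ Finset.range I.1, dist (u (I.2 i).1) (u (I.2 i).2) ≤
      ε * ∫ t, G (deriv u t) ∂μI T + C * ∑ i ∈ Finset.range I.1, dist (I.2 i).1 (I.2 i).2 := by
  have hmem : ∀ i ∈ Finset.range I.1, (I.2 i).1 ∈ Icc (-T) T ∧ (I.2 i).2 ∈ Icc (-T) T := by
    have := hI.1
    rwa [uIcc_neg_self hT.le] at this
  have hsub : ∀ i ∈ Finset.range I.1, uIoc (I.2 i).1 (I.2 i).2 ⊆ Icc (-T) T := fun i hi =>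
    uIoc_subset_uIcc.trans (uIcc_subset_Icc (hmem i hi).1 (hmem i hi).2)
  have h1 : ∑ i ∈ Finset.range I.1, dist (u (I.2 i).1) (u (I.2 i).2) ≤
      ∑ i ∈ Finset.range I.1, (ε * (∫ t in uIoc (I.2 i).1 (I.2 i).2, G (deriv u t)) +
        C * dist (I.2 i).1 (I.2 i).2) :=
    Finset.sum_le_sum fun i hi => dist_le_modular hT hC hu hGu (hmem i hi).1 (hmem i hi).2
  rw [Finset.sum_add_distrib, ← Finset.mul_sum, ← Finset.mul_sum,
    ← integral_biUnion_finset _ (fun i _ => measurableSet_uIoc) hI.2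
      (fun i hi => IntegrableOn.mono_set hGu (hsub i hi))] at h1
  have h2 : ∫ t in ⋃ i ∈ Finset.range I.1, uIoc (I.2 i).1 (I.2 i).2, G (deriv u t) ≤
      ∫ t, G (deriv u t) ∂μI T :=
    setIntegral_mono_set hGu (Eventually.of_forall fun t => hG.nonneg _)
      (LE.le.eventuallyLE (iUnion₂_subset hsub))
  linarith [mul_le_mul_of_nonneg_left h2 hε]

/-- Absolute continuity passes to pointwise limits of functions with bounded modulars. -/
lemma ac_of_tendsto (hG : IsYoung G) (hT : 0 < T) {u : ℕ → ℝ → E N} {U : ℝ → E N} {K : ℝ}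
    (hu : ∀ n, AbsolutelyContinuousOnInterval (u n) (-T) T)
    (hGu : ∀ n, Integrable (fun t => G (deriv (u n) t)) (μI T))
    (hK : ∀ n, ∫ t, G (deriv (u n) t) ∂μI T ≤ K)
    (hlim : ∀ t ∈ Icc (-T) T, Tendsto (fun n => u n t) atTop (𝓝 (U t))) :
    AbsolutelyContinuousOnInterval U (-T) T := by
  rw [absolutelyContinuousOnInterval_iff]
  intro ε hε
  -- The modular then contributes at most `ε / 4`, the total length at most another `ε / 4`.
  set η := ε / (4 * (|K| + 1)) with hη
  have hη0 : 0 < η := by positivity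
  obtain ⟨C, hC0, hC⟩ := hG.coercive η hη0
  refine ⟨ε / (4 * (C + 1)), by positivity, fun I hI hlt => ?_⟩
  have hmem := hI.1
  rw [uIcc_neg_self hT.le] at hmem
  have hle : ∀ n, ∑ i ∈ Finset.range I.1, dist (u n (I.2 i).1) (u n (I.2 i).2) ≤ ε / 2 := by
    intro n
    refine (sum_dist_le_modular hG hT hη0.le hC (hu n) (hGu n) hI).trans ?_
    have h1 : η * ∫ t, G (deriv (u n) t) ∂μI T ≤ η * (|K| + 1) := by
      gcongr; exact (hK n).trans ((le_abs_self K).trans (by linarith))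
    have h2 : η * (|K| + 1) = ε / 4 := by rw [hη]; field_simp
    have h3 : C * ∑ i ∈ Finset.range I.1, dist (I.2 i).1 (I.2 i).2 ≤
        (C + 1) * (ε / (4 * (C + 1))) := by
      gcongr; linarith
    have h4 : (C + 1) * (ε / (4 * (C + 1))) = ε / 4 := by field_simp
    linarith
  have hl : Tendsto (fun n => ∑ i ∈ Finset.range I.1, dist (u n (I.2 i).1) (u n (I.2 i).2)) atTop
      (𝓝 (∑ i ∈ Finset.range I.1, dist (U (I.2 i).1) (U (I.2 i).2))) :=
    tendsto_finsetSum _ fun i hi => (hlim _ (hmem i hi).1).dist (hlim _ (hmem i hi).2)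
  linarith [le_of_tendsto' hl hle]

/-- Sequences with bounded modulars of the derivatives have uniformly convergent subsequences. -/
lemma exists_uniform_subseq (hG : IsYoung G) (hT : 0 < T) {u : ℕ → ℝ → E N} {K R : ℝ}
    (hu : ∀ n, AbsolutelyContinuousOnInterval (u n) (-T) T)
    (hGu : ∀ n, Integrable (fun t => G (deriv (u n) t)) (μI T))
    (hK : ∀ n, ∫ t, G (deriv (u n) t) ∂μI T ≤ K)
    (hR : ∀ n, ∀ t ∈ Icc (-T) T, ‖u n t‖ ≤ R) :
    ∃ φ : ℕ → ℕ, StrictMono φ ∧ ∃ U : ℝ → E N,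
      ∀ ε > 0, ∀ᶠ n in atTop, ∀ t ∈ Icc (-T) T, ‖u (φ n) t - U t‖ ≤ ε := by
  have hc : ∀ n, ContinuousOn (u n) (Icc (-T) T) := fun n => by
    rw [← uIcc_neg_self hT.le]; exact (hu n).continuousOn
  let f : ℕ → BoundedContinuousFunction (Icc (-T) T) (E N) := fun n =>
    BoundedContinuousFunction.mkOfCompact ⟨fun x => u n x, (hc n).domRestrict⟩
  have hcomp : IsCompact (closure (range f)) := by
    refine BoundedContinuousFunction.arzela_ascoli (Metric.closedBall 0 R)
      (isCompact_closedBall 0 R) _ ?_ ?_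
    · rintro _ x ⟨n, rfl⟩
      rw [mem_closedBall_zero_iff]
      exact hR n x x.2
    · intro x₀
      rw [Metric.equicontinuousAt_iff]
      intro ε hε
      set η := ε / (2 * (|K| + 1)) with hη
      have hη0 : 0 < η := by positivity
      obtain ⟨C, hC0, hC⟩ := hG.coercive η hη0
      refine ⟨ε / (2 * (C + 1)), by positivity, ?_⟩
      rintro x hx ⟨_, n, rfl⟩
      change dist (u n x₀) (u n x) < ε
      refine (dist_le_modular hT hC (hu n) (hGu n) x₀.2 x.2).trans_lt ?_
      have hsub : uIoc (x₀ : ℝ) x ⊆ Icc (-T) T :=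
        uIoc_subset_uIcc.trans (uIcc_subset_Icc x₀.2 x.2)
      have h0 : ∫ t in uIoc (x₀ : ℝ) x, G (deriv (u n) t) ≤ ∫ t, G (deriv (u n) t) ∂μI T :=
        setIntegral_mono_set (hGu n) (Eventually.of_forall fun t => hG.nonneg _)
          (Eventually.of_forall hsub)
      have h1 : η * (∫ t in uIoc (x₀ : ℝ) x, G (deriv (u n) t)) ≤ η * (|K| + 1) := by
        gcongr; exact h0.trans ((hK n).trans ((le_abs_self K).trans (by linarith)))
      have h2 : η * (|K| + 1) = ε / 2 := by rw [hη]; field_simp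
      have h3 : C * dist (x₀ : ℝ) x ≤ C * (ε / (2 * (C + 1))) := by
        gcongr
        rw [dist_comm]
        exact (Subtype.dist_eq x x₀ ▸ hx).le
      have h4 : C * (ε / (2 * (C + 1))) < ε / 2 := by
        rw [mul_div_assoc', div_lt_div_iff₀ (by positivity) two_pos]
        nlinarith
      linarith
  obtain ⟨g, -, φ, hφ, hlim⟩ := hcomp.tendsto_subseq (fun n => subset_closure (mem_range_self n))
  have hle : -T ≤ T := by linarith
  refine ⟨φ, hφ, fun t => g (projIcc (-T) T hle t), fun ε hε => ?_⟩
  filter_upwards [(Metric.tendsto_nhds.1 hlim) ε hε] with n hn t ht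
  have h1 := (BoundedContinuousFunction.dist_coe_le_dist (f := f (φ n)) (g := g)
    (⟨t, ht⟩ : Icc (-T) T)).trans hn.le
  rw [projIcc_of_mem hle ht, ← dist_eq_norm]
  exact h1

lemma integral_inner_deriv (hT : 0 < T) {p d : ℝ → E N}
    (hp : AbsolutelyContinuousOnInterval p (-T) T) (hd : AbsolutelyContinuousOnInterval d (-T) T) :
    ∫ t, inner ℝ (p t) (deriv d t) ∂μI T = inner ℝ (p T) (d T) - inner ℝ (p (-T)) (d (-T)) -
      ∫ t, inner ℝ (deriv p t) (d t) ∂μI T := by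
  have hpi := AbsolutelyContinuousOnInterval.coord hp
  have hdi := AbsolutelyContinuousOnInterval.coord hd
  have h1 : ∫ t, inner ℝ (p t) (deriv d t) ∂μI T =
      ∑ i, ∫ t, p t i * deriv (fun t => d t i) t ∂μI T := by
    rw [← integral_finsetSum]
    · refine integral_congr_ae ?_
      filter_upwards [AbsolutelyContinuousOnInterval.ae_differentiableAt_μI hT.le hd] with t ht
      simp only [PiLp.inner_apply, deriv_coord ht]
      exact Finset.sum_congr rfl fun i _ => by simp [mul_comm]
    · intro i _
      rw [integrable_μI_iff hT.le]
      exact (hdi i).intervalIntegrable_deriv.continuousOn_mul (hpi i).continuousOn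
  have h2 : ∫ t, inner ℝ (deriv p t) (d t) ∂μI T =
      ∑ i, ∫ t, deriv (fun t => p t i) t * d t i ∂μI T := by
    rw [← integral_finsetSum]
    · refine integral_congr_ae ?_
      filter_upwards [AbsolutelyContinuousOnInterval.ae_differentiableAt_μI hT.le hp] with t ht
      simp only [PiLp.inner_apply, deriv_coord ht]
      exact Finset.sum_congr rfl fun i _ => by simp [mul_comm]
    · intro i _
      rw [integrable_μI_iff hT.le]
      exact (hpi i).intervalIntegrable_deriv.mul_continuousOn (hdi i).continuousOn
  rw [h1, h2, PiLp.inner_apply, PiLp.inner_apply, ← Finset.sum_sub_distrib,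
    ← Finset.sum_sub_distrib]
  refine Finset.sum_congr rfl fun i _ => ?_
  rw [integral_μI hT.le, integral_μI hT.le, (hpi i).integral_mul_deriv_eq_deriv_mul (hdi i)]
  simp [mul_comm]

/-- Integration by parts moves the derivative onto the Lipschitz factor, so uniform smallness of `d`
is enough. -/
lemma abs_integral_inner_deriv_le (hT : 0 < T) {p d : ℝ → E N} {K : NNReal} {M δ : ℝ}
    (hp : LipschitzWith K p) (hM : ∀ t, ‖p t‖ ≤ M) (hd : AbsolutelyContinuousOnInterval d (-T) T)
    (hδ : ∀ t ∈ Icc (-T) T, ‖d t‖ ≤ δ) :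
    |∫ t, inner ℝ (p t) (deriv d t) ∂μI T| ≤ (2 * M + 2 * T * K) * δ := by
  have hpa : AbsolutelyContinuousOnInterval p (-T) T :=
    (hp.lipschitzOnWith).absolutelyContinuousOnInterval
  have hTm : T ∈ Icc (-T) T := ⟨by linarith, le_rfl⟩
  have hTm' : -T ∈ Icc (-T) T := ⟨le_rfl, by linarith⟩
  have hδ0 : 0 ≤ δ := (norm_nonneg _).trans (hδ T hTm)
  have hM0 : 0 ≤ M := (norm_nonneg _).trans (hM 0)
  have hb : ∀ t ∈ Icc (-T) T, |inner ℝ (p t) (d t)| ≤ M * δ := fun t ht =>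
    (abs_real_inner_le_norm _ _).trans (mul_le_mul (hM t) (hδ t ht) (norm_nonneg _) hM0)
  have h3 : |∫ t, inner ℝ (deriv p t) (d t) ∂μI T| ≤ 2 * T * K * δ := by
    have h4 := abs_integral_inner_le_of_bound (integrable_deriv_μI hT.le hpa)
      (integrable_of_ac hT hd).aestronglyMeasurable (R := δ)
      (by filter_upwards [ae_μI_mem_Icc T] with t ht using hδ t ht)
    refine h4.trans ?_
    gcongr
    have h5 : ∫ t, ‖deriv p t‖ ∂μI T ≤ ∫ _t, (K : ℝ) ∂μI T :=
      integral_mono (integrable_deriv_μI hT.le hpa).norm (integrable_const _)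
        fun t => norm_deriv_le_of_lipschitz hp
    rwa [integral_const, measureReal_μI hT, smul_eq_mul] at h5
  rw [integral_inner_deriv hT hpa hd]
  have h1 := hb T hTm
  have h2 := hb (-T) hTm'
  rw [abs_le] at *
  constructor <;> linarith [h1.1, h1.2, h2.1, h2.2, h3.1, h3.2]

/-- Bounded measurable functions are almost everywhere limits of bounded Lipschitz functions. -/
lemma exists_lipschitz_approx {y : ℝ → E N} (hy : StronglyMeasurable y) {M : ℝ}
    (hM : ∀ t, ‖y t‖ ≤ M) :
    ∃ p : ℕ → ℝ → E N, (∀ k, ∃ K : NNReal, LipschitzWith K (p k)) ∧ (∀ k t, ‖p k t‖ ≤ M) ∧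
      ∀ᵐ t, Tendsto (fun k => p k t) atTop (𝓝 (y t)) := by
  have hM0 : 0 ≤ M := (norm_nonneg _).trans (hM 0)
  have hloc : LocallyIntegrable y volume := by
    intro t
    refine ⟨Icc (t - 1) (t + 1), Icc_mem_nhds (by linarith) (by linarith), ?_⟩
    refine Measure.integrableOn_of_bounded (M := M) (by simp) hy.aestronglyMeasurable ?_
    exact Eventually.of_forall hM
  let Y : ℝ → E N := fun t => ∫ s in (0 : ℝ)..t, y s
  have hii : ∀ a b, IntervalIntegrable y volume a b := fun a b =>
    intervalIntegrable_iff.mpr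
      ((hloc.integrableOn_isCompact isCompact_uIcc).mono_set uIoc_subset_uIcc)
  have hYL : ∀ a b, ‖Y b - Y a‖ ≤ M * |b - a| := by
    intro a b
    rw [intervalIntegral.integral_interval_sub_left (hii _ _) (hii _ _)]
    exact intervalIntegral.norm_integral_le_of_norm_le_const fun t _ => hM t
  -- The approximants are averages of `y` over `[t, t + h k]`: bounded by `M`, Lipschitz because `Y`
  -- is, and convergent by Lebesgue differentiation.
  let h : ℕ → ℝ := fun k => 1 / ((k : ℝ) + 1)
  have hh0 : ∀ k, 0 < h k := fun k => by positivity
  refine ⟨fun k t => (h k)⁻¹ • (Y (t + h k) - Y t), fun k => ?_, fun k t => ?_, ?_⟩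
  · refine ⟨⟨(h k)⁻¹ * (2 * M), by have := hh0 k; positivity⟩,
      LipschitzWith.of_dist_le_mul fun a b => ?_⟩
    rw [dist_eq_norm, ← smul_sub, norm_smul, Real.norm_of_nonneg (by have := hh0 k; positivity)]
    change _ ≤ (h k)⁻¹ * (2 * M) * dist a b
    rw [mul_assoc]
    have := hh0 k
    gcongr
    have e : Y (a + h k) - Y a - (Y (b + h k) - Y b) =
        (Y (a + h k) - Y (b + h k)) - (Y a - Y b) := by abel
    rw [e, Real.dist_eq]
    have h1 := hYL (b + h k) (a + h k)
    rw [add_sub_add_right_eq_sub] at h1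
    have h2 := hYL b a
    exact (norm_sub_le _ _).trans (by linarith)
  · rw [norm_smul, Real.norm_of_nonneg (by have := hh0 k; positivity), inv_mul_le_iff₀ (hh0 k)]
    have := hYL t (t + h k)
    rwa [add_sub_cancel_left, abs_of_pos (hh0 k), mul_comm] at this
  · filter_upwards [LocallyIntegrable.ae_hasDerivAt_integral hloc] with t ht
    have h1 := (ht 0).tendsto_slope_zero_right
    have h2 : Tendsto h atTop (𝓝[>] 0) :=
      tendsto_nhdsWithin_of_tendsto_nhds_of_eventually_within _
        tendsto_one_div_add_atTop_nhds_zero_nat (Eventually.of_forall hh0)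
    exact h1.comp h2

end AnisotropicEL

/-! ### Weak convergence of derivatives and weak limits. -/

namespace AnisotropicEL

variable {N : ℕ} {G : E N → ℝ} {T : ℝ}

section Weak

variable {u : ℕ → ℝ → E N} {U : ℝ → E N} {K : ℝ}
    (hT : 0 < T) (hu : ∀ n, AbsolutelyContinuousOnInterval (u n) (-T) T)
    (hU : AbsolutelyContinuousOnInterval U (-T) T)
    (hGu : ∀ n, Integrable (fun t => G (deriv (u n) t)) (μI T))
    (hK : ∀ n, ∫ t, G (deriv (u n) t) ∂μI T ≤ K)
    (hlim : ∀ ε > 0, ∀ᶠ n in atTop, ∀ t ∈ Icc (-T) T, ‖u n t - U t‖ ≤ ε)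
include hT hu hU hGu hK hlim

/-- A Lipschitz approximant `p k` of `y` is handled by integration by parts. The error pairs `y - p
k` with the derivatives, where `‖u̇_n‖ ≤ η G(u̇_n) + C` makes it small uniformly in `n`. -/
lemma tendsto_integral_inner_of_bounded (hG : IsYoung G) {y : ℝ → E N}
    (hy : AEStronglyMeasurable y (μI T)) {M : ℝ} (hM : ∀ᵐ t ∂μI T, ‖y t‖ ≤ M) :
    Tendsto (fun n => ∫ t, inner ℝ (y t) (deriv (u n) t - deriv U t) ∂μI T) atTop (𝓝 0) := by
  wlog hM0 : 0 ≤ M generalizing M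
  · refine this (M := |M|) ?_ (abs_nonneg M)
    filter_upwards [hM] with t ht using ht.trans (le_abs_self M)
  obtain ⟨z, hz, hzM, hyz⟩ : ∃ z : ℝ → E N, StronglyMeasurable z ∧ (∀ t, ‖z t‖ ≤ M) ∧
      y =ᵐ[μI T] z := by
    have hms : MeasurableSet {t | ‖hy.mk y t‖ ≤ M} :=
      measurableSet_le hy.stronglyMeasurable_mk.norm.measurable measurable_const
    refine ⟨{t | ‖hy.mk y t‖ ≤ M}.indicator (hy.mk y), hy.stronglyMeasurable_mk.indicator hms,
      fun t => ?_, ?_⟩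
    · by_cases ht : t ∈ {t | ‖hy.mk y t‖ ≤ M}
      · rw [indicator_of_mem ht]; exact ht
      · rw [indicator_of_notMem ht]; simpa using hM0
    · filter_upwards [hy.ae_eq_mk, hM] with t h1 h2
      rw [h1] at h2
      rw [indicator_of_mem (show t ∈ {t | ‖hy.mk y t‖ ≤ M} from h2), h1]
  have hcongr : ∀ n, ∫ t, inner ℝ (y t) (deriv (u n) t - deriv U t) ∂μI T =
      ∫ t, inner ℝ (z t) (deriv (u n) t - deriv U t) ∂μI T := fun n => by
    refine integral_congr_ae ?_
    filter_upwards [hyz] with t ht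
    rw [ht]
  simp_rw [hcongr]
  obtain ⟨p, hpL, hpM, hp⟩ := exists_lipschitz_approx hz hzM
  have hpz : ∀ᵐ t ∂μI T, Tendsto (fun k => p k t) atTop (𝓝 (z t)) := ae_restrict_of_ae hp
  have hpm : ∀ k, AEStronglyMeasurable (p k) (μI T) := fun k => by
    obtain ⟨L, hL⟩ := hpL k
    exact hL.continuous.aestronglyMeasurable
  have hUi := integrable_deriv_μI hT.le hU
  have hui := fun n => integrable_deriv_μI hT.le (hu n)
  rw [Metric.tendsto_nhds]
  intro ε hε
  -- Chosen so that `2 (M + 1) * η * (|K| + 1) = ε / 4`.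
  set η := ε / (8 * (M + 1) * (|K| + 1)) with hη
  have hη0 : 0 < η := by positivity
  obtain ⟨C, hC0, hC⟩ := hG.coercive η hη0
  have ha : Tendsto (fun k => ∫ t, ‖z t - p k t‖ * (C + ‖deriv U t‖) ∂μI T) atTop (𝓝 0) := by
    have h0 : (0 : ℝ) = ∫ _t, (0 : ℝ) ∂μI T := by simp
    rw [h0]
    refine tendsto_integral_of_dominated_convergence
      (fun t => 2 * M * (C + ‖deriv U t‖)) (fun k => ?_)
      (((integrable_const C).add hUi.norm).const_mul _) (fun k => ?_) ?_
    · exact ((hz.aestronglyMeasurable.sub (hpm k)).norm).mul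
        (((integrable_const C).add hUi.norm).aestronglyMeasurable)
    · refine Eventually.of_forall fun t => ?_
      rw [Real.norm_of_nonneg (by positivity)]
      gcongr
      refine (norm_sub_le _ _).trans ?_
      linarith [hzM t, hpM k t]
    · filter_upwards [hpz] with t ht
      have h1 := (ht.const_sub (z t)).norm.mul_const (C + ‖deriv U t‖)
      simpa using h1
  obtain ⟨k, hk⟩ := (ha.eventually (gt_mem_nhds (by positivity : 0 < ε / 4))).exists
  obtain ⟨L, hL⟩ := hpL k
  set D := 2 * M + 2 * T * L + 1 with hD
  have hD0 : 0 < D := by positivity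
  filter_upwards [hlim (ε / (4 * D)) (by positivity)] with n hn
  have hdi : Integrable (fun t => deriv (u n) t - deriv U t) (μI T) := (hui n).sub hUi
  have hzb : ∀ᵐ t ∂μI T, ‖z t - p k t‖ ≤ 2 * M := Eventually.of_forall fun t =>
    (norm_sub_le _ _).trans (by linarith [hzM t, hpM k t])
  have hi1 : Integrable (fun t => inner ℝ (p k t) (deriv (u n) t - deriv U t)) (μI T) := by
    have := integrable_inner_of_bound hdi (hpm k) (Eventually.of_forall (hpM k))
    simpa only [real_inner_comm] using this
  have hi2 : Integrable (fun t => inner ℝ (z t - p k t) (deriv (u n) t - deriv U t)) (μI T) := by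
    refine (integrable_inner_of_bound hdi (hz.aestronglyMeasurable.sub (hpm k)) hzb).congr
      (Eventually.of_forall fun t => ?_)
    exact real_inner_comm _ _
  have h1 : ∫ t, inner ℝ (z t) (deriv (u n) t - deriv U t) ∂μI T =
      ∫ t, inner ℝ (p k t) (deriv (u n) t - deriv U t) ∂μI T +
      ∫ t, inner ℝ (z t - p k t) (deriv (u n) t - deriv U t) ∂μI T := by
    rw [← integral_add hi1 hi2]
    refine integral_congr_ae (Eventually.of_forall fun t => ?_)
    simp only
    rw [← inner_add_left, add_sub_cancel]
  have h2 : |∫ t, inner ℝ (p k t) (deriv (u n) t - deriv U t) ∂μI T| ≤ ε / 4 := by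
    have h3 := abs_integral_inner_deriv_le hT hL (hpM k) ((hu n).sub hU) hn
    have h4 : ∫ t, inner ℝ (p k t) (deriv (u n - U) t) ∂μI T =
        ∫ t, inner ℝ (p k t) (deriv (u n) t - deriv U t) ∂μI T := by
      refine integral_congr_ae ?_
      filter_upwards [deriv_sub_ae hT.le (hu n) hU] with t ht
      rw [ht]; rfl
    rw [h4] at h3
    refine h3.trans ?_
    calc (2 * M + 2 * T * L) * (ε / (4 * D)) ≤ D * (ε / (4 * D)) := by gcongr; linarith
      _ = ε / 4 := by field_simp
  have h3 : |∫ t, inner ℝ (z t - p k t) (deriv (u n) t - deriv U t) ∂μI T| ≤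
      2 * M * (η * ∫ t, G (deriv (u n) t) ∂μI T) +
        ∫ t, ‖z t - p k t‖ * (C + ‖deriv U t‖) ∂μI T := by
    have hiz : Integrable (fun t => ‖z t - p k t‖ * (C + ‖deriv U t‖)) (μI T) := by
      refine Integrable.bdd_mul ((integrable_const C).add hUi.norm)
        (hz.aestronglyMeasurable.sub (hpm k)).norm (c := 2 * M) ?_
      filter_upwards [hzb] with t ht
      rwa [norm_norm]
    rw [← integral_const_mul, ← integral_const_mul, ← integral_add (((hGu n).const_mul _).const_mul _)
      hiz, ← Real.norm_eq_abs]
    refine (norm_integral_le_integral_norm _).trans ?_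
    refine integral_mono_ae hi2.norm ((((hGu n).const_mul _).const_mul _).add hiz) ?_
    filter_upwards [hzb] with t ht
    have e1 := abs_real_inner_le_norm (z t - p k t) (deriv (u n) t - deriv U t)
    have e2 := norm_sub_le (deriv (u n) t) (deriv U t)
    have e3 := hC (deriv (u n) t)
    have e4 := hG.nonneg (deriv (u n) t)
    have e5 : ‖z t - p k t‖ * ‖deriv (u n) t - deriv U t‖ ≤
        ‖z t - p k t‖ * (η * G (deriv (u n) t) + (C + ‖deriv U t‖)) := by gcongr; linarith
    have e6 : ‖z t - p k t‖ * (η * G (deriv (u n) t)) ≤ 2 * M * (η * G (deriv (u n) t)) := by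
      gcongr
    simp only [Real.norm_eq_abs]
    linarith
  have h4 : 2 * M * (η * ∫ t, G (deriv (u n) t) ∂μI T) ≤ ε / 4 := by
    have : ∫ t, G (deriv (u n) t) ∂μI T ≤ |K| + 1 := (hK n).trans (by linarith [le_abs_self K])
    calc 2 * M * (η * ∫ t, G (deriv (u n) t) ∂μI T) ≤ 2 * (M + 1) * (η * (|K| + 1)) := by
          gcongr
          · exact mul_nonneg hη0.le (integral_nonneg fun t => hG.nonneg _)
          · linarith
      _ = ε / 4 := by rw [hη]; field_simp; norm_num
  rw [Real.dist_0_eq_abs, h1]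
  refine (abs_add_le _ _).trans_lt ?_
  linarith

/-- On `{‖U̇‖ ≤ R}` the gradient `∇G(U̇)` is bounded, so in `G(U̇) + ⟨∇G(U̇), u̇_n - U̇⟩ ≤ G(u̇_n)`
the linear term disappears in the limit. The truncated modular is therefore at most `K`, and Fatou's
lemma removes the truncation. -/
lemma deriv_limit_mem (hG : IsGFunction G) : deriv U ∈ LG G T := by
  have hUi := integrable_deriv_μI hT.le hU
  refine ⟨hUi.aestronglyMeasurable, ?_⟩
  have hUm : StronglyMeasurable (deriv U) := stronglyMeasurable_deriv U
  have hgc : Continuous (gradient G) :=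
    (InnerProductSpace.toDual ℝ (E N)).symm.continuous.comp (hG.contDiff.continuous_fderiv one_ne_zero)
  let A : ℕ → Set ℝ := fun R => {t | ‖deriv U t‖ ≤ R}
  have hA : ∀ R, MeasurableSet (A R) := fun R =>
    measurableSet_le hUm.norm.measurable measurable_const
  have hGA : ∀ R, Integrable ((A R).indicator fun t => G (deriv U t)) (μI T) := fun R => by
    rw [integrable_indicator_iff (hA R)]
    refine hG.isYoung.integrable_of_bound hUm.aestronglyMeasurable (R := R) ?_
    filter_upwards [ae_restrict_mem (hA R)] with t ht using ht
  refine (integrable_and_integral_le_of_tendsto (μ := μI T) (C := K)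
    (f := fun R => (A R).indicator fun t => G (deriv U t)) hGA
    (fun R t => indicator_nonneg (fun t _ => hG.nonneg _) t) ?_ fun R => ?_).1
  · refine Eventually.of_forall fun t => tendsto_const_nhds.congr' ?_
    obtain ⟨m, hm⟩ := exists_nat_ge ‖deriv U t‖
    filter_upwards [eventually_ge_atTop m] with R hR
    rw [indicator_of_mem]
    exact hm.trans (by exact_mod_cast hR)
  · let y : ℝ → E N := (A R).indicator fun t => gradient G (deriv U t)
    have hym : AEStronglyMeasurable y (μI T) :=
      ((hgc.comp_stronglyMeasurable hUm).indicator (hA R)).aestronglyMeasurable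
    obtain ⟨M, hM⟩ := (isCompact_closedBall (0 : E N) R).exists_bound_of_continuousOn
      hgc.continuousOn
    have hyM : ∀ t, ‖y t‖ ≤ |M| := fun t => by
      by_cases ht : t ∈ A R
      · simp only [y, indicator_of_mem ht]
        exact (hM _ (by simpa using! ht)).trans (le_abs_self M)
      · simp [y, indicator_of_notMem ht]
    have hw := tendsto_integral_inner_of_bounded hT hu hU hGu hK hlim hG.isYoung hym
      (Eventually.of_forall hyM)
    have hle : ∀ n, ∫ t, (A R).indicator (fun t => G (deriv U t)) t ∂μI T +
        ∫ t, inner ℝ (y t) (deriv (u n) t - deriv U t) ∂μI T ≤ K := by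
      intro n
      have hi : Integrable (fun t => inner ℝ (y t) (deriv (u n) t - deriv U t)) (μI T) := by
        refine (integrable_inner_of_bound ((integrable_deriv_μI hT.le (hu n)).sub hUi) hym
          (Eventually.of_forall hyM)).congr (Eventually.of_forall fun t => ?_)
        exact real_inner_comm _ _
      rw [← integral_add (hGA R) hi]
      refine (integral_mono ((hGA R).add hi) (hGu n) fun t => ?_).trans (hK n)
      by_cases ht : t ∈ A R
      · simp only [y, indicator_of_mem ht, Pi.add_apply]
        exact ConvexOn.add_inner_gradient_le hG.convex
          (hG.contDiff.differentiable one_ne_zero _) _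
      · simp [y, indicator_of_notMem ht, hG.nonneg]
    have h2 := le_of_tendsto' (hw.const_add _) hle
    simpa using h2

/-- Truncation of `y` reduces to the bounded case. The tail is controlled by Fenchel–Young at scale
`η`: the modulars of `u̇_n - U̇` stay below `Q`, and that of the rescaled tail tends to zero by `Δ₂`
for `conj G`. -/
lemma tendsto_integral_inner (hG : IsGFunction G) {y : ℝ → E N} (hy : y ∈ LG (conj G) T) :
    Tendsto (fun n => ∫ t, inner ℝ (y t) (deriv (u n) t - deriv U t) ∂μI T) atTop (𝓝 0) := by
  have hUG := deriv_limit_mem hT hu hU hGu hK hlim hG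
  have hY := hG.isYoung
  have hYc := hG.isYoung_conj
  have huG : ∀ n, deriv (u n) ∈ LG G T := fun n =>
    ⟨(integrable_deriv_μI hT.le (hu n)).aestronglyMeasurable, hGu n⟩
  obtain ⟨C, hC0, hC⟩ := hY.exists_add_le 1
  set Q := C * (|K| + ∫ t, G (deriv U t) ∂μI T + 2 * T) + 1 with hQ
  have hQ0 : 0 < Q := by
    have : 0 ≤ ∫ t, G (deriv U t) ∂μI T := integral_nonneg fun t => hG.nonneg _
    positivity
  have hmod : ∀ n, ∫ t, G (deriv (u n) t - deriv U t) ∂μI T ≤ Q := by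
    intro n
    have h1 : ∫ t, G (deriv (u n) t - deriv U t) ∂μI T ≤
        ∫ t, C * (G (deriv (u n) t) + G (deriv U t) + 1) ∂μI T := by
      refine integral_mono (hY.LG_sub (huG n) hUG).2
        ((((huG n).2.add hUG.2).add (integrable_const 1)).const_mul C) fun t => ?_
      have := hC 1 (-1) (by simp) (by simp) (deriv (u n) t) (deriv U t)
      rwa [one_smul, neg_one_smul, ← sub_eq_add_neg] at this
    have h3 : Integrable (fun t => G (deriv (u n) t) + G (deriv U t)) (μI T) := (huG n).2.add hUG.2
    rw [integral_const_mul, integral_add h3 (integrable_const 1),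
      integral_add (huG n).2 hUG.2, integral_const, measureReal_μI hT, smul_eq_mul, mul_one] at h1
    refine h1.trans ?_
    have h2 : C * (∫ t, G (deriv (u n) t) ∂μI T + ∫ t, G (deriv U t) ∂μI T + 2 * T) ≤
        C * (|K| + ∫ t, G (deriv U t) ∂μI T + 2 * T) := by
      gcongr
      exact (hK n).trans (le_abs_self K)
    linarith
  rw [Metric.tendsto_nhds]
  intro ε hε
  -- The truncation level is chosen to bring the rescaled tail below `Q` as well, and `η * (Q + Q) =
  -- ε / 2`.
  set η := ε / (4 * Q) with hη
  have hη0 : 0 < η := by positivity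
  let A : ℕ → Set ℝ := fun R => {t | ‖hy.1.mk y t‖ ≤ R}
  have hA : ∀ R, MeasurableSet (A R) := fun R =>
    measurableSet_le hy.1.stronglyMeasurable_mk.norm.measurable measurable_const
  let z : ℕ → ℝ → E N := fun R => (A R).indicator (hy.1.mk y)
  have hzm : ∀ R, AEStronglyMeasurable (z R) (μI T) := fun R =>
    (hy.1.stronglyMeasurable_mk.indicator (hA R)).aestronglyMeasurable
  have hzb : ∀ R t, ‖z R t‖ ≤ R := fun R t => by
    by_cases ht : t ∈ A R
    · simp only [z, indicator_of_mem ht]; exact ht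
    · simp [z, indicator_of_notMem ht]
  have hzG : ∀ R, z R ∈ LG (conj G) T := fun R =>
    hYc.LG_of_bound (hzm R) (Eventually.of_forall (hzb R))
  have ha : Tendsto (fun R => ∫ t, conj G (η⁻¹ • (y t - z R t)) ∂μI T) atTop (𝓝 0) := by
    have h0 : (0 : ℝ) = ∫ _t, (0 : ℝ) ∂μI T := by simp
    rw [h0]
    have hm : ∀ R, AEStronglyMeasurable (fun t => η⁻¹ • (y t - z R t)) (μI T) := fun R =>
      (hy.1.sub (hzm R)).const_smul η⁻¹
    refine tendsto_integral_of_dominated_convergence (fun t => conj G (η⁻¹ • y t))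
      (fun R => hYc.aestronglyMeasurable_comp (hm R))
      (hYc.integrable_smul hy.1 hy.2 _) (fun R => ?_) ?_
    · filter_upwards [hy.1.ae_eq_mk] with t ht
      rw [Real.norm_of_nonneg (hG.conj_nonneg _)]
      by_cases hm : t ∈ A R
      · simp only [z, indicator_of_mem hm, ← ht, sub_self, smul_zero, hYc.zero]
        exact hG.conj_nonneg _
      · simp [z, indicator_of_notMem hm]
    · filter_upwards [hy.1.ae_eq_mk] with t ht
      refine tendsto_const_nhds.congr' ?_
      obtain ⟨m, hm⟩ := exists_nat_ge ‖hy.1.mk y t‖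
      filter_upwards [eventually_ge_atTop m] with R hR
      have hmem : t ∈ A R := hm.trans (by exact_mod_cast hR)
      simp only [z, indicator_of_mem hmem, ← ht, sub_self, smul_zero, hYc.zero]
  obtain ⟨R, hR⟩ := (ha.eventually (gt_mem_nhds hQ0)).exists
  have hw := tendsto_integral_inner_of_bounded hT hu hU hGu hK hlim hY (hzm R)
    (Eventually.of_forall (hzb R))
  filter_upwards [(Metric.tendsto_nhds.1 hw) (ε / 4) (by positivity)] with n hn
  rw [Real.dist_0_eq_abs] at hn ⊢
  have hvG := hY.LG_sub (huG n) hUG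
  have hyz := hYc.LG_sub hy (hzG R)
  have hi1 : Integrable (fun t => inner ℝ (z R t) (deriv (u n) t - deriv U t)) (μI T) :=
    hG.integrable_inner (hzG R) hvG
  have hi2 : Integrable (fun t => inner ℝ (y t - z R t) (deriv (u n) t - deriv U t)) (μI T) :=
    hG.integrable_inner hyz hvG
  have h1 : ∫ t, inner ℝ (y t) (deriv (u n) t - deriv U t) ∂μI T =
      ∫ t, inner ℝ (z R t) (deriv (u n) t - deriv U t) ∂μI T +
      ∫ t, inner ℝ (y t - z R t) (deriv (u n) t - deriv U t) ∂μI T := by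
    rw [← integral_add hi1 hi2]
    refine integral_congr_ae (Eventually.of_forall fun t => ?_)
    simp only
    rw [← inner_add_left, add_sub_cancel]
  have h2 : |∫ t, inner ℝ (y t - z R t) (deriv (u n) t - deriv U t) ∂μI T| ≤
      η * (∫ t, conj G (η⁻¹ • (y t - z R t)) ∂μI T +
        ∫ t, G (deriv (u n) t - deriv U t) ∂μI T) := by
    have hs : Integrable (fun t => conj G (η⁻¹ • (y t - z R t))) (μI T) :=
      hYc.integrable_smul hyz.1 hyz.2 η⁻¹
    have hv : Integrable (fun t => G (deriv (u n) t - deriv U t)) (μI T) := hvG.2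
    rw [← integral_add hs hv, ← integral_const_mul, ← Real.norm_eq_abs]
    refine (norm_integral_le_integral_norm _).trans ?_
    refine integral_mono hi2.norm ((hs.add hv).const_mul η)
      fun t => ?_
    have h3 := hG.abs_inner_le (deriv (u n) t - deriv U t) (η⁻¹ • (y t - z R t))
    rw [inner_smul_right, abs_mul, abs_of_pos (inv_pos.2 hη0), inv_mul_le_iff₀ hη0,
      real_inner_comm] at h3
    simp only [Real.norm_eq_abs]
    linarith
  have h3 : η * (∫ t, conj G (η⁻¹ • (y t - z R t)) ∂μI T +
        ∫ t, G (deriv (u n) t - deriv U t) ∂μI T) ≤ η * (Q + Q) := by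
    gcongr; exact hmod n
  have h4 : η * (Q + Q) = ε / 2 := by rw [hη]; field_simp; norm_num
  rw [h1]
  refine (abs_add_le _ _).trans_lt ?_
  linarith

end Weak

/-- Uniform convergence together with weak convergence of the derivatives. -/
structure TendstoWeakly {hG : IsGFunction G} {hT : 0 < T} (u : ℕ → PeriodicSpace hG hT)
    (U : PeriodicSpace hG hT) : Prop where
  unif : ∀ ε > 0, ∀ᶠ n in atTop, ∀ t ∈ Icc (-T) T, ‖(u n - U).fn t‖ ≤ ε
  weak : ∀ y ∈ LG (conj G) T, Tendsto (fun n =>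
    ∫ t, inner ℝ (y t) (deriv (u n - U).fn t) ∂μI T) atTop (𝓝 0)

/-- Weak sequential compactness of bounded sets in `W¹_T L^G`. -/
theorem exists_weak_limit {hG : IsGFunction G} {hT : 0 < T} (u : ℕ → PeriodicSpace hG hT)
    {K R : ℝ} (hK : ∀ n, ∫ t, G (deriv (u n).fn t) ∂μI T ≤ K)
    (hR : ∀ n, ∀ t ∈ Icc (-T) T, ‖(u n).fn t‖ ≤ R) :
    ∃ φ : ℕ → ℕ, StrictMono φ ∧ ∃ U : PeriodicSpace hG hT,
      TendstoWeakly (fun n => u (φ n)) U := by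
  have hY := hG.isYoung
  obtain ⟨φ, hφ, U, hlim⟩ := exists_uniform_subseq hY hT (fun n => (u n).ac)
    (fun n => (u n).deriv_mem.2) hK hR
  have hpt : ∀ t ∈ Icc (-T) T, Tendsto (fun n => (u (φ n)).fn t) atTop (𝓝 (U t)) := by
    intro t ht
    rw [Metric.tendsto_nhds]
    intro ε hε
    filter_upwards [hlim (ε / 2) (by positivity)] with n hn
    rw [dist_eq_norm]
    linarith [hn t ht]
  have hU := ac_of_tendsto hY hT (fun n => (u (φ n)).ac) (fun n => (u (φ n)).deriv_mem.2)
    (fun n => hK (φ n)) hpt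
  have hUd := deriv_limit_mem hT (fun n => (u (φ n)).ac) hU (fun n => (u (φ n)).deriv_mem.2)
    (fun n => hK (φ n)) hlim hG
  have hUm : U ∈ WLGT G T := by
    obtain ⟨C, hC⟩ := hU.exists_bound
    rw [uIcc_neg_self hT.le] at hC
    refine ⟨⟨hU, hY.LG_of_bound (integrable_of_ac hT hU).aestronglyMeasurable (R := C) ?_, hUd⟩, ?_⟩
    · filter_upwards [ae_μI_mem_Icc T] with t ht using hC t ht
    · have h1 := hpt T ⟨by linarith, le_rfl⟩
      have h2 : (fun n => (u (φ n)).fn T) = fun n => (u (φ n)).fn (-T) := by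
        ext1 n; exact (u (φ n)).mem.2.symm
      rw [h2] at h1
      exact tendsto_nhds_unique (hpt (-T) ⟨le_rfl, by linarith⟩) h1
  refine ⟨φ, hφ, PeriodicSpace.mk U hUm, hlim, fun y hy => ?_⟩
  refine (tendsto_integral_inner hT (fun n => (u (φ n)).ac) hU (fun n => (u (φ n)).deriv_mem.2)
    (fun n => hK (φ n)) hlim hG hy).congr fun n => integral_congr_ae ?_
  filter_upwards [(u (φ n)).deriv_sub_ae (PeriodicSpace.mk U hUm)] with t ht
  rw [ht]
  rfl

end AnisotropicEL

/-! ### Lower semicontinuity of the action. -/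

namespace AnisotropicEL

variable {N : ℕ} {G : E N → ℝ} {T : ℝ} {hG : IsGFunction G} {hT : 0 < T}

namespace TendstoWeakly

variable {u : ℕ → PeriodicSpace hG hT} {U : PeriodicSpace hG hT}

lemma subseq (h : TendstoWeakly u U) {ψ : ℕ → ℕ} (hψ : Tendsto ψ atTop atTop) :
    TendstoWeakly (fun n => u (ψ n)) U :=
  ⟨fun ε hε => hψ.eventually (h.unif ε hε), fun y hy => (h.weak y hy).comp hψ⟩

lemma add_const (h : TendstoWeakly u U) (φ : PeriodicSpace hG hT) :
    TendstoWeakly (fun n => u n + φ) (U + φ) := by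
  refine ⟨fun ε hε => ?_, fun y hy => ?_⟩
  · simpa only [add_sub_add_right_eq_sub] using h.unif ε hε
  · simpa only [add_sub_add_right_eq_sub] using h.weak y hy

lemma tendsto_apply (h : TendstoWeakly u U) {t : ℝ} (ht : t ∈ Icc (-T) T) :
    Tendsto (fun n => (u n).fn t) atTop (𝓝 (U.fn t)) := by
  rw [Metric.tendsto_nhds]
  intro ε hε
  filter_upwards [h.unif (ε / 2) (by positivity)] with n hn
  rw [dist_eq_norm]
  have : ‖(u n).fn t - U.fn t‖ ≤ ε / 2 := hn t ht
  linarith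

end TendstoWeakly

lemma PeriodicSpace.exists_common_bound {u : ℕ → PeriodicSpace hG hT} (U : PeriodicSpace hG hT)
    {Q : ℝ} (hQ : ∀ n, ‖u n‖ ≤ Q) :
    ∃ R ≥ 0, (∀ n, ∀ t ∈ Icc (-T) T, ‖(u n).fn t‖ ≤ R) ∧ ∀ t ∈ Icc (-T) T, ‖U.fn t‖ ≤ R := by
  obtain ⟨C, hC0, hC⟩ := PeriodicSpace.exists_norm_apply_le hG hT
  refine ⟨C * max Q ‖U‖, mul_nonneg hC0 ((norm_nonneg U).trans (le_max_right _ _)),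
    fun n t ht => (hC _ t ht).trans ?_, fun t ht => (hC _ t ht).trans ?_⟩
  · exact mul_le_mul_of_nonneg_left ((hQ n).trans (le_max_left _ _)) hC0
  · exact mul_le_mul_of_nonneg_left (le_max_right _ _) hC0

namespace IsLagrangian

variable {L : ℝ → E N → E N → ℝ} {u : ℕ → PeriodicSpace hG hT} {U : PeriodicSpace hG hT} {Q : ℝ}
  (hL : IsLagrangian G T L) (hu : TendstoWeakly u U) (hQ : ∀ n, ‖u n‖ ≤ Q)
include hL hu hQ

/-- With the velocity frozen, only the convergence of positions matters and dominated convergence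
applies. -/
lemma tendsto_integral_frozen {w : ℝ → E N} (hw : w ∈ LG G T) :
    Tendsto (fun n => ∫ t, L t ((u n).fn t) (w t) ∂μI T) atTop
      (𝓝 (∫ t, L t (U.fn t) (w t) ∂μI T)) := by
  obtain ⟨R, hR0, hR, hRU⟩ := PeriodicSpace.exists_common_bound U hQ
  obtain ⟨B, hB, hB0, hbd⟩ := hL.bound
  obtain ⟨A, hA, hb⟩ := hbd R
  refine tendsto_integral_of_dominated_convergence (fun t => A * (B t + G (w t)))
    (fun n => (hL.meas _ _ (u n).mem_LG.1 hw.1).1) ((hB.add hw.2).const_mul A) (fun n => ?_) ?_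
  · filter_upwards [ae_μI_mem_Icc T] with t ht using (hb t ht _ _ (hR n t ht)).1
  · filter_upwards [ae_μI_mem_Icc T] with t ht
    exact ((hL.continuous t ht).tendsto (U.fn t, w t)).comp
      ((hu.tendsto_apply ht).prodMk_nhds tendsto_const_nhds)

lemma tendsto_modular_gradV_frozen {w : ℝ → E N} (hw : w ∈ LG G T) (c : ℝ) :
    Tendsto (fun n => ∫ t, conj G (c • (gradV L t ((u n).fn t) (w t) -
      gradV L t (U.fn t) (w t))) ∂μI T) atTop (𝓝 0) := by
  obtain ⟨R, hR0, hR, hRU⟩ := PeriodicSpace.exists_common_bound U hQ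
  obtain ⟨B, hB, hB0, hbd⟩ := hL.bound
  obtain ⟨A, hA, hb⟩ := hbd R
  have hYc := hG.isYoung_conj
  obtain ⟨K, hK0, hK⟩ := hYc.exists_add_le |c|
  have h0 : (0 : ℝ) = ∫ _t, (0 : ℝ) ∂μI T := by simp
  rw [h0]
  refine tendsto_integral_of_dominated_convergence
    (fun t => K * (A * (B t + G (w t)) + A * (B t + G (w t)) + 1)) (fun n => ?_)
    (((((hB.add hw.2).const_mul A).add ((hB.add hw.2).const_mul A)).add
      (integrable_const 1)).const_mul K) (fun n => ?_) ?_
  · have hm : AEStronglyMeasurable (fun t => c • (gradV L t ((u n).fn t) (w t) -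
        gradV L t (U.fn t) (w t))) (μI T) :=
      ((hL.meas _ _ (u n).mem_LG.1 hw.1).2.2.sub (hL.meas _ _ U.mem_LG.1 hw.1).2.2).const_smul c
    exact hYc.aestronglyMeasurable_comp hm
  · filter_upwards [ae_μI_mem_Icc T] with t ht
    rw [Real.norm_of_nonneg (hG.conj_nonneg _)]
    have h1 := hK c (-c) le_rfl (by rw [abs_neg])
      (gradV L t ((u n).fn t) (w t)) (gradV L t (U.fn t) (w t))
    rw [neg_smul, ← sub_eq_add_neg, ← smul_sub] at h1
    have h2 := (hb t ht _ (w t) (hR n t ht)).2.2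
    have h3 := (hb t ht _ (w t) (hRU t ht)).2.2
    refine h1.trans ?_
    gcongr
  · filter_upwards [ae_μI_mem_Icc T] with t ht
    have h1 := (hL.tendsto_grad ht (hu.tendsto_apply ht) (tendsto_const_nhds (x := w t))).2
    have h2 := (h1.sub_const (gradV L t (U.fn t) (w t))).const_smul c
    rw [sub_self, smul_zero] at h2
    have h3 := (hYc.continuous.tendsto 0).comp h2
    rwa [hYc.zero] at h3

/-- The momentum at frozen velocity converges strongly and is paired with a bounded sequence; what
remains is a fixed element of `L^{G*}` paired with a weakly null one. -/
lemma tendsto_integral_gradV_frozen :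
    Tendsto (fun n => ∫ t, inner ℝ (gradV L t ((u n).fn t) (deriv U.fn t))
      (deriv (u n - U).fn t) ∂μI T) atTop (𝓝 0) := by
  obtain ⟨R, hR0, hR, hRU⟩ := PeriodicSpace.exists_common_bound U hQ
  have hq : ∀ n, (fun t => gradV L t ((u n).fn t) (deriv U.fn t)) ∈ LG (conj G) T := fun n =>
    hL.gradV_mem hG (u n).mem_LG.1
      (by filter_upwards [ae_μI_mem_Icc T] with t ht using hR n t ht) U.deriv_mem
  have hq0 := hL.gradV_mem_LG U
  have hsplit : ∀ n, ∫ t, inner ℝ (gradV L t ((u n).fn t) (deriv U.fn t))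
      (deriv (u n - U).fn t) ∂μI T =
      ∫ t, inner ℝ (gradV L t ((u n).fn t) (deriv U.fn t) - gradV L t (U.fn t) (deriv U.fn t))
        (deriv (u n - U).fn t) ∂μI T +
      ∫ t, inner ℝ (gradV L t (U.fn t) (deriv U.fn t)) (deriv (u n - U).fn t) ∂μI T := by
    intro n
    have hi : Integrable (fun t => inner ℝ (gradV L t ((u n).fn t) (deriv U.fn t) -
        gradV L t (U.fn t) (deriv U.fn t)) (deriv (u n - U).fn t)) (μI T) :=
      hG.integrable_inner (hG.isYoung_conj.LG_sub (hq n) hq0) (u n - U).deriv_mem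
    rw [← integral_add hi (hG.integrable_inner hq0 (u n - U).deriv_mem)]
    refine integral_congr_ae (Eventually.of_forall fun t => ?_)
    simp only
    rw [← inner_add_left, sub_add_cancel]
  simp_rw [hsplit]
  rw [← add_zero (0 : ℝ)]
  refine Tendsto.add ?_ (hu.weak _ hq0)
  set D := Q + ‖U‖ + 1 with hD
  have hQ0 : 0 ≤ Q := (norm_nonneg _).trans (hQ 0)
  have hD0 : 0 < D := by positivity
  rw [Metric.tendsto_nhds]
  intro ε hε
  set η := ε / (4 * D) with hη
  have hη0 : 0 < η := by positivity
  filter_upwards [(hL.tendsto_modular_gradV_frozen hu hQ U.deriv_mem η⁻¹).eventually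
    (gt_mem_nhds one_pos)] with n hn
  rw [Real.dist_0_eq_abs]
  have h1 := hG.abs_integral_inner_le_scaled (hG.isYoung_conj.LG_sub (hq n) hq0)
    (u n - U).deriv_mem hη0
  simp only [Pi.sub_apply] at h1
  have h2 : normLG G T (deriv (u n - U).fn) ≤ D :=
    ((u n - U).normLG_deriv_le.trans (norm_sub_le _ _)).trans (by linarith [hQ n])
  refine h1.trans_lt ?_
  have h3 : η * (∫ t, conj G (η⁻¹ • (gradV L t ((u n).fn t) (deriv U.fn t) -
      gradV L t (U.fn t) (deriv U.fn t))) ∂μI T + 1) * normLG G T (deriv (u n - U).fn) ≤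
      η * (1 + 1) * D := by
    gcongr
    exact normLG_nonneg _ _ _
  refine h3.trans_lt ?_
  have : η * (1 + 1) * D = ε / 2 := by rw [hη]; field_simp; norm_num
  linarith

variable (hconv : ∀ t ∈ Icc (-T) T, ∀ x v w,
  L t x v + inner ℝ (gradV L t x v) (w - v) ≤ L t x w)
include hconv

/-- Lower semicontinuity of the action along weakly convergent sequences. -/
lemma eventually_action_le {ε : ℝ} (hε : 0 < ε) :
    ∀ᶠ n in atTop, action L T U.fn ≤ action L T (u n).fn + ε := by
  obtain ⟨R, hR0, hR, hRU⟩ := PeriodicSpace.exists_common_bound U hQ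
  have hRa : ∀ n, ∀ᵐ t ∂μI T, ‖(u n).fn t‖ ≤ R := fun n => by
    filter_upwards [ae_μI_mem_Icc T] with t ht using hR n t ht
  have hlim := (hL.tendsto_integral_frozen hu hQ U.deriv_mem).add
    (hL.tendsto_integral_gradV_frozen hu hQ)
  rw [add_zero] at hlim
  filter_upwards [hlim.eventually (lt_mem_nhds (sub_lt_self _ hε))] with n hn
  have hi1 := (hL.integrable_comp (u n).mem_LG.1 (hRa n) U.deriv_mem).1
  have hi2 := hG.integrable_inner (hL.gradV_mem hG (u n).mem_LG.1 (hRa n) U.deriv_mem)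
    (u n - U).deriv_mem
  rw [← integral_add hi1 hi2] at hn
  -- Convexity in `v` with the supporting hyperplane at `U̇`; the integral on the left converges to
  -- the action of `U`.
  have h2 : ∫ t, (L t ((u n).fn t) (deriv U.fn t) + inner ℝ (gradV L t ((u n).fn t) (deriv U.fn t))
      (deriv (u n - U).fn t)) ∂μI T ≤ action L T (u n).fn := by
    refine integral_mono_ae (hi1.add hi2) (hL.integrable_action (u n)) ?_
    filter_upwards [ae_μI_mem_Icc T, (u n).deriv_sub_ae U] with t ht hd
    simp only [hd]
    exact hconv t ht _ _ _
  have h3 : action L T U.fn = ∫ t, L t (U.fn t) (deriv U.fn t) ∂μI T := rfl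
  linarith

end IsLagrangian

end AnisotropicEL

/-! ### Weakly convergent almost critical sequences. -/

namespace AnisotropicEL

variable {N : ℕ} {G : E N → ℝ} {T : ℝ} {hG : IsGFunction G} {hT : 0 < T}

lemma PeriodicSpace.exists_modular_deriv_le (hG : IsGFunction G) (hT : 0 < T) (Q : ℝ) :
    ∃ K ≥ 0, ∀ u : PeriodicSpace hG hT, ‖u‖ ≤ Q → ∫ t, G (deriv u.fn t) ∂μI T ≤ K := by
  have hY := hG.isYoung
  obtain ⟨C, hC0, hC⟩ := hY.exists_add_le (|Q| + 1)
  refine ⟨C * (1 + 2 * T), by positivity, fun u hu => ?_⟩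
  set l := |Q| + 1 with hl
  have hl0 : 0 < l := by positivity
  have h1 := hY.modular_le_div_of_normLG_lt u.deriv_mem (l := l)
    ((u.normLG_deriv_le.trans (hu.trans (le_abs_self Q))).trans_lt (lt_add_one _))
  have hi := hY.integrable_smul u.deriv_mem.1 u.deriv_mem.2 l⁻¹
  have h2 : ∫ t, G (deriv u.fn t) ∂μI T ≤ ∫ t, C * (G (l⁻¹ • deriv u.fn t) + 1) ∂μI T := by
    refine integral_mono u.deriv_mem.2 ((hi.add (integrable_const 1)).const_mul C) fun t => ?_
    have := hC l 0 (abs_of_pos hl0).le (by simpa using hl0.le) (l⁻¹ • deriv u.fn t) 0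
    rwa [smul_inv_smul₀ hl0.ne', smul_zero, add_zero, hG.zero, add_zero] at this
  rw [integral_const_mul, integral_add hi (integrable_const 1), integral_const, measureReal_μI hT,
    smul_eq_mul, mul_one] at h2
  refine h2.trans ?_
  gcongr

namespace IsLagrangian

variable {L : ℝ → E N → E N → ℝ} {u : ℕ → PeriodicSpace hG hT} {U : PeriodicSpace hG hT} {Q : ℝ}
  (hL : IsLagrangian G T L) (hu : TendstoWeakly u U) (hQ : ∀ n, ‖u n‖ ≤ Q)
  (hconv : ∀ t ∈ Icc (-T) T, ∀ x v w, L t x v + inner ℝ (gradV L t x v) (w - v) ≤ L t x w)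
  (hcrit : Tendsto (fun n => ‖hL.dAction (u n)‖) atTop (𝓝 0))

include hL hu hQ in
-- The `x`-gradients are bounded in `L¹`, and `u_n - U` tends to zero uniformly.
lemma tendsto_integral_gradX :
    Tendsto (fun n => ∫ t, inner ℝ (gradX L t ((u n).fn t) (deriv (u n).fn t))
      ((u n - U).fn t) ∂μI T) atTop (𝓝 0) := by
  obtain ⟨R, hR0, hR, hRU⟩ := PeriodicSpace.exists_common_bound U hQ
  obtain ⟨K, hK0, hK⟩ := PeriodicSpace.exists_modular_deriv_le hG hT Q
  obtain ⟨B, hB, hB0, hbd⟩ := hL.bound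
  obtain ⟨A, hA, hb⟩ := hbd R
  have hBn : 0 ≤ ∫ t, B t ∂μI T := integral_nonneg_of_ae (by
    filter_upwards [ae_μI_mem_Icc T] with t ht using hB0 t ht)
  set D := A * (∫ t, B t ∂μI T + K) + 1 with hD
  have hD0 : 0 < D := by positivity
  have hX : ∀ n, ∫ t, ‖gradX L t ((u n).fn t) (deriv (u n).fn t)‖ ∂μI T ≤ D := by
    intro n
    have h1 : ∫ t, ‖gradX L t ((u n).fn t) (deriv (u n).fn t)‖ ∂μI T ≤
        ∫ t, A * (B t + G (deriv (u n).fn t)) ∂μI T := by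
      refine integral_mono_ae (hL.integrable_gradX (u n)).norm
        ((hB.add (u n).deriv_mem.2).const_mul A) ?_
      filter_upwards [ae_μI_mem_Icc T] with t ht using (hb t ht _ _ (hR n t ht)).2.1
    rw [integral_const_mul, integral_add hB (u n).deriv_mem.2] at h1
    have h2 : A * (∫ t, B t ∂μI T + ∫ t, G (deriv (u n).fn t) ∂μI T) ≤
        A * (∫ t, B t ∂μI T + K) := by gcongr; exact hK _ (hQ n)
    exact (h1.trans h2).trans (by linarith)
  rw [Metric.tendsto_nhds]
  intro ε hε
  filter_upwards [hu.unif (ε / (2 * D)) (by positivity)] with n hn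
  rw [Real.dist_0_eq_abs]
  have h1 := abs_integral_inner_le_of_bound (hL.integrable_gradX (u n)) (u n - U).mem_LG.1
    (R := ε / (2 * D)) (by filter_upwards [ae_μI_mem_Icc T] with t ht using hn t ht)
  refine h1.trans_lt ?_
  have h2 : (∫ t, ‖gradX L t ((u n).fn t) (deriv (u n).fn t)‖ ∂μI T) * (ε / (2 * D)) ≤
      D * (ε / (2 * D)) := by gcongr; exact hX n
  refine h2.trans_lt ?_
  have : D * (ε / (2 * D)) = ε / 2 := by field_simp
  linarith

include hu hQ hconv hcrit

/-- The action is continuous along weakly convergent almost critical sequences. -/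
lemma tendsto_action_of_dAction :
    Tendsto (fun n => action L T (u n).fn) atTop (𝓝 (action L T U.fn)) := by
  obtain ⟨R, hR0, hR, hRU⟩ := PeriodicSpace.exists_common_bound U hQ
  have hRa : ∀ n, ∀ᵐ t ∂μI T, ‖(u n).fn t‖ ≤ R := fun n => by
    filter_upwards [ae_μI_mem_Icc T] with t ht using hR n t ht
  have h1 : Tendsto (fun n => hL.dAction (u n) (u n - U)) atTop (𝓝 0) := by
    have h2 : Tendsto (fun n => ‖hL.dAction (u n)‖ * (Q + ‖U‖)) atTop (𝓝 0) := by
      simpa using hcrit.mul_const (Q + ‖U‖)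
    refine squeeze_zero_norm (fun n => ?_) h2
    refine ((hL.dAction (u n)).le_opNorm _).trans ?_
    gcongr
    exact (norm_sub_le _ _).trans (by linarith [hQ n])
  -- `J'(u_n)(u_n - U)` tends to zero and so does its `x`-part, which leaves the `v`-part.
  have hV : Tendsto (fun n => ∫ t, inner ℝ (gradV L t ((u n).fn t) (deriv (u n).fn t))
      (deriv (u n - U).fn t) ∂μI T) atTop (𝓝 0) := by
    have h2 := h1.sub (hL.tendsto_integral_gradX hu hQ)
    rw [sub_zero] at h2
    refine h2.congr fun n => ?_
    rw [hL.dAction_apply, integral_add (hL.integrable_inner_gradX _ _)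
      (hL.integrable_inner_gradV _ _)]
    ring
  have hup := (hL.tendsto_integral_frozen hu hQ U.deriv_mem).add hV
  rw [add_zero] at hup
  -- Here the supporting hyperplane is taken at `u̇_n` instead of `U̇`: this yields the upper bound
  -- complementary to lower semicontinuity.
  have hle : ∀ n, action L T (u n).fn ≤ ∫ t, L t ((u n).fn t) (deriv U.fn t) ∂μI T +
      ∫ t, inner ℝ (gradV L t ((u n).fn t) (deriv (u n).fn t)) (deriv (u n - U).fn t) ∂μI T := by
    intro n
    have hi1 := (hL.integrable_comp (u n).mem_LG.1 (hRa n) U.deriv_mem).1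
    have hi2 := hL.integrable_inner_gradV (u n) (u n - U)
    rw [← integral_add hi1 hi2]
    refine integral_mono_ae (hL.integrable_action (u n)) (hi1.add hi2) ?_
    filter_upwards [ae_μI_mem_Icc T, (u n).deriv_sub_ae U] with t ht hd
    have h3 := hconv t ht ((u n).fn t) (deriv (u n).fn t) (deriv U.fn t)
    simp only [hd]
    rw [← neg_sub, inner_neg_right] at h3
    linarith
  rw [Metric.tendsto_nhds]
  intro ε hε
  filter_upwards [hL.eventually_action_le hu hQ hconv (half_pos hε),
    hup.eventually (gt_mem_nhds (lt_add_of_pos_right _ (half_pos hε)))] with n h2 h3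
  rw [Real.dist_eq, abs_sub_lt_iff]
  have h4 : action L T U.fn = ∫ t, L t (U.fn t) (deriv U.fn t) ∂μI T := rfl
  constructor
  · linarith [hle n]
  · linarith

/-- The excess `p n` of `L` over its supporting hyperplane at `U̇` is nonnegative, and its integral
tends to zero because the action converges. A subsequence of excesses has an integrable majorant
`P`, and coercivity converts this into a majorant of `G(u̇_n)`. -/
lemma exists_subseq_deriv_dominated {Λ : ℝ} (hΛ : 0 < Λ)
    (hcoer : ∀ R : ℝ, ∃ D : ℝ → ℝ, Integrable D (μI T) ∧ ∀ t ∈ Icc (-T) T, ∀ x v : E N, ‖x‖ ≤ R →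
      Λ * G v ≤ L t x v + D t) :
    ∃ ψ : ℕ → ℕ, StrictMono ψ ∧ ∃ H : ℝ → ℝ, Integrable H (μI T) ∧
      ∀ᵐ t ∂μI T, ∀ n, G (deriv (u (ψ n)).fn t) ≤ H t := by
  obtain ⟨R, hR0, hR, hRU⟩ := PeriodicSpace.exists_common_bound U hQ
  have hRa : ∀ n, ∀ᵐ t ∂μI T, ‖(u n).fn t‖ ≤ R := fun n => by
    filter_upwards [ae_μI_mem_Icc T] with t ht using hR n t ht
  obtain ⟨D, hD, hDc⟩ := hcoer R
  obtain ⟨B, hB, hB0, hbd⟩ := hL.bound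
  obtain ⟨A, hA, hb⟩ := hbd R
  let p : ℕ → ℝ → ℝ := fun n t => L t ((u n).fn t) (deriv (u n).fn t) -
    (L t ((u n).fn t) (deriv U.fn t) + inner ℝ (gradV L t ((u n).fn t) (deriv U.fn t))
      (deriv (u n - U).fn t))
  have hi1 := fun n => (hL.integrable_comp (u n).mem_LG.1 (hRa n) U.deriv_mem).1
  have hi2 := fun n => hG.integrable_inner
    (hL.gradV_mem hG (u n).mem_LG.1 (hRa n) U.deriv_mem) (u n - U).deriv_mem
  have hpi : ∀ n, Integrable (p n) (μI T) := fun n =>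
    (hL.integrable_action (u n)).sub ((hi1 n).add (hi2 n))
  have hp0 : ∀ n, ∀ᵐ t ∂μI T, 0 ≤ p n t := fun n => by
    filter_upwards [ae_μI_mem_Icc T, (u n).deriv_sub_ae U] with t ht hd
    have h3 := hconv t ht ((u n).fn t) (deriv U.fn t) (deriv (u n).fn t)
    simp only [p, hd]
    linarith
  have hpl : Tendsto (fun n => ∫ t, |p n t| ∂μI T) atTop (𝓝 0) := by
    have h1 := (hL.tendsto_action_of_dAction hu hQ hconv hcrit).sub
      ((hL.tendsto_integral_frozen hu hQ U.deriv_mem).add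
        (hL.tendsto_integral_gradV_frozen hu hQ))
    have h0 : action L T U.fn - (∫ t, L t (U.fn t) (deriv U.fn t) ∂μI T + 0) = 0 := by
      rw [add_zero]; exact sub_self _
    rw [h0] at h1
    refine h1.congr fun n => ?_
    rw [← integral_add (hi1 n) (hi2 n)]
    have h2 : ∫ t, |p n t| ∂μI T = ∫ t, p n t ∂μI T := by
      refine integral_congr_ae ?_
      filter_upwards [hp0 n] with t ht using abs_of_nonneg ht
    rw [h2]
    exact (integral_sub (hL.integrable_action (u n)) ((hi1 n).add (hi2 n))).symm
  obtain ⟨ψ, hψ, hψl⟩ := extraction_forall_of_eventually (fun n =>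
    hpl.eventually (gt_mem_nhds (by positivity : (0 : ℝ) < (1 / 2) ^ n)))
  obtain ⟨P, hPi, hP⟩ := exists_integrable_bound_of_summable (μ := μI T)
    (f := fun n t => |p (ψ n) t|) (fun n => (hpi _).abs) (fun _ _ => abs_nonneg _)
    (Summable.of_nonneg_of_le (fun n => integral_nonneg fun t => abs_nonneg _)
      (fun n => (hψl n).le) (summable_geometric_of_lt_one (by norm_num) (by norm_num)))
  obtain ⟨C, hC0, hC⟩ := hG.isYoung.exists_add_le 1
  -- In the linear term, Fenchel–Young at scale `s` costs `s G(u̇_n - U̇) ≤ (Λ/2)(G(u̇_n) + G(U̇) +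
  -- 1)`. Half of the coercivity absorbs it, whence the factor `2 / Λ` in the majorant.
  set s := Λ / (2 * (C + 1)) with hs
  have hs0 : 0 < s := by positivity
  have hsC : s * C ≤ Λ / 2 := by
    have : s * (C + 1) = Λ / 2 := by rw [hs]; field_simp
    nlinarith
  obtain ⟨C', hC'0, hC'⟩ := hG.isYoung_conj.exists_add_le s⁻¹
  refine ⟨ψ, hψ, fun t => 2 / Λ * (P t + (A * (B t + G (deriv U.fn t)) +
    Λ / 2 * (G (deriv U.fn t) + 1) + s * (C' * (A * (B t + G (deriv U.fn t)) + 1)) + D t)), ?_, ?_⟩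
  · have hg := U.deriv_mem.2
    have hg' : Integrable (fun t => A * (B t + G (deriv U.fn t))) (μI T) := (hB.add hg).const_mul A
    exact (hPi.add (((hg'.add ((hg.add (integrable_const 1)).const_mul _)).add
      (((hg'.add (integrable_const 1)).const_mul C').const_mul s)).add hD)).const_mul _
  · have hd : ∀ᵐ t ∂μI T, ∀ n, deriv (u n - U).fn t = deriv (u n).fn t - deriv U.fn t :=
      ae_all_iff.2 fun n => (u n).deriv_sub_ae U
    filter_upwards [ae_μI_mem_Icc T, hd, hP] with t ht hdt hPt n
    have e1 := (le_abs_self _).trans (hPt.1 n)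
    simp only [p, hdt] at e1
    set x := (u (ψ n)).fn t
    set v := deriv (u (ψ n)).fn t
    set w := deriv U.fn t
    set q := gradV L t x w
    have e2 := hDc t ht x v (hR _ t ht)
    obtain ⟨e3, -, e4⟩ := hb t ht x w (hR _ t ht)
    have e5 := hG.abs_inner_le (v - w) (s⁻¹ • q)
    rw [inner_smul_right, abs_mul, abs_of_pos (inv_pos.2 hs0), inv_mul_le_iff₀ hs0,
      real_inner_comm] at e5
    have e6 := hC 1 (-1) (by simp) (by simp) v w
    rw [one_smul, neg_one_smul, ← sub_eq_add_neg] at e6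
    have e7 := hC' s⁻¹ 0 (abs_of_pos (inv_pos.2 hs0)).le (by simpa using hs0.le) q 0
    rw [smul_zero, add_zero, hG.isYoung_conj.zero, add_zero] at e7
    have e8 : s * G (v - w) ≤ Λ / 2 * (G v + G w + 1) := by
      calc s * G (v - w) ≤ s * (C * (G v + G w + 1)) := by gcongr
        _ = s * C * (G v + G w + 1) := by ring
        _ ≤ _ := by
          have h1 := hG.nonneg v
          have h2 := hG.nonneg w
          gcongr
    have e9 : s * conj G (s⁻¹ • q) ≤ s * (C' * (A * (B t + G w) + 1)) := by
      gcongr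
      exact e7.trans (by gcongr)
    have e10 := (le_abs_self _).trans e3
    have e11 := (le_abs_self _).trans e5
    rw [div_mul_eq_mul_div, le_div_iff₀ hΛ]
    linarith

end IsLagrangian

end AnisotropicEL

/-! ### The weak limit is a critical point. -/

namespace AnisotropicEL

variable {N : ℕ} {G : E N → ℝ} {T : ℝ} {hG : IsGFunction G} {hT : 0 < T}

namespace IsLagrangian

variable {L : ℝ → E N → E N → ℝ}

/-- The derivatives of `z n` need not converge. At almost every time the majorant `H` confines them
to a bounded set, on which the gradients of `L` are uniformly continuous, and it also provides the
domination. -/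
lemma tendsto_dAction_shift (hL : IsLagrangian G T L) {z : ℕ → PeriodicSpace hG hT} {Q : ℝ}
    (hQ : ∀ n, ‖z n‖ ≤ Q) {H : ℝ → ℝ} (hH : Integrable H (μI T))
    (hzH : ∀ᵐ t ∂μI T, ∀ n, G (deriv (z n).fn t) ≤ H t) (φ : PeriodicSpace hG hT) {σ : ℕ → ℝ}
    (hσ : Tendsto σ atTop (𝓝 0)) (hσ1 : ∀ n, |σ n| ≤ 1) :
    Tendsto (fun n => hL.dAction (z n + σ n • φ) φ - hL.dAction (z n) φ) atTop (𝓝 0) := by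
  obtain ⟨R, hR0, hR, hRφ⟩ := PeriodicSpace.exists_common_bound φ hQ
  obtain ⟨B, hB, hB0, hbd⟩ := hL.exists_deriv_bound hG
  obtain ⟨A, hA, hb⟩ := hbd (2 * R)
  obtain ⟨C, hC0, hC⟩ := hG.isYoung.exists_add_le 1
  have heq : ∀ n, hL.dAction (z n + σ n • φ) φ - hL.dAction (z n) φ =
      ∫ t, ((inner ℝ (gradX L t ((z n + σ n • φ).fn t) (deriv (z n + σ n • φ).fn t)) (φ.fn t) +
        inner ℝ (gradV L t ((z n + σ n • φ).fn t) (deriv (z n + σ n • φ).fn t)) (deriv φ.fn t)) -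
        (inner ℝ (gradX L t ((z n).fn t) (deriv (z n).fn t)) (φ.fn t) +
        inner ℝ (gradV L t ((z n).fn t) (deriv (z n).fn t)) (deriv φ.fn t))) ∂μI T := by
    intro n
    rw [hL.dAction_apply, hL.dAction_apply]
    exact (integral_sub ((hL.integrable_inner_gradX _ _).add (hL.integrable_inner_gradV _ _))
      ((hL.integrable_inner_gradX _ _).add (hL.integrable_inner_gradV _ _))).symm
  simp_rw [heq]
  have hd : ∀ᵐ t ∂μI T, ∀ n, deriv (z n + σ n • φ).fn t =
      deriv (z n).fn t + σ n • deriv φ.fn t := ae_all_iff.2 fun n => by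
    filter_upwards [(z n).deriv_add_ae (σ n • φ)] with t ht
    rw [ht, PeriodicSpace.deriv_smul]
  have hbz : ∀ n, ∀ t ∈ Icc (-T) T, ‖(z n + σ n • φ).fn t‖ ≤ 2 * R := by
    intro n t ht
    have h1 : ‖(z n + σ n • φ).fn t‖ ≤ ‖(z n).fn t‖ + ‖σ n • φ.fn t‖ := norm_add_le _ _
    rw [norm_smul, Real.norm_eq_abs] at h1
    have h2 := mul_le_of_le_one_left (norm_nonneg (φ.fn t)) (hσ1 n)
    linarith [hR n t ht, hRφ t ht]
  have h0 : (0 : ℝ) = ∫ _t, (0 : ℝ) ∂μI T := by simp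
  rw [h0]
  refine tendsto_integral_of_dominated_convergence
    (fun t => A * (B t + C * (H t + G (deriv φ.fn t) + 1) + G (deriv φ.fn t)) +
      A * (B t + H t + G (deriv φ.fn t))) (fun n => ?_) ?_ (fun n => ?_) ?_
  · exact (((hL.integrable_inner_gradX _ _).add (hL.integrable_inner_gradV _ _)).sub
      ((hL.integrable_inner_gradX _ _).add (hL.integrable_inner_gradV _ _))).aestronglyMeasurable
  · have hφ := φ.deriv_mem.2
    exact (((hB.add (((hH.add hφ).add (integrable_const 1)).const_mul C)).add hφ).const_mul A).add
      (((hB.add hH).add hφ).const_mul A)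
  · filter_upwards [ae_μI_mem_Icc T, hd, hzH] with t ht hdt hHt
    rw [Real.norm_eq_abs]
    refine (abs_sub _ _).trans (add_le_add ?_ ?_)
    · refine (hb t ht _ _ _ _ (hbz n t ht) ((hRφ t ht).trans (by linarith))).trans ?_
      have h1 := hC 1 (σ n) (by simp) (hσ1 n) (deriv (z n).fn t) (deriv φ.fn t)
      rw [one_smul, ← hdt n] at h1
      gcongr
      exact h1.trans (by gcongr; exact hHt n)
    · refine (hb t ht _ _ _ _ ((hR n t ht).trans (by linarith))
        ((hRφ t ht).trans (by linarith))).trans ?_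
      gcongr
      exact hHt n
  · filter_upwards [ae_μI_mem_Icc T, hd, hzH] with t ht hdt hHt
    obtain ⟨D, hD0, hD⟩ := hG.isYoung.coercive 1 one_pos
    set S := max (2 * R) (H t + D + ‖deriv φ.fn t‖) with hS
    have hv : ∀ n, ‖deriv (z n).fn t‖ ≤ H t + D := fun n => by linarith [hD (deriv (z n).fn t), hHt n]
    have hg : ∀ ε > 0, ∀ᶠ n in atTop,
        ‖gradX L t ((z n + σ n • φ).fn t) (deriv (z n + σ n • φ).fn t) -
          gradX L t ((z n).fn t) (deriv (z n).fn t)‖ ≤ ε ∧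
        ‖gradV L t ((z n + σ n • φ).fn t) (deriv (z n + σ n • φ).fn t) -
          gradV L t ((z n).fn t) (deriv (z n).fn t)‖ ≤ ε := by
      intro ε hε
      obtain ⟨δ, hδ, h⟩ := hL.unif S ε hε
      have hs : ∀ y : E N, ∀ᶠ n in atTop, ‖σ n • y‖ < δ := fun y => by
        have h1 : Tendsto (fun n => ‖σ n • y‖) atTop (𝓝 0) := by
          simpa using (hσ.smul_const y).norm
        exact h1.eventually (gt_mem_nhds hδ)
      filter_upwards [hs (φ.fn t), hs (deriv φ.fn t)] with n h1 h2
      refine h t ht _ _ _ _ ((hbz n t ht).trans (le_max_left _ _))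
        (((hR n t ht).trans (by linarith)).trans (le_max_left _ _)) ?_ ?_ ?_ ?_
      · refine le_trans ?_ (le_max_right _ _)
        rw [hdt n]
        refine (norm_add_le _ _).trans (add_le_add (hv n) ?_)
        rw [norm_smul, Real.norm_eq_abs]
        exact mul_le_of_le_one_left (norm_nonneg _) (hσ1 n)
      · exact ((hv n).trans (le_add_of_nonneg_right (norm_nonneg _))).trans (le_max_right _ _)
      · have : (z n + σ n • φ).fn t - (z n).fn t = σ n • φ.fn t := add_sub_cancel_left _ _
        rwa [this]
      · rw [hdt n, add_sub_cancel_left]; exact h2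
    rw [Metric.tendsto_nhds]
    intro ε hε
    set m := ‖φ.fn t‖ + ‖deriv φ.fn t‖ + 1 with hm
    have hm0 : 0 < m := by positivity
    filter_upwards [hg (ε / (2 * m)) (by positivity)] with n hn
    rw [Real.dist_0_eq_abs]
    have h1 : ∀ a b c d x y : E N, (inner ℝ a x + inner ℝ b y) - (inner ℝ c x + inner ℝ d y) =
        inner ℝ (a - c) x + inner ℝ (b - d) y := fun a b c d x y => by
      rw [inner_sub_left, inner_sub_left]; ring
    rw [h1]
    have h2 := abs_real_inner_le_norm (gradX L t ((z n + σ n • φ).fn t)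
      (deriv (z n + σ n • φ).fn t) - gradX L t ((z n).fn t) (deriv (z n).fn t)) (φ.fn t)
    have h3 := abs_real_inner_le_norm (gradV L t ((z n + σ n • φ).fn t)
      (deriv (z n + σ n • φ).fn t) - gradV L t ((z n).fn t) (deriv (z n).fn t)) (deriv φ.fn t)
    have h4 := mul_le_mul_of_nonneg_right hn.1 (norm_nonneg (φ.fn t))
    have h5 := mul_le_mul_of_nonneg_right hn.2 (norm_nonneg (deriv φ.fn t))
    have h6 : ε / (2 * m) * m = ε / 2 := by field_simp
    have h7 : 0 < ε / (2 * m) := by positivity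
    refine (abs_add_le _ _).trans_lt ?_
    have h8 : ε / (2 * m) * ‖φ.fn t‖ + ε / (2 * m) * ‖deriv φ.fn t‖ ≤ ε / (2 * m) * m := by
      rw [hm]; nlinarith
    linarith

/-- The weak limit of a bounded almost critical sequence is a critical point. -/
theorem dAction_eq_zero_of_tendstoWeakly (hL : IsLagrangian G T L)
    {u : ℕ → PeriodicSpace hG hT} {U : PeriodicSpace hG hT} {Q : ℝ}
    (hu : TendstoWeakly u U) (hQ : ∀ n, ‖u n‖ ≤ Q)
    (hconv : ∀ t ∈ Icc (-T) T, ∀ x v w, L t x v + inner ℝ (gradV L t x v) (w - v) ≤ L t x w)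
    (hcrit : Tendsto (fun n => ‖hL.dAction (u n)‖) atTop (𝓝 0)) {Λ : ℝ} (hΛ : 0 < Λ)
    (hcoer : ∀ R : ℝ, ∃ D : ℝ → ℝ, Integrable D (μI T) ∧ ∀ t ∈ Icc (-T) T, ∀ x v : E N, ‖x‖ ≤ R →
      Λ * G v ≤ L t x v + D t) :
    hL.dAction U = 0 := by
  suffices h : ∀ φ, hL.dAction U φ ≤ 0 by
    ext φ
    refine le_antisymm (h φ) ?_
    have := h (-φ)
    rw [map_neg] at this
    simpa using this
  intro φ
  obtain ⟨ψ, hψ, H, hH, hzH⟩ := hL.exists_subseq_deriv_dominated hu hQ hconv hcrit hΛ hcoer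
  have hz := hu.subseq hψ.tendsto_atTop
  have hzc : Tendsto (fun n => ‖hL.dAction (u (ψ n))‖) atTop (𝓝 0) := hcrit.comp hψ.tendsto_atTop
  have hJ := hL.tendsto_action_of_dAction hz (fun n => hQ _) hconv hzc
  let s : ℕ → ℝ := fun k => 1 / ((k : ℝ) + 1)
  have hs0 : ∀ k, 0 < s k := fun k => by positivity
  have hs1 : ∀ k, s k ≤ 1 := fun k => by
    simp only [s]
    rw [div_le_one (by positivity)]
    have : (0 : ℝ) ≤ k := k.cast_nonneg
    linarith
  have hsl : Tendsto s atTop (𝓝 0) := tendsto_one_div_add_atTop_nhds_zero_nat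
  -- The errors are quadratic in `s k`, so that they still vanish after division by `s k`.
  have hex : ∀ k, ∃ n, action L T (U + s k • φ).fn ≤ action L T (u (ψ n) + s k • φ).fn + s k ^ 2 / 2 ∧
      action L T (u (ψ n)).fn ≤ action L T U.fn + s k ^ 2 / 2 ∧ ‖hL.dAction (u (ψ n))‖ < s k := by
    intro k
    have hk := hs0 k
    have h1 := hL.eventually_action_le (hz.add_const (s k • φ)) (Q := Q + ‖s k • φ‖)
      (fun n => (norm_add_le _ _).trans (by linarith [hQ (ψ n)])) hconv
      (by positivity : 0 < s k ^ 2 / 2)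
    have h2 := hJ.eventually (gt_mem_nhds (lt_add_of_pos_right _ (by positivity : 0 < s k ^ 2 / 2)))
    have h3 := hzc.eventually (gt_mem_nhds hk)
    obtain ⟨n, a, b, c⟩ := (h1.and (h2.and h3)).exists
    exact ⟨n, a, b.le, c⟩
  choose n hn1 hn2 hn3 using hex
  have hseg := fun k => exists_eq_deriv_segment (J := fun u : PeriodicSpace hG hT => action L T u.fn)
    (fun u φ => hL.hasDerivAt_action u φ) (u (ψ (n k))) (s k • φ)
  choose τ hτ hτe using hseg
  have hσ : Tendsto (fun k => τ k * s k) atTop (𝓝 0) :=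
    squeeze_zero (fun k => mul_nonneg (hτ k).1.le (hs0 k).le)
      (fun k => mul_le_of_le_one_left (hs0 k).le (hτ k).2.le) hsl
  have hshift := hL.tendsto_dAction_shift (z := fun k => u (ψ (n k))) (fun k => hQ _) hH
    (by filter_upwards [hzH] with t ht k using ht (n k)) φ hσ (fun k => by
      rw [abs_of_nonneg (mul_nonneg (hτ k).1.le (hs0 k).le)]
      exact (mul_le_of_le_one_left (hs0 k).le (hτ k).2.le).trans (hs1 k))
  have hlow : Tendsto (fun k => (s k)⁻¹ * (action L T (U + s k • φ).fn - action L T U.fn)) atTop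
      (𝓝 (hL.dAction U φ)) := by
    have h1 := (hL.hasDerivAt_action U φ).tendsto_slope_zero.comp
      (tendsto_nhdsWithin_iff.2 ⟨hsl, Eventually.of_forall fun k => (hs0 k).ne'⟩)
    refine h1.congr fun k => ?_
    simp [Function.comp]
  -- An upper bound for the difference quotient at `U`: the change of the derivative along the
  -- segment, plus the size of the almost critical derivative, plus the error `s k`.
  have hup : Tendsto (fun k => (hL.dAction (u (ψ (n k)) + (τ k * s k) • φ) φ -
      hL.dAction (u (ψ (n k))) φ) + s k * ‖φ‖ + s k) atTop (𝓝 0) := by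
    simpa using (hshift.add (hsl.mul_const ‖φ‖)).add hsl
  refine le_of_tendsto_of_tendsto' hlow hup fun k => ?_
  have hk := hs0 k
  have h1 := hτe k
  rw [map_smul, smul_eq_mul, smul_smul] at h1
  have h2 : hL.dAction (u (ψ (n k))) φ ≤ s k * ‖φ‖ :=
    ((le_abs_self _).trans ((hL.dAction (u (ψ (n k)))).le_opNorm φ)).trans
      (mul_le_mul_of_nonneg_right (hn3 k).le (norm_nonneg _))
  rw [inv_mul_le_iff₀ hk]
  have h3 := hn1 k
  have h4 := hn2 k
  have h5 := mul_le_mul_of_nonneg_left h2 hk.le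
  nlinarith

end IsLagrangian

end AnisotropicEL

/-! ### From critical points to the Euler–Lagrange equation. -/

namespace AnisotropicEL

variable {N : ℕ} {G : E N → ℝ} {T : ℝ} {hG : IsGFunction G} {hT : 0 < T}

/-- The du Bois-Reymond lemma. -/
lemma exists_ae_eq_const_of_integral_inner_eq_zero (hT : 0 < T) {h : ℝ → E N}
    (hh : Integrable h (μI T))
    (h0 : ∀ w : ℝ → E N, AEStronglyMeasurable w (μI T) → (∃ M, ∀ t, ‖w t‖ ≤ M) →
      ∫ t, w t ∂μI T = 0 → ∫ t, inner ℝ (h t) (w t) ∂μI T = 0) :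
    ∃ c : E N, ∀ᵐ t ∂μI T, h t = c := by
  set c := (2 * T)⁻¹ • ∫ t, h t ∂μI T with hc
  have hk : Integrable (fun t => h t - c) (μI T) := hh.sub (integrable_const c)
  have hk0 : ∫ t, (h t - c) ∂μI T = 0 := by
    rw [integral_sub hh (integrable_const c), integral_const, measureReal_μI hT, hc, smul_smul,
      mul_inv_cancel₀ (by positivity), one_smul, sub_self]
  -- `h - c` is only integrable, so it is normalised to a bounded test function; the pairing `‖h -
  -- c‖² / (1 + ‖h - c‖)` still vanishes only where `h = c`. Subtracting the mean `m` makes it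
  -- admissible.
  let y : ℝ → E N := fun t => (1 + ‖h t - c‖)⁻¹ • (h t - c)
  have hym : AEStronglyMeasurable y (μI T) := by
    have h1 : AEStronglyMeasurable (fun t => (1 + ‖h t - c‖)⁻¹) (μI T) :=
      ((hk.aestronglyMeasurable.norm.aemeasurable.const_add 1).inv).aestronglyMeasurable
    exact h1.smul hk.aestronglyMeasurable
  have hyb : ∀ t, ‖y t‖ ≤ 1 := fun t => by
    have : 0 ≤ ‖h t - c‖ := norm_nonneg _
    simp only [y]
    rw [norm_smul, Real.norm_of_nonneg (by positivity), inv_mul_le_iff₀ (by positivity)]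
    linarith
  have hyi : Integrable y (μI T) := Integrable.of_bound hym 1 (Eventually.of_forall hyb)
  set m := (2 * T)⁻¹ • ∫ t, y t ∂μI T with hm
  have hw0 : ∫ t, (y t - m) ∂μI T = 0 := by
    rw [integral_sub hyi (integrable_const m), integral_const, measureReal_μI hT, hm, smul_smul,
      mul_inv_cancel₀ (by positivity), one_smul, sub_self]
  have hwb : ∀ t, ‖y t - m‖ ≤ 1 + ‖m‖ := fun t =>
    (norm_sub_le _ _).trans (by linarith [hyb t])
  have hwm : AEStronglyMeasurable (fun t => y t - m) (μI T) := hym.sub aestronglyMeasurable_const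
  have h1 := h0 _ hwm ⟨_, hwb⟩ hw0
  have hint : ∀ (f : ℝ → E N), Integrable f (μI T) → ∀ d : E N,
      ∫ t, inner ℝ (f t) d ∂μI T = inner ℝ (∫ t, f t ∂μI T) d := fun f hf d => by
    rw [real_inner_comm, ← integral_inner hf d]
    simp only [real_inner_comm]
  have h2 : ∫ t, inner ℝ (h t - c) (y t) ∂μI T = 0 := by
    have i1 := integrable_inner_of_bound hh hwm (Eventually.of_forall hwb)
    have i2 : Integrable (fun t => inner ℝ (h t - c) m) (μI T) := hk.inner_const m
    have hwi : Integrable (fun t => y t - m) (μI T) := hyi.sub (integrable_const m)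
    have i3 : Integrable (fun t => inner ℝ c (y t - m)) (μI T) := hwi.const_inner c
    have e : ∀ t, inner ℝ (h t - c) (y t) = inner ℝ (h t) (y t - m) - inner ℝ c (y t - m) +
        inner ℝ (h t - c) m := fun t => by
      rw [← inner_sub_left, ← inner_add_right, sub_add_cancel]
    simp_rw [e]
    have i4 : Integrable (fun t => inner ℝ (h t) (y t - m) - inner ℝ c (y t - m)) (μI T) :=
      i1.sub i3
    rw [integral_add i4 i2, integral_sub i1 i3, h1, hint _ hk, hk0,
      integral_inner hwi c, hw0]
    simp
  have h3 : ∀ t, 0 ≤ inner ℝ (h t - c) (y t) := fun t => by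
    simp only [y]
    rw [inner_smul_right, real_inner_self_eq_norm_sq]
    positivity
  have h4 := (integral_eq_zero_iff_of_nonneg h3
    (integrable_inner_of_bound hk hym (Eventually.of_forall hyb))).1 h2
  refine ⟨c, ?_⟩
  filter_upwards [h4] with t ht
  simp only [y, Pi.zero_apply] at ht
  rw [inner_smul_right, real_inner_self_eq_norm_sq, mul_eq_zero] at ht
  rcases ht with ht | ht
  · have : 0 < 1 + ‖h t - c‖ := by positivity
    exact absurd ht (inv_pos.2 this).ne'
  · exact sub_eq_zero.1 (norm_eq_zero.1 (pow_eq_zero_iff two_ne_zero |>.1 ht))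

/-- Critical points of the action solve the Euler–Lagrange equation. -/
theorem IsLagrangian.isPeriodicSolution {L : ℝ → E N → E N → ℝ} (hL : IsLagrangian G T L)
    {u : PeriodicSpace hG hT} (h : hL.dAction u = 0) : IsPeriodicSolution G L T u.fn := by
  have hr := hL.integrable_gradX u
  have hq := hL.gradV_mem_LG u
  have hqi := hG.isYoung_conj.LG_integrable hq
  set r := fun t => gradX L t (u.fn t) (deriv u.fn t) with hrd
  set q := fun t => gradV L t (u.fn t) (deriv u.fn t) with hqd
  have hP := primitive_ac hT.le 0 hr
  have hPd := primitive_hasDerivAt hT.le 0 hr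
  set P := primitive T 0 r with hPdef
  have hPi := integrable_of_ac hT hP
  -- Primitives of bounded mean-zero functions vanish at both endpoints and serve as test functions.
  -- Integration by parts turns `J'(u) = 0` into orthogonality of `q - P` to all such `w`, so `q`
  -- differs from the primitive `P` of `r` by a constant.
  obtain ⟨c, hc⟩ := exists_ae_eq_const_of_integral_inner_eq_zero hT (hqi.sub hPi) (by
    intro w hwm ⟨M, hM⟩ hw0
    have hwG : w ∈ LG G T := hG.isYoung.LG_of_bound hwm (Eventually.of_forall hM)
    have hwi := hG.isYoung.LG_integrable hwG
    let φ : PeriodicSpace hG hT := PeriodicSpace.mk _ (hG.isYoung.primitive_mem_WLGT hT 0 hwG hw0)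
    have hφ : φ.fn = primitive T 0 w := rfl
    have h1 : hL.dAction u φ = 0 := by rw [h]; rfl
    rw [hL.dAction_apply, integral_add (hL.integrable_inner_gradX u φ)
      (hL.integrable_inner_gradV u φ)] at h1
    have h2 := integral_inner_deriv hT hP φ.ac
    have hφT : φ.fn T = 0 := by rw [hφ, primitive_right hT.le, hw0, add_zero]
    have hφT' : φ.fn (-T) = 0 := by rw [hφ, primitive_neg]
    rw [hφT, hφT', inner_zero_right, inner_zero_right, sub_zero, zero_sub] at h2
    have h3 : ∫ t, inner ℝ (deriv P t) (φ.fn t) ∂μI T = ∫ t, inner ℝ (r t) (φ.fn t) ∂μI T := by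
      refine integral_congr_ae ?_
      filter_upwards [hPd] with t ht
      rw [ht.deriv]
    have hφd : deriv φ.fn =ᵐ[μI T] w := primitive_deriv hT.le 0 hwi
    have h4 : ∫ t, inner ℝ (P t) (deriv φ.fn t) ∂μI T = ∫ t, inner ℝ (P t) (w t) ∂μI T := by
      refine integral_congr_ae ?_
      filter_upwards [hφd] with t ht
      rw [ht]
    have h5 : ∫ t, inner ℝ (q t) (deriv φ.fn t) ∂μI T = ∫ t, inner ℝ (q t) (w t) ∂μI T := by
      refine integral_congr_ae ?_
      filter_upwards [hφd] with t ht
      rw [ht]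
    have h6 : ∫ t, inner ℝ ((q - P) t) (w t) ∂μI T =
        ∫ t, inner ℝ (q t) (w t) ∂μI T - ∫ t, inner ℝ (P t) (w t) ∂μI T := by
      simp only [Pi.sub_apply, inner_sub_left]
      exact integral_sub (integrable_inner_of_bound hqi hwm (Eventually.of_forall hM))
        (integrable_inner_of_bound hPi hwm (Eventually.of_forall hM))
    rw [h6, ← h5, ← h4, h2, h3]
    simp only [r, q]
    linarith)
  refine ⟨u.mem.1, u.mem.2, primitive T c r, primitive_ac hT.le c hr, ?_,
    primitive_hasDerivAt hT.le c hr⟩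
  filter_upwards [hc] with t ht
  have h1 : primitive T c r t = c + P t := by simp [primitive, hPdef]
  rw [h1, ← ht, Pi.sub_apply, sub_add_cancel]

end AnisotropicEL

/-! ### Positivity of the action on the boundary of `Ω`. -/

namespace AnisotropicEL

variable {N : ℕ} {G : E N → ℝ} {T : ℝ} {hG : IsGFunction G} {hT : 0 < T}

lemma IsYoung.jensen (hG : IsYoung G) (hT : 0 < T) {w : ℝ → E N} (hw : w ∈ LG G T) :
    G ((2 * T)⁻¹ • ∫ t, w t ∂μI T) ≤ (2 * T)⁻¹ * ∫ t, G (w t) ∂μI T := by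
  have hne : NeZero (μI T) := ⟨fun h => by
    have h1 := measureReal_μI hT
    rw [h] at h1
    simp only [Measure.real, Measure.coe_zero, Pi.zero_apply, ENNReal.toReal_zero] at h1
    linarith⟩
  have h := hG.convex.map_average_le (μ := μI T) hG.continuous.continuousOn isClosed_univ
    (f := w) (by simp) (hG.LG_integrable hw) hw.2
  rwa [average_eq, average_eq, measureReal_μI hT, smul_eq_mul] at h

/-- Jensen's inequality over all of `I`, applied to the derivative cut off outside the segment;
hence the factor `1/|I|` does not depend on `s` and `t`. -/
lemma IsGFunction.modular_segment_le (hG : IsGFunction G) (hT : 0 < T) {u : ℝ → E N}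
    (hu : AbsolutelyContinuousOnInterval u (-T) T) (hd : deriv u ∈ LG G T) {s t : ℝ}
    (hs : s ∈ Icc (-T) T) (ht : t ∈ Icc (-T) T) :
    G ((2 * T)⁻¹ • (u t - u s)) ≤ (2 * T)⁻¹ * ∫ r, G (deriv u r) ∂μI T := by
  wlog hst : s ≤ t generalizing s t
  · have h := this ht hs (le_of_not_ge hst)
    rwa [← hG.even, ← smul_neg, neg_sub]  at h
  have hsub : Ioc s t ⊆ Icc (-T) T := fun r hr => ⟨hs.1.trans hr.1.le, hr.2.trans ht.2⟩
  have hGi : ∀ r, G ((Ioc s t).indicator (deriv u) r) ≤ G (deriv u r) := fun r => by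
    by_cases hr : r ∈ Ioc s t
    · rw [indicator_of_mem hr]
    · rw [indicator_of_notMem hr, hG.zero]; exact hG.nonneg _
  have hwm : AEStronglyMeasurable ((Ioc s t).indicator (deriv u)) (μI T) :=
    hd.1.indicator measurableSet_Ioc
  have hw : (Ioc s t).indicator (deriv u) ∈ LG G T := by
    refine ⟨hwm, Integrable.mono' hd.2 (hG.isYoung.aestronglyMeasurable_comp hwm) ?_⟩
    refine Eventually.of_forall fun r => ?_
    rw [Real.norm_of_nonneg (hG.nonneg _)]
    exact hGi r
  have h1 := hG.isYoung.jensen hT hw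
  have h2 : ∫ r, (Ioc s t).indicator (deriv u) r ∂μI T = u t - u s := by
    rw [integral_indicator measurableSet_Ioc, Measure.restrict_restrict measurableSet_Ioc,
      inter_eq_self_of_subset_left hsub, ← integral_deriv_interval hT.le hu hs ht,
      intervalIntegral.integral_of_le hst]
  rw [h2] at h1
  refine h1.trans ?_
  exact mul_le_mul_of_nonneg_left (integral_mono hw.2 hd.2 hGi) (by positivity)

lemma Phi_eq {u : ℝ → E N} (hu : u ∈ WLGT G T) :
    Phi G T u = ∫ t, G (deriv u t) ∂μI T + ∫ t, G (u t) ∂μI T :=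
  integral_add (WLGT_deriv hu).2 (WLGT_mem hu).2

/-- `u(t)/(2|I|)` is the midpoint of `u(s)/|I|` and `(u(t) - u(s))/|I|`; apply convexity and average
over `s`. This explains the scaling in (V3), and it is here that `|I| ≥ 1` enters. -/
lemma IsGFunction.apply_le_half_Phi (hG : IsGFunction G) (hT : 1 ≤ 2 * T) {u : ℝ → E N}
    (hu : u ∈ WLGT G T) {t : ℝ} (ht : t ∈ Icc (-T) T) :
    G ((2 * (2 * T))⁻¹ • u t) ≤ Phi G T u / 2 := by
  have hT0 : 0 < T := by linarith
  have hl0 : 0 < (2 * T)⁻¹ := by positivity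
  have hl1 : (2 * T)⁻¹ ≤ 1 := inv_le_one_of_one_le₀ hT
  have hmem := WLGT_mem hu
  have hd := WLGT_deriv hu
  set a := ∫ r, G (deriv u r) ∂μI T with ha
  have ha0 : 0 ≤ a := integral_nonneg fun _ => hG.nonneg _
  have hb0 : 0 ≤ ∫ r, G (u r) ∂μI T := integral_nonneg fun _ => hG.nonneg _
  have h1 : ∀ s ∈ Icc (-T) T,
      G ((2 * (2 * T))⁻¹ • u t) ≤ 1 / 2 * G (u s) + 1 / 2 * ((2 * T)⁻¹ * a) := by
    intro s hs
    have h2 := hG.convex.2 (mem_univ ((2 * T)⁻¹ • u s)) (mem_univ ((2 * T)⁻¹ • (u t - u s)))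
      (by norm_num : (0 : ℝ) ≤ 1 / 2) (by norm_num : (0 : ℝ) ≤ 1 / 2) (by norm_num)
    have h3 : (1 / 2 : ℝ) • ((2 * T)⁻¹ • u s) + (1 / 2 : ℝ) • ((2 * T)⁻¹ • (u t - u s)) =
        (2 * (2 * T))⁻¹ • u t := by
      rw [← smul_add, ← smul_add, add_sub_cancel, smul_smul, mul_inv 2 (2 * T), one_div]
    rw [h3, smul_eq_mul, smul_eq_mul] at h2
    have h4 := hG.modular_segment_le hT0 (WLGT_ac hu) hd hs ht
    have h5 := hG.isYoung.smul_le hl0.le hl1 (u s)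
    have h6 : (2 * T)⁻¹ * G (u s) ≤ G (u s) := mul_le_of_le_one_left (hG.nonneg _) hl1
    linarith
  have h2 : ∫ _s, G ((2 * (2 * T))⁻¹ • u t) ∂μI T ≤
      ∫ s, (1 / 2 * G (u s) + 1 / 2 * ((2 * T)⁻¹ * a)) ∂μI T := by
    refine integral_mono_ae (integrable_const _)
      ((hmem.2.const_mul _).add (integrable_const _)) ?_
    filter_upwards [ae_μI_mem_Icc T] with s hs using h1 s hs
  rw [integral_add (hmem.2.const_mul _) (integrable_const _), integral_const, integral_const,
    integral_const_mul, measureReal_μI hT0, smul_eq_mul, smul_eq_mul] at h2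
  have h3 : 2 * T * (1 / 2 * ((2 * T)⁻¹ * a)) = a / 2 := by field_simp
  have h4 := mul_le_mul_of_nonneg_right hT (hG.nonneg ((2 * (2 * T))⁻¹ • u t))
  rw [Phi_eq hu]
  linarith

variable {F : ℝ → E N → E N → ℝ} {V : ℝ → E N → ℝ} {f : ℝ → E N} {g : ℝ → ℝ} {Λ ρ b : ℝ}

/-- The previous bound makes (V3) available at every time. Fenchel–Young applied to `⟨f, u⟩` costs
one copy of `G(u)`, so `b` is reduced to `b - 1`. -/
lemma le_action_of_Phi_eq (hG : IsGFunction G) (hT : 1 ≤ 2 * T)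
    (hF4 : ∀ t ∈ Icc (-T) T, ∀ x v, Λ * G v ≤ F t x v)
    (hg : IntegrableOn g (Icc (-T) T))
    (hV3 : ∀ t ∈ Icc (-T) T, ∀ x, G ((2 * (2 * T))⁻¹ • x) ≤ ρ / 2 → b * G x - g t ≤ V t x)
    (hf : f ∈ LG (conj G) T) {u : ℝ → E N} (hu : u ∈ WLGT G T)
    (hi : IntegrableOn (fun t => lagr F V f t (u t) (deriv u t)) (Icc (-T) T))
    (hΦ : Phi G T u = ρ) :
    min Λ (b - 1) * ρ - ∫ t in Icc (-T) T, (conj G (f t) + g t) ≤ action (lagr F V f) T u := by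
  have hmem := (WLGT_mem hu).2
  have hd := (WLGT_deriv hu).2
  have hfg : Integrable (fun t => conj G (f t) + g t) (μI T) := hf.2.add hg
  have hs : Integrable (fun t => Λ * G (deriv u t) + (b - 1) * G (u t)) (μI T) :=
    (hd.const_mul Λ).add (hmem.const_mul (b - 1))
  have h1 : ∫ t, ((Λ * G (deriv u t) + (b - 1) * G (u t)) - (conj G (f t) + g t)) ∂μI T ≤
      action (lagr F V f) T u := by
    refine integral_mono_ae (hs.sub hfg) hi ?_
    filter_upwards [ae_μI_mem_Icc T] with t ht
    have h2 := hV3 t ht (u t) ((hG.apply_le_half_Phi hT hu ht).trans (by rw [hΦ]))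
    have h3 := hF4 t ht (u t) (deriv u t)
    have h4 := (neg_abs_le _).trans' (neg_le_neg (hG.abs_inner_le (u t) (f t)))
    rw [real_inner_comm] at h4
    simp only [lagr]
    linarith
  rw [integral_sub hs hfg, integral_add (hd.const_mul Λ) (hmem.const_mul (b - 1)),
    integral_const_mul, integral_const_mul] at h1
  refine le_trans ?_ h1
  rw [Phi_eq hu] at hΦ
  have h5 : 0 ≤ ∫ t, G (deriv u t) ∂μI T := integral_nonneg fun _ => hG.nonneg _
  have h6 : 0 ≤ ∫ t, G (u t) ∂μI T := integral_nonneg fun _ => hG.nonneg _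
  have h7 := mul_le_mul_of_nonneg_right (min_le_left Λ (b - 1)) h5
  have h8 := mul_le_mul_of_nonneg_right (min_le_right Λ (b - 1)) h6
  rw [← hΦ, mul_add]
  linarith

/-- `Φ` is itself the action of the Lagrangian `G(v) + G(x)`, which satisfies the growth conditions.
-/
lemma continuous_Phi (hG : IsGFunction G) (hT : 0 < T) :
    Continuous fun u : PeriodicSpace hG hT => Phi G T u.fn := by
  have hL : IsLagrangian G T (lagr (fun _ _ v => G v) (fun _ x => G x) 0) := by
    refine isLagrangian_lagr hG hT ?_ ⟨fun _ => 1, fun _ => 0, continuousOn_const,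
      fun _ _ => zero_le_one, integrableOn_zero, fun _ _ => le_rfl, fun t _ x v => ⟨?_, ?_, ?_⟩⟩ ?_
      hG.isYoung_conj.LG_zero
    · exact (hG.contDiff.comp (contDiff_snd.comp contDiff_snd)).contDiffOn
    · rw [one_mul, zero_add, abs_of_nonneg (hG.nonneg v)]
    · have h0 : gradX (fun _ _ v => G v) t x v = 0 := by simp [gradX]
      rw [h0, norm_zero, one_mul, zero_add]
      exact hG.nonneg v
    · rw [one_mul, zero_add]
      exact le_rfl
    · exact (hG.contDiff.comp contDiff_snd).contDiffOn
  refine (hL.continuous_action (hG := hG) (hT := hT)).congr fun u => ?_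
  simp [action, Phi, lagr]

lemma Phi_eq_of_mem_boundaryOmega (hG : IsGFunction G) (hT : 0 < T) {w : ℝ → E N}
    (hw : w ∈ boundaryOmega G T ρ) : Phi G T w = ρ := by
  let U : PeriodicSpace hG hT := PeriodicSpace.mk w hw.1
  have hc := (continuous_Phi hG hT).tendsto U
  rcases lt_trichotomy (Phi G T w) ρ with h | h | h
  · obtain ⟨δ, hδ, hb⟩ := Metric.eventually_nhds_iff.1 (hc.eventually (gt_mem_nhds h))
    obtain ⟨v, hv, hvn, hvd⟩ := (hw.2 δ hδ).2
    refine absurd ⟨hv, ?_⟩ hvn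
    refine hb (y := PeriodicSpace.mk v hv) ?_
    rw [dist_eq_norm]
    exact hvd
  · exact h
  · obtain ⟨δ, hδ, hb⟩ := Metric.eventually_nhds_iff.1 (hc.eventually (lt_mem_nhds h))
    obtain ⟨v, hv, hvd⟩ := (hw.2 δ hδ).1
    refine absurd hv.2 (not_lt.2 (le_of_lt ?_))
    refine hb (y := PeriodicSpace.mk v hv.1) ?_
    rw [dist_eq_norm]
    exact hvd

end AnisotropicEL

/-! ### Constants with negative action. -/

namespace AnisotropicEL

variable {N : ℕ} {G : E N → ℝ} {T : ℝ}

/-- If `r φ'(r) ≤ q φ(r)` for `r ≥ 1`, then `φ(r) ≤ r^q φ(1)`. -/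
lemma le_rpow_mul_of_deriv_le {φ φ' : ℝ → ℝ} {q : ℝ} (hφ : ∀ r, HasDerivAt φ (φ' r) r)
    (h : ∀ r, 1 ≤ r → r * φ' r ≤ q * φ r) {r : ℝ} (hr : 1 ≤ r) : φ r ≤ r ^ q * φ 1 := by
  have hd : ∀ x : ℝ, 1 ≤ x → HasDerivAt (fun x => x ^ (-q) * φ x)
      (-q * x ^ (-q - 1) * φ x + x ^ (-q) * φ' x) x := fun x hx =>
    (Real.hasDerivAt_rpow_const (Or.inl (by linarith))).mul (hφ x)
  have hanti : AntitoneOn (fun x => x ^ (-q) * φ x) (Ici 1) := by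
    refine antitoneOn_of_deriv_nonpos (convex_Ici 1)
      (fun x hx => (hd x hx).continuousAt.continuousWithinAt)
      (fun x hx => (hd x (interior_subset hx)).differentiableAt.differentiableWithinAt)
      fun x hx => ?_
    have hx1 : 1 ≤ x := interior_subset hx
    have hx0 : 0 < x := by linarith
    rw [(hd x hx1).deriv, Real.rpow_sub_one hx0.ne']
    have h1 := h x hx1
    have h2 : -q * (x ^ (-q) / x) * φ x + x ^ (-q) * φ' x =
        x ^ (-q) / x * (x * φ' x - q * φ x) := by field_simp; ring
    rw [h2]
    exact mul_nonpos_of_nonneg_of_nonpos (by positivity) (by linarith)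
  have h1 := hanti (mem_Ici.2 le_rfl) (mem_Ici.2 hr) hr
  simp only [Real.one_rpow, one_mul] at h1
  have hr0 : 0 < r := by linarith
  rw [Real.rpow_neg hr0.le, inv_mul_le_iff₀ (by positivity)] at h1
  exact h1

/-- Constants far away have negative action and lie outside `{Φ ≤ ρ}`. -/
lemma exists_const_action_neg (hN : 1 ≤ N) (hT : 0 < T) (hG : IsGFunction G)
    {F : ℝ → E N → E N → ℝ} (hF5 : ∀ t ∈ Icc (-T) T, ∀ x, F t x 0 = 0)
    {V K W : ℝ → E N → ℝ}
    (hV : ContDiffOn ℝ 1 (fun p : ℝ × E N => V p.1 p.2) (Icc (-T) T ×ˢ univ))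
    (hV1 : ∀ t ∈ Icc (-T) T, ∀ x, V t x = K t x - W t x)
    {M εV θV pK : ℝ} (hM : 0 < M) (hε : 0 < εV) (hp : 1 < pK) (hpθ : pK ≤ θV - εV)
    (hV2 : ∀ t ∈ Icc (-T) T, ∀ x, M < ‖x‖ →
        inner ℝ (gradient (V t) x) x ≤ (θV - εV) * K t x - θV * W t x ∧
        K t x < W t x ∧ ‖x‖ ^ pK < K t x)
    {f : ℝ → E N} (hf : Integrable f (μI T)) (ρ : ℝ) :
    ∃ ξ : E N, ρ < Phi G T (fun _ => ξ) ∧ action (lagr F V f) T (fun _ => ξ) < 0 := by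
  obtain ⟨hVd, -⟩ := exists_gradient_potential hT hV
  set q := θV - εV with hq
  have hq1 : 1 < q := hp.trans_le hpθ
  -- `N ≥ 1` supplies a direction; the whole ray from `x₀` outwards stays in the region where (V2)
  -- holds.
  let x₀ : E N := EuclideanSpace.single ⟨0, hN⟩ (M + 1)
  have hx₀ : ‖x₀‖ = M + 1 := by
    simp only [x₀]
    rw [PiLp.norm_single, Real.norm_of_nonneg (by positivity)]
  have hray : ∀ r : ℝ, 1 ≤ r → M < ‖r • x₀‖ := fun r hr => by
    rw [norm_smul, Real.norm_of_nonneg (by linarith), hx₀]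
    nlinarith
  -- Since `W > 0`, (V2) gives `⟨V_x, x⟩ ≤ qK - (q + ε_V)W ≤ qV` on the ray.
  have hgrow : ∀ t ∈ Icc (-T) T, ∀ r : ℝ, 1 ≤ r → V t (r • x₀) ≤ r ^ q * V t x₀ := by
    intro t ht r hr
    have hd : ∀ r : ℝ, HasDerivAt (fun r : ℝ => V t (r • x₀))
        (inner ℝ (gradient (V t) (r • x₀)) x₀) r := fun r => by
      have h1 := (hasDerivAt_id r).smul_const x₀
      rw [one_smul] at h1
      exact (hVd t ht (r • x₀)).comp_hasDerivAt r h1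
    have h := le_rpow_mul_of_deriv_le (q := q) hd (fun s hs => ?_) hr
    · simpa using h
    · obtain ⟨h1, h2, h3⟩ := hV2 t ht (s • x₀) (hray s hs)
      rw [inner_smul_right] at h1
      have h4 : 0 ≤ ‖s • x₀‖ ^ pK := by positivity
      rw [hV1 t ht]
      have h5 : 0 < εV * W t (s • x₀) := mul_pos hε (by linarith)
      have h6 : θV = q + εV := by rw [hq]; ring
      rw [h6] at h1
      linarith
  have hVc : ContinuousOn (fun t => V t x₀) (Icc (-T) T) :=
    hV.continuousOn.comp (continuousOn_id.prodMk continuousOn_const)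
      fun t ht => ⟨ht, mem_univ _⟩
  obtain ⟨t₀, ht₀, hmax⟩ := isCompact_Icc.exists_isMaxOn
    (⟨-T, le_rfl, by linarith⟩ : (Icc (-T) T).Nonempty) hVc
  -- By compactness in time, `V t x₀ ≤ -δ < 0` uniformly.
  set δ := -V t₀ x₀ with hδ
  have hδ0 : 0 < δ := by
    obtain ⟨-, h2, -⟩ := hV2 t₀ ht₀ x₀ (by rw [hx₀]; linarith)
    rw [hδ, hV1 t₀ ht₀]
    linarith
  set D := (∫ t, ‖f t‖ ∂μI T) * (M + 1) with hD
  obtain ⟨C, hC0, hC⟩ := hG.isYoung.coercive 1 one_pos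
  have hpow : ∀ᶠ r : ℝ in atTop, D < 2 * T * δ * r ^ (q - 1) :=
    ((tendsto_rpow_atTop (by linarith : 0 < q - 1)).const_mul_atTop
      (by positivity : 0 < 2 * T * δ)).eventually_gt_atTop D
  have hlin : ∀ᶠ r : ℝ in atTop, ρ / (2 * T) + C < r * (M + 1) :=
    (tendsto_id.atTop_mul_const (by positivity : 0 < M + 1)).eventually_gt_atTop _
  obtain ⟨r, h1, h2, hr⟩ := (hpow.and (hlin.and (eventually_ge_atTop 1))).exists
  have hr0 : 0 < r := by linarith
  have hξn : ‖r • x₀‖ = r * (M + 1) := by rw [norm_smul, Real.norm_of_nonneg hr0.le, hx₀]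
  refine ⟨r • x₀, ?_, ?_⟩
  · have h3 : Phi G T (fun _ => r • x₀) = 2 * T * G (r • x₀) := by
      simp only [Phi, deriv_const, hG.zero, zero_add]
      rw [integral_const, measureReal_μI hT, smul_eq_mul]
    rw [h3]
    have h4 := hC (r • x₀)
    rw [hξn] at h4
    have h5 : ρ / (2 * T) < G (r • x₀) := by linarith
    rwa [div_lt_iff₀' (by positivity)] at h5
  · have hVi : Integrable (fun t => V t (r • x₀)) (μI T) :=
      ContinuousOn.integrableOn_Icc (hV.continuousOn.comp
        (continuousOn_id.prodMk continuousOn_const) fun t ht => ⟨ht, mem_univ _⟩)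
    have hfi : Integrable (fun t => inner ℝ (f t) (r • x₀)) (μI T) := hf.inner_const _
    have h3 : action (lagr F V f) T (fun _ => r • x₀) =
        ∫ t, V t (r • x₀) ∂μI T + ∫ t, inner ℝ (f t) (r • x₀) ∂μI T := by
      rw [← integral_add hVi hfi]
      refine integral_congr_ae ?_
      filter_upwards [ae_μI_mem_Icc T] with t ht
      simp [lagr, hF5 t ht]
    have h4 : ∫ t, V t (r • x₀) ∂μI T ≤ ∫ _t, r ^ q * (-δ) ∂μI T := by
      refine integral_mono_ae hVi (integrable_const _) ?_
      filter_upwards [ae_μI_mem_Icc T] with t ht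
      refine (hgrow t ht r hr).trans ?_
      have : V t x₀ ≤ -δ := by rw [hδ, neg_neg]; exact hmax ht
      gcongr
    rw [integral_const, measureReal_μI hT, smul_eq_mul] at h4
    have h5 := abs_integral_inner_le_of_bound hf
      (aestronglyMeasurable_const (b := r • x₀)) (R := r * (M + 1))
      (Eventually.of_forall fun _ => hξn.le)
    have h6 := (le_abs_self _).trans h5
    have h7 : r ^ q = r ^ (q - 1) * r := by rw [Real.rpow_sub_one hr0.ne']; field_simp
    have h8 := mul_lt_mul_of_pos_right h1 hr0
    rw [h7] at h4
    rw [h3]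
    have h9 : (∫ t, ‖f t‖ ∂μI T) * (r * (M + 1)) = D * r := by rw [hD]; ring
    linarith

end AnisotropicEL

/-! ### Boundedness of almost critical points. -/

namespace AnisotropicEL

variable {N : ℕ} {G : E N → ℝ} {T : ℝ} {hG : IsGFunction G} {hT : 0 < T}

lemma exists_linear_le_rpow {p ε : ℝ} (hp : 1 < p) (hε : 0 < ε) (k : ℝ) :
    ∃ C ≥ 0, ∀ s : ℝ, 0 ≤ s → k * s ≤ ε * s ^ p + C := by
  have h := (tendsto_rpow_atTop (by linarith : 0 < p - 1)).eventually_ge_atTop (k / ε)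
  obtain ⟨S, hS⟩ := eventually_atTop.1 h
  set S₁ := max S 1 with hS₁
  refine ⟨|k| * S₁, by positivity, fun s hs => ?_⟩
  rcases le_total S₁ s with h1 | h1
  · have hs0 : 0 < s := by linarith [le_max_right S 1]
    have h2 := hS s ((le_max_left _ _).trans h1)
    rw [Real.rpow_sub_one hs0.ne', div_le_div_iff₀ hε hs0] at h2
    have : 0 ≤ |k| * S₁ := by positivity
    linarith
  · have h2 : k * s ≤ |k| * S₁ :=
      mul_le_mul (le_abs_self k) h1 hs (abs_nonneg k)
    have : 0 ≤ ε * s ^ p := by positivity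
    linarith

/-- A condition of Ambrosetti–Rabinowitz type. (F3) and (F4) leave `(θ_V - θ_F)Λ G(v)`; (V2) leaves
`ε_V K ≥ ε_V |x|^{p_K}` for large `x`, which is superlinear and so dominates any `k|x|`. The forcing
contributes `(θ_V - 1)⟨f, x⟩`. -/
lemma exists_coercive_bound (hT : 0 < T) {F : ℝ → E N → E N → ℝ}
    (hF : ContDiffOn ℝ 1 (fun p : ℝ × E N × E N => F p.1 p.2.1 p.2.2) (Icc (-T) T ×ˢ univ))
    {θF Λ : ℝ}
    (hF3 : ∀ t ∈ Icc (-T) T, ∀ x v,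
      inner ℝ (gradX F t x v) x + inner ℝ (gradV F t x v) v ≤ θF * F t x v)
    (hF4 : ∀ t ∈ Icc (-T) T, ∀ x v, Λ * G v ≤ F t x v)
    {V K W : ℝ → E N → ℝ}
    (hV : ContDiffOn ℝ 1 (fun p : ℝ × E N => V p.1 p.2) (Icc (-T) T ×ˢ univ))
    (hV1 : ∀ t ∈ Icc (-T) T, ∀ x, V t x = K t x - W t x)
    {M εV θV pK : ℝ} (hM : 0 < M) (hε : 0 < εV) (hθ : θF < θV) (hp : 1 < pK)
    (hV2 : ∀ t ∈ Icc (-T) T, ∀ x, M < ‖x‖ →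
        inner ℝ (gradient (V t) x) x ≤ (θV - εV) * K t x - θV * W t x ∧
        K t x < W t x ∧ ‖x‖ ^ pK < K t x)
    (f : ℝ → E N) (k : ℝ) :
    ∃ C : ℝ, ∀ t ∈ Icc (-T) T, ∀ x v, (θV - θF) * Λ * G v + k * ‖x‖ ≤
      θV * lagr F V f t x v - (inner ℝ (gradX (lagr F V f) t x v) x +
        inner ℝ (gradV (lagr F V f) t x v) v) + |θV - 1| * ‖f t‖ * ‖x‖ + C := by
  obtain ⟨C₁, hC₁, h1⟩ := exists_linear_le_rpow hp hε k
  obtain ⟨A₁, hA₁, hb1⟩ := exists_bound_of_continuousOn hV.continuousOn M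
  obtain ⟨A₂, hA₂, hb2⟩ := exists_bound_of_continuousOn (exists_gradient_potential hT hV).2 M
  have key : ∀ t ∈ Icc (-T) T, ∀ x, k * ‖x‖ ≤ θV * V t x - inner ℝ (gradient (V t) x) x +
      (C₁ + (|θV| * A₁ + A₂ * M + |k| * M)) := by
    intro t ht x
    have hpos : 0 ≤ |θV| * A₁ + A₂ * M + |k| * M := by positivity
    rcases lt_or_ge M ‖x‖ with hx | hx
    · obtain ⟨e1, e2, e3⟩ := hV2 t ht x hx
      have e4 := h1 ‖x‖ (norm_nonneg x)
      have e5 := mul_le_mul_of_nonneg_left e3.le hε.le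
      rw [hV1 t ht x]
      linarith
    · have e1 : |θV * V t x| ≤ |θV| * A₁ := by
        rw [abs_mul]
        exact mul_le_mul_of_nonneg_left (hb1 t ht x hx) (abs_nonneg _)
      have e2 : |inner ℝ (gradient (V t) x) x| ≤ A₂ * M :=
        (abs_real_inner_le_norm _ _).trans
          (mul_le_mul (hb2 t ht x hx) hx (norm_nonneg _) hA₂)
      have e3 : k * ‖x‖ ≤ |k| * M := mul_le_mul (le_abs_self k) hx (norm_nonneg _) (abs_nonneg k)
      have e4 := (abs_le.1 e1).1
      have e5 := (abs_le.1 e2).2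
      linarith
  refine ⟨C₁ + (|θV| * A₁ + A₂ * M + |k| * M), fun t ht x v => ?_⟩
  rw [gradX_lagr hT hF hV ht, gradV_lagr hT hF hV ht, inner_add_left, inner_add_left]
  have e1 := key t ht x
  have e2 := hF3 t ht x v
  have e3 := mul_le_mul_of_nonneg_left (hF4 t ht x v) (sub_nonneg.2 hθ.le)
  have e4 : -(|θV - 1| * ‖f t‖ * ‖x‖) ≤ (θV - 1) * inner ℝ (f t) x := by
    have := abs_real_inner_le_norm (f t) x
    have h2 : |(θV - 1) * inner ℝ (f t) x| ≤ |θV - 1| * (‖f t‖ * ‖x‖) := by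
      rw [abs_mul]; gcongr
    rw [← mul_assoc] at h2
    exact (abs_le.1 h2).1
  simp only [lagr]
  linarith

/-- Almost critical points at bounded level are bounded. -/
theorem IsLagrangian.exists_bound_of_almost_critical {L : ℝ → E N → E N → ℝ}
    (hL : IsLagrangian G T L) (hG : IsGFunction G) (hT : 0 < T) {θ c₁ : ℝ} (hc₁ : 0 < c₁)
    {h : ℝ → ℝ} (hh : Integrable h (μI T)) (hh0 : ∀ t, 0 ≤ h t)
    (hcoer : ∀ k : ℝ, ∃ C : ℝ, ∀ t ∈ Icc (-T) T, ∀ x v, c₁ * G v + k * ‖x‖ ≤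
      θ * L t x v - (inner ℝ (gradX L t x v) x + inner ℝ (gradV L t x v) v) + h t * ‖x‖ + C)
    (c : ℝ) :
    ∃ η > 0, ∃ K R Q : ℝ, ∀ u : PeriodicSpace hG hT, |action L T u.fn| ≤ c →
      ‖hL.dAction u‖ ≤ η → ∫ t, G (deriv u.fn t) ∂μI T ≤ K ∧
        (∀ t ∈ Icc (-T) T, ‖u.fn t‖ ≤ R) ∧ ‖u‖ ≤ Q := by
  obtain ⟨C₂, hC₂, hnorm⟩ := hG.isYoung.exists_normLG_le_of_bound T
  have hi0 : 0 ≤ ∫ t, h t ∂μI T := integral_nonneg hh0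
  -- `D` is the total coefficient of the supremum bound `S = m * a + b₁` of `u`, from the forcing
  -- term and from the norm of `u`.
  set D := ∫ t, h t ∂μI T + C₂ with hD
  have hD0 : 0 ≤ D := by positivity
  set m := (2 * T)⁻¹ with hm
  have hm0 : 0 < m := by positivity
  -- This slope cancels `D * m * a` and leaves one copy of `a`. The choice of `κ` keeps `D * b₁`
  -- below a quarter of `c₁ * b` up to a constant, and the derivative term uses another quarter, so
  -- `c₁ / 2 * b + a ≤ Z` remains.
  obtain ⟨C, hC⟩ := hcoer (D * m + 1)
  set κ := c₁ / (4 * (D + 1)) with hκ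
  have hκ0 : 0 < κ := by positivity
  have hDκ : D * κ ≤ c₁ / 4 := by
    have h1 : (D + 1) * κ = c₁ / 4 := by rw [hκ]; field_simp
    linarith
  obtain ⟨Cκ, hCκ0, hCκ⟩ := hG.isYoung.coercive κ hκ0
  set Z := |θ| * c + 2 * T * C + 1 + 2 * T * (D * Cκ) with hZ
  set R := m * Z + (κ * (2 * Z / c₁) + 2 * T * Cκ) with hR
  refine ⟨min 1 (c₁ / 4), lt_min one_pos (by positivity), 2 * Z / c₁, R, C₂ * R + (2 * Z / c₁ + 1),
    fun u hJ hdJ => ?_⟩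
  set a := ∫ t, ‖u.fn t‖ ∂μI T with ha
  set b := ∫ t, G (deriv u.fn t) ∂μI T with hb
  set b₁ := ∫ t, ‖deriv u.fn t‖ ∂μI T with hb₁
  have hui := hG.isYoung.LG_integrable u.mem_LG
  have hdi := hG.isYoung.LG_integrable u.deriv_mem
  have ha0 : 0 ≤ a := integral_nonneg fun _ => norm_nonneg _
  have hb0 : 0 ≤ b := integral_nonneg fun _ => hG.nonneg _
  have hb₁0 : 0 ≤ b₁ := integral_nonneg fun _ => norm_nonneg _
  set S := m * a + b₁ with hS
  have hS0 : 0 ≤ S := by positivity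
  have hsup : ∀ t ∈ Icc (-T) T, ‖u.fn t‖ ≤ S := fun t ht => by
    have h1 := norm_le_integral hT u.ac ht
    have h2 : ‖u.fn t‖ = m * (2 * T * ‖u.fn t‖) := by rw [hm]; field_simp
    rw [h2]
    refine (mul_le_mul_of_nonneg_left h1 hm0.le).trans (le_of_eq ?_)
    rw [hS, hm, ha, hb₁]; field_simp
  have hsa : ∀ᵐ t ∂μI T, ‖u.fn t‖ ≤ S := by
    filter_upwards [ae_μI_mem_Icc T] with t ht using hsup t ht
  have hb₁b : b₁ ≤ κ * b + 2 * T * Cκ := by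
    have h1 : b₁ ≤ ∫ t, (κ * G (deriv u.fn t) + Cκ) ∂μI T :=
      integral_mono hdi.norm ((u.deriv_mem.2.const_mul κ).add (integrable_const _))
        fun t => hCκ _
    rwa [integral_add (u.deriv_mem.2.const_mul κ) (integrable_const _), integral_const_mul,
      integral_const, measureReal_μI hT, smul_eq_mul] at h1
  have hun : ‖u‖ ≤ C₂ * S + (b + 1) := by
    rw [PeriodicSpace.norm_def]
    exact add_le_add (hnorm _ _ u.mem_LG.1 hS0 hsa)
      (hG.isYoung.normLG_le_modular_add_one u.deriv_mem)
  have hmain : c₁ * b + (D * m + 1) * a ≤ θ * action L T u.fn - hL.dAction u u +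
      (∫ t, h t ∂μI T) * S + 2 * T * C := by
    have i1 := (hL.integrable_action u).const_mul θ
    have i2 := (hL.integrable_inner_gradX u u).add (hL.integrable_inner_gradV u u)
    have i3 := hh.mul_const S
    have i4 := i1.sub i2
    have i5 := (i4.add i3).add (integrable_const C)
    have j1 := u.deriv_mem.2.const_mul c₁
    have j2 := hui.norm.const_mul (D * m + 1)
    have h1 := integral_mono_ae (j1.add j2) i5 (by
      filter_upwards [ae_μI_mem_Icc T] with t ht
      have h2 := hC t ht (u.fn t) (deriv u.fn t)
      have h3 := mul_le_mul_of_nonneg_left (hsup t ht) (hh0 t)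
      simp only [Pi.add_apply, Pi.sub_apply]
      linarith)
    rw [integral_add' j1 j2, integral_add' (i4.add i3) (integrable_const C), integral_add' i4 i3,
      integral_sub' i1 i2, integral_const_mul, integral_const_mul, integral_const_mul,
      integral_mul_const, integral_const, measureReal_μI hT, smul_eq_mul] at h1
    rw [hL.dAction_apply]
    exact h1
  have hθ : θ * action L T u.fn ≤ |θ| * c := by
    refine (le_abs_self _).trans ?_
    rw [abs_mul]
    gcongr
  have hdu : -(hL.dAction u u) ≤ C₂ * S + 1 + c₁ / 4 * b := by
    have h1 : |hL.dAction u u| ≤ min 1 (c₁ / 4) * ‖u‖ :=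
      ((hL.dAction u).le_opNorm u).trans (mul_le_mul_of_nonneg_right hdJ (norm_nonneg _))
    have hη0 : 0 ≤ min 1 (c₁ / 4) := le_min zero_le_one (by positivity)
    have h2 := mul_le_mul_of_nonneg_left hun hη0
    have h3 : min 1 (c₁ / 4) * (C₂ * S + 1) ≤ 1 * (C₂ * S + 1) :=
      mul_le_mul_of_nonneg_right (min_le_left _ _) (by positivity)
    have h4 := mul_le_mul_of_nonneg_right (min_le_right 1 (c₁ / 4)) hb0
    have h5 := neg_le_abs (hL.dAction u u)
    linarith
  have hDb : D * b₁ ≤ c₁ / 4 * b + 2 * T * (D * Cκ) := by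
    have h1 := mul_le_mul_of_nonneg_left hb₁b hD0
    have h2 := mul_le_mul_of_nonneg_right hDκ hb0
    linarith
  have hfin : c₁ / 2 * b + a ≤ Z := by
    have h1 : (∫ t, h t ∂μI T) * S + C₂ * S = D * m * a + D * b₁ := by rw [hS, hD]; ring
    linarith
  have hbZ : b ≤ 2 * Z / c₁ := by
    rw [le_div_iff₀ hc₁]; linarith
  have haZ : a ≤ Z := by
    have : 0 ≤ c₁ / 2 * b := by positivity
    linarith
  have hSR : S ≤ R := by
    have h1 := mul_le_mul_of_nonneg_left haZ hm0.le
    have h2 := mul_le_mul_of_nonneg_left hbZ hκ0.le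
    linarith
  refine ⟨hbZ, fun t ht => (hsup t ht).trans hSR, hun.trans ?_⟩
  have := mul_le_mul_of_nonneg_left hSR hC₂
  linarith

end AnisotropicEL

/-! ### The minimax level and the conclusion. -/

namespace AnisotropicEL

variable {N : ℕ} {G : E N → ℝ} {T : ℝ} {hG : IsGFunction G} {hT : 0 < T}

section Level

variable {J : (ℝ → E N) → ℝ}

lemma isGreatest_pathMax (hJ : Continuous fun u : PeriodicSpace hG hT => J u.fn)
    {γ : ℝ → ℝ → E N} {Γ : C(unitInterval, PeriodicSpace hG hT)}
    (h : ∀ s (hs : s ∈ Icc (0 : ℝ) 1), γ s = (Γ ⟨s, hs⟩).fn) :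
    IsGreatest ((fun s => J (γ s)) '' Icc (0 : ℝ) 1)
      (pathMax (fun u : PeriodicSpace hG hT => J u.fn) Γ) := by
  obtain ⟨s, h1, -⟩ := exists_eq_pathMax hJ Γ
  refine ⟨⟨s, s.2, ?_⟩, ?_⟩
  · simp only [h s s.2]
    exact h1
  · rintro _ ⟨r, hr, rfl⟩
    simp only [h r hr]
    exact le_pathMax hJ Γ ⟨r, hr⟩

/-- Endpoints in `Paths` are prescribed only on `I`, which is the same as up to norm zero in the
seminormed space; so both families of paths have the same maxima. -/
lemma exists_pathSet_of_mem_Paths {e : PeriodicSpace hG hT} {γ : ℝ → ℝ → E N}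
    (hγ : γ ∈ Paths G T e.fn) :
    ∃ Γ ∈ pathSet e, ∀ s (hs : s ∈ Icc (0 : ℝ) 1), γ s = (Γ ⟨s, hs⟩).fn := by
  obtain ⟨hm, hc, h0, h1⟩ := hγ
  let Γ : C(unitInterval, PeriodicSpace hG hT) :=
    ⟨fun s => PeriodicSpace.mk (γ s) (hm s s.2), by
      rw [continuous_iff_continuousAt]
      intro s
      refine tendsto_iff_norm_sub_tendsto_zero.2 ?_
      exact (hc s s.2).comp (tendsto_nhdsWithin_iff.2
        ⟨continuous_subtype_val.tendsto s, Eventually.of_forall fun r => r.2⟩)⟩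
  refine ⟨Γ, ⟨?_, ?_⟩, fun s hs => rfl⟩
  · exact PeriodicSpace.norm_eq_zero_of_eqOn _ h0
  · refine PeriodicSpace.norm_eq_zero_of_eqOn _ fun t ht => ?_
    exact sub_eq_zero.2 (h1 ht)

lemma mem_Paths_of_pathSet {e : PeriodicSpace hG hT}
    {Γ : C(unitInterval, PeriodicSpace hG hT)} (hΓ : Γ ∈ pathSet e) :
    (fun s => (Γ (projIcc 0 1 zero_le_one s)).fn) ∈ Paths G T e.fn := by
  refine ⟨fun s _ => PeriodicSpace.mem _, fun s hs => ?_, ?_, ?_⟩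
  · have h1 : Continuous fun r : ℝ => Γ (projIcc 0 1 zero_le_one r) :=
      Γ.continuous.comp continuous_projIcc
    exact (tendsto_iff_norm_sub_tendsto_zero.1 (h1.tendsto s)).mono_left nhdsWithin_le_nhds
  · simp only [projIcc_left]
    exact PeriodicSpace.eqOn_zero_of_norm_eq_zero _ hΓ.1
  · simp only [projIcc_right]
    intro t ht
    exact sub_eq_zero.1 (PeriodicSpace.eqOn_zero_of_norm_eq_zero _ hΓ.2 ht)

lemma isMountainPassLevel_of_isGLB (hJ : Continuous fun u : PeriodicSpace hG hT => J u.fn)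
    {e : PeriodicSpace hG hT} {c : ℝ}
    (hc : IsGLB (pathMax (fun u : PeriodicSpace hG hT => J u.fn) '' pathSet e) c) :
    IsMountainPassLevel G T J e.fn c := by
  refine ⟨fun γ hγ => ?_, ?_⟩
  · obtain ⟨Γ, -, h⟩ := exists_pathSet_of_mem_Paths hγ
    exact ⟨_, isGreatest_pathMax hJ h⟩
  · convert hc using 1
    ext m
    constructor
    · rintro ⟨γ, hγ, hm⟩
      obtain ⟨Γ, hΓ, h⟩ := exists_pathSet_of_mem_Paths hγ
      exact ⟨Γ, hΓ, (isGreatest_pathMax hJ h).unique hm⟩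
    · rintro ⟨Γ, hΓ, rfl⟩
      refine ⟨_, mem_Paths_of_pathSet hΓ, isGreatest_pathMax hJ fun s hs => ?_⟩
      rw [projIcc_of_mem zero_le_one hs]

end Level

/-- Every path from `0` to a point with `Φ > ρ` crosses `{Φ = ρ}`. -/
lemma exists_Phi_eq {e : PeriodicSpace hG hT} {ρ : ℝ} (hρ : 0 < ρ) (he : ρ < Phi G T e.fn)
    {Γ : C(unitInterval, PeriodicSpace hG hT)} (hΓ : Γ ∈ pathSet e) :
    ∃ s, Phi G T (Γ s).fn = ρ := by
  have hc := continuous_Phi hG hT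
  have hins : ∀ x y : PeriodicSpace hG hT, ‖x - y‖ = 0 → Phi G T x.fn = Phi G T y.fn :=
    fun x y h => by
      have : Inseparable x y := Metric.inseparable_iff.2 (by rw [dist_eq_norm, h])
      exact (this.map hc).eq
  have h0 : Phi G T (Γ 0).fn = 0 := by
    rw [hins (Γ 0) 0 (by simpa using hΓ.1), PeriodicSpace.fn_zero]
    have : deriv (0 : ℝ → E N) = 0 := by ext1 t; exact deriv_const t (0 : E N)
    simp [Phi, this, hG.zero]
  have h1 : Phi G T (Γ 1).fn = Phi G T e.fn := hins _ _ hΓ.2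
  exact mem_range_of_exists_le_of_exists_ge (hc.comp Γ.continuous) ⟨0, by simp [h0, hρ.le]⟩
    ⟨1, by simpa [h1] using he.le⟩

section Lagr

variable {F : ℝ → E N → E N → ℝ} {V : ℝ → E N → ℝ} {f : ℝ → E N}

lemma lagr_add_inner_gradV_le (hT : 0 < T)
    (hF : ContDiffOn ℝ 1 (fun p : ℝ × E N × E N => F p.1 p.2.1 p.2.2) (Icc (-T) T ×ˢ univ))
    (hF1 : ∀ t ∈ Icc (-T) T, ∀ x, ConvexOn ℝ univ (F t x))
    (hV : ContDiffOn ℝ 1 (fun p : ℝ × E N => V p.1 p.2) (Icc (-T) T ×ˢ univ))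
    {t : ℝ} (ht : t ∈ Icc (-T) T) (x v w : E N) :
    lagr F V f t x v + inner ℝ (gradV (lagr F V f) t x v) (w - v) ≤ lagr F V f t x w := by
  have hd : DifferentiableAt ℝ (F t x) v :=
    (HasFDerivAt.comp (g := fun p : E N × E N => F t p.1 p.2) v
      ((exists_gradients hT hF).1 t ht x v) (hasFDerivAt_prodMk_right (𝕜 := ℝ) x v)).differentiableAt
  have h := ConvexOn.add_inner_gradient_le (hF1 t ht x) hd w
  rw [gradV_lagr hT hF hV ht]
  simp only [lagr, gradV]
  linarith

lemma exists_lagr_coercive {Λ : ℝ} (hF4 : ∀ t ∈ Icc (-T) T, ∀ x v, Λ * G v ≤ F t x v)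
    (hV : ContDiffOn ℝ 1 (fun p : ℝ × E N => V p.1 p.2) (Icc (-T) T ×ˢ univ))
    (hf : Integrable f (μI T)) (R : ℝ) :
    ∃ D : ℝ → ℝ, Integrable D (μI T) ∧ ∀ t ∈ Icc (-T) T, ∀ x v : E N, ‖x‖ ≤ R →
      Λ * G v ≤ lagr F V f t x v + D t := by
  obtain ⟨A, -, hb⟩ := exists_bound_of_continuousOn hV.continuousOn R
  refine ⟨fun t => A + ‖f t‖ * R, (integrable_const A).add (hf.norm.mul_const R),
    fun t ht x v hx => ?_⟩
  have h1 := hF4 t ht x v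
  have h2 := (abs_le.1 (hb t ht x hx)).1
  have h3 := (abs_le.1 (abs_real_inner_le_norm (f t) x)).1
  have h4 := mul_le_mul_of_nonneg_left hx (norm_nonneg (f t))
  simp only [lagr]
  linarith

end Lagr

/-- A mountain pass level is attained at a critical point. -/
theorem IsLagrangian.exists_critical_of_isGLB {L : ℝ → E N → E N → ℝ} (hL : IsLagrangian G T L)
    (hconv : ∀ t ∈ Icc (-T) T, ∀ x v w, L t x v + inner ℝ (gradV L t x v) (w - v) ≤ L t x w)
    {Λ : ℝ} (hΛ : 0 < Λ)
    (hcoer : ∀ R : ℝ, ∃ D : ℝ → ℝ, Integrable D (μI T) ∧ ∀ t ∈ Icc (-T) T, ∀ x v : E N, ‖x‖ ≤ R →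
      Λ * G v ≤ L t x v + D t)
    {θ c₁ : ℝ} (hc₁ : 0 < c₁) {h : ℝ → ℝ} (hh : Integrable h (μI T)) (hh0 : ∀ t, 0 ≤ h t)
    (hps : ∀ k : ℝ, ∃ C : ℝ, ∀ t ∈ Icc (-T) T, ∀ x v, c₁ * G v + k * ‖x‖ ≤
      θ * L t x v - (inner ℝ (gradX L t x v) x + inner ℝ (gradV L t x v) v) + h t * ‖x‖ + C)
    {e : PeriodicSpace hG hT} {c : ℝ}
    (hc : IsGLB (pathMax (fun u : PeriodicSpace hG hT => action L T u.fn) '' pathSet e) c)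
    (h0 : action L T (0 : PeriodicSpace hG hT).fn < c) (he : action L T e.fn < c) :
    ∃ U : PeriodicSpace hG hT, hL.dAction U = 0 ∧ action L T U.fn = c := by
  obtain ⟨η, hη, K, R, Q, hb⟩ :=
    hL.exists_bound_of_almost_critical hG hT hc₁ hh hh0 hps (|c| + 1)
  -- The factor `min 1 η` keeps all levels within `|c| + 1` and all derivatives within `η`, so the a
  -- priori bound holds from the first index.
  have hεl : Tendsto (fun n : ℕ => min 1 η * (1 / ((n : ℝ) + 1))) atTop (𝓝 0) := by
    simpa using (tendsto_one_div_add_atTop_nhds_zero_nat (𝕜 := ℝ)).const_mul (min 1 η)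
  have hη1 : 0 < min 1 η := lt_min one_pos hη
  have hε : ∀ n : ℕ, 0 < min 1 η * (1 / ((n : ℝ) + 1)) := fun n => by positivity
  have hεle : ∀ n : ℕ, min 1 η * (1 / ((n : ℝ) + 1)) ≤ min 1 η := fun n => by
    refine mul_le_of_le_one_right hη1.le ?_
    rw [div_le_one (by positivity)]
    have : (0 : ℝ) ≤ n := n.cast_nonneg
    linarith
  choose u hu1 hu2 using fun n => exists_almost_critical
    (J := fun u : PeriodicSpace hG hT => action L T u.fn)
    (fun u φ => hL.hasDerivAt_action u φ) hL.continuous_dAction hc h0 he (hε n)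
  have hu3 := fun n => hb (u n) (by
    have h1 := (hu1 n).trans ((hεle n).trans (min_le_left _ _))
    have h2 := abs_sub_abs_le_abs_sub (action L T (u n).fn) c
    linarith) ((hu2 n).trans ((hεle n).trans (min_le_right _ _)))
  obtain ⟨φ, hφ, U, hU⟩ := exists_weak_limit u (fun n => (hu3 n).1) (fun n => (hu3 n).2.1)
  have hcrit : Tendsto (fun n => ‖hL.dAction (u (φ n))‖) atTop (𝓝 0) :=
    (squeeze_zero (fun _ => norm_nonneg _) hu2 hεl).comp hφ.tendsto_atTop
  have hQ : ∀ n, ‖u (φ n)‖ ≤ Q := fun n => (hu3 _).2.2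
  refine ⟨U, hL.dAction_eq_zero_of_tendstoWeakly hU hQ hconv hcrit hΛ hcoer, ?_⟩
  have h1 := hL.tendsto_action_of_dAction hU hQ hconv hcrit
  have h2 : Tendsto (fun n => action L T (u (φ n)).fn) atTop (𝓝 c) := by
    have h3 : Tendsto (fun n => action L T (u n).fn) atTop (𝓝 c) :=
      tendsto_iff_norm_sub_tendsto_zero.2
        (squeeze_zero (fun _ => norm_nonneg _) (fun n => hu1 n) hεl)
    exact h3.comp hφ.tendsto_atTop
  exact tendsto_nhds_unique h1 h2

lemma IsLagrangian.isCriticalPt {L : ℝ → E N → E N → ℝ} (hL : IsLagrangian G T L)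
    {U : PeriodicSpace hG hT} (h : hL.dAction U = 0) : IsCriticalPt G T (action L T) U.fn := by
  refine ⟨U.mem, fun ε hε => ?_⟩
  obtain ⟨δ, hδ, hb⟩ := exists_abs_sub_deriv_le
    (J := fun u : PeriodicSpace hG hT => action L T u.fn)
    (fun u φ => hL.hasDerivAt_action u φ) hL.continuous_dAction U hε
  refine ⟨δ, hδ, fun φ hφ hn => ?_⟩
  have h1 := hb (PeriodicSpace.mk φ hφ) hn
  rw [h, zero_apply, sub_zero] at h1
  exact h1

end AnisotropicEL

theorem theorem3p1 {N : ℕ} (hN : 1 ≤ N) (T : ℝ) (hT : 1 ≤ 2 * T)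
    (G : E N → ℝ) (hG : IsGFunction G)
    -- the function `F`
    (F : ℝ → E N → E N → ℝ)
    (hF : ContDiffOn ℝ 1 (fun p : ℝ × E N × E N => F p.1 p.2.1 p.2.2) (Icc (-T) T ×ˢ univ))
    (hF1 : ∀ t ∈ Icc (-T) T, ∀ x, ConvexOn ℝ univ (F t x))
    (hF2 : ∃ a β : ℝ → ℝ, ContinuousOn a (Ici 0) ∧ (∀ r, 0 ≤ r → 0 ≤ a r) ∧
      IntegrableOn β (Icc (-T) T) ∧ (∀ t ∈ Icc (-T) T, 0 ≤ β t) ∧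
      ∀ t ∈ Icc (-T) T, ∀ x v,
        |F t x v| ≤ a ‖x‖ * (β t + G v) ∧
        ‖gradX F t x v‖ ≤ a ‖x‖ * (β t + G v) ∧
        conj G (gradV F t x v) ≤ a ‖x‖ * (β t + conj G (gradient G v)))
    (θF : ℝ) (hθF : 0 < θF)
    (hF3 : ∀ t ∈ Icc (-T) T, ∀ x v,
      inner ℝ (gradX F t x v) x + inner ℝ (gradV F t x v) v ≤ θF * F t x v)
    (Λ : ℝ) (hΛ : 0 < Λ)
    (hF4 : ∀ t ∈ Icc (-T) T, ∀ x v, Λ * G v ≤ F t x v)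
    (hF5 : ∀ t ∈ Icc (-T) T, ∀ x, F t x 0 = 0 ∧ gradV F t x 0 = 0)
    -- the potential `V = K - W`
    (V K W : ℝ → E N → ℝ)
    (hV : ContDiffOn ℝ 1 (fun p : ℝ × E N => V p.1 p.2) (Icc (-T) T ×ˢ univ))
    (hV1 : ∀ t ∈ Icc (-T) T, ∀ x, V t x = K t x - W t x)
    (hV2 : ∃ M εV θV pK : ℝ, 0 < M ∧ 0 < εV ∧ θF < θV ∧ 1 < pK ∧ pK ≤ θV - εV ∧
      ∀ t ∈ Icc (-T) T, ∀ x, M < ‖x‖ →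
        inner ℝ (gradient (V t) x) x ≤ (θV - εV) * K t x - θV * W t x ∧
        K t x < W t x ∧ ‖x‖ ^ pK < K t x)
    (ρ b : ℝ) (hρ : 0 < ρ) (hb : 1 < b)
    (g : ℝ → ℝ) (hg : IntegrableOn g (Icc (-T) T))
    (hV3 : ∀ t ∈ Icc (-T) T, ∀ x, G ((2 * (2 * T))⁻¹ • x) ≤ ρ / 2 → b * G x - g t ≤ V t x)
    (hV4 : ∫ t in Icc (-T) T, V t 0 = 0)
    -- the forcing term
    (f : ℝ → E N) (hf : f ∈ LG (conj G) T)
    (hfsmall : ∫ t in Icc (-T) T, (conj G (f t) + g t) < min Λ (b - 1) * ρ) :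
    -- the action functional is well defined
    (∀ u ∈ WLGT G T,
      IntegrableOn (fun t => lagr F V f t (u t) (deriv u t)) (Icc (-T) T)) ∧
    ∃ e ∈ WLGT G T, ∃ c₁ : ℝ, ∃ u : ℝ → E N,
      -- mountain pass geometry with respect to `Ω`
      ρ < Phi G T e ∧ action (lagr F V f) T 0 = 0 ∧ action (lagr F V f) T e < 0 ∧
      (∃ α > 0, ∀ w ∈ boundaryOmega G T ρ, α ≤ action (lagr F V f) T w) ∧
      IsMountainPassLevel G T (action (lagr F V f) T) e c₁ ∧ 0 < c₁ ∧
      -- the solution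
      IsPeriodicSolution G (lagr F V f) T u ∧ (∃ t ∈ Icc (-T) T, u t ≠ 0) ∧
      IsCriticalPt G T (action (lagr F V f) T) u ∧ action (lagr F V f) T u = c₁ := by
  have hT0 : 0 < T := by linarith
  obtain ⟨M, εV, θV, pK, hM, hε, hθ, hp, hpθ, hV2'⟩ := hV2
  have hL : IsLagrangian G T (lagr F V f) := isLagrangian_lagr hG hT0 hF hF2 hV hf
  have hint : ∀ u ∈ WLGT G T,
      IntegrableOn (fun t => lagr F V f t (u t) (deriv u t)) (Icc (-T) T) := fun u hu =>
    hL.integrable_action (PeriodicSpace.mk u hu : PeriodicSpace hG hT0)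
  have hfi : Integrable f (μI T) := hG.isYoung_conj.LG_integrable hf
  have hJ : Continuous fun u : PeriodicSpace hG hT0 => action (lagr F V f) T u.fn :=
    hL.continuous_action
  obtain ⟨ξ, hξΦ, hξJ⟩ := exists_const_action_neg hN hT0 hG (fun t ht x => (hF5 t ht x).1) hV hV1
    hM hε hp hpθ hV2' hfi ρ
  let e : PeriodicSpace hG hT0 := PeriodicSpace.mk (fun _ => ξ) (hG.isYoung.WLGT_const ξ)
  have h0 : action (lagr F V f) T 0 = 0 := by
    have hd : deriv (0 : ℝ → E N) = 0 := by ext1 t; exact deriv_const t (0 : E N)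
    rw [← hV4]
    refine integral_congr_ae ?_
    filter_upwards [ae_μI_mem_Icc T] with t ht
    simp [lagr, hd, (hF5 t ht 0).1]
  have hα : 0 < min Λ (b - 1) * ρ - ∫ t in Icc (-T) T, (conj G (f t) + g t) :=
    sub_pos.2 hfsmall
  set α := min Λ (b - 1) * ρ - ∫ t in Icc (-T) T, (conj G (f t) + g t)
  have hbd : ∀ u ∈ WLGT G T, Phi G T u = ρ → α ≤ action (lagr F V f) T u := fun u hu hΦ =>
    le_action_of_Phi_eq hG hT hF4 hg hV3 hf hu (hint u hu) hΦ
  have hlow : α ∈ lowerBounds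
      (pathMax (fun u : PeriodicSpace hG hT0 => action (lagr F V f) T u.fn) '' pathSet e) := by
    rintro _ ⟨Γ, hΓ, rfl⟩
    obtain ⟨s, hs⟩ := exists_Phi_eq hρ (e := e) hξΦ hΓ
    exact (hbd _ (Γ s).mem hs).trans (le_pathMax hJ Γ s)
  have hglb := isGLB_csInf (Set.Nonempty.image
    (pathMax fun u : PeriodicSpace hG hT0 => action (lagr F V f) T u.fn)
    ⟨_, segmentPath_mem e⟩) ⟨α, hlow⟩
  set c := sInf (pathMax (fun u : PeriodicSpace hG hT0 => action (lagr F V f) T u.fn) '' pathSet e)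
  have hc : 0 < c := hα.trans_le (hglb.2 hlow)
  obtain ⟨U, hU, hUc⟩ := hL.exists_critical_of_isGLB
    (fun t ht x v w => lagr_add_inner_gradV_le hT0 hF hF1 hV ht x v w) hΛ
    (exists_lagr_coercive hF4 hV hfi) (mul_pos (sub_pos.2 hθ) hΛ)
    (hfi.norm.const_mul |θV - 1|) (fun t => by positivity)
    (exists_coercive_bound hT0 hF hF3 hF4 hV hV1 hM hε hθ hp hV2' f) hglb
    (h0.trans_lt hc) (hξJ.trans hc)
  refine ⟨hint, e.fn, e.mem, c, U.fn, hξΦ, h0, hξJ,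
    ⟨α, hα, fun w hw => hbd w hw.1 (Phi_eq_of_mem_boundaryOmega hG hT0 hw)⟩,
    isMountainPassLevel_of_isGLB hJ hglb, hc, hL.isPeriodicSolution hU, ?_, hL.isCriticalPt hU, hUc⟩
  -- If `U` vanished on `I`, its action would be `J(0) = 0`, whereas it equals the positive level
  -- `c`.
  by_contra! hzero
  have h1 : action (lagr F V f) T U.fn = action (lagr F V f) T 0 := by
    refine integral_congr_ae ?_
    filter_upwards [ae_μI_mem_Icc T, deriv_congr_ae (u := U.fn) (v := 0) hzero] with t ht hd
    rw [hzero t ht, hd]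
    rfl
  rw [hUc, h0] at h1
  exact hc.ne' h1
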